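/- Let $q$ be a fixed odd prime power. For $g\ge 0$ let $\mathcal H_{2g+1,q}$ be the set of monic square-free polynomials of degree $2g+1$ in $\mathbb F_q[x]$, and put $|f|=q^{\deg f}$ for $f\ne 0$, so that $|D|=q^{2g+1}$ for $D\in\mathcal H_{2g+1,q}$. Let $\chi_D(f)=\left(\frac{D}{f}\right)$ be the quadratic (Jacobi) character, and let $$L(s,\chi_D)=\sum_{n\ge 0}\Big(\sum_{f\ \mathrm{monic},\ \deg f=n}\chi_D(f)\Big)q^{-ns},$$ which is a polynomial in $q^{-s}$. Let $\zeta_A(s)=\frac1{1-q^{1-s}}$, $X(s)=q^{-1/2+s}$, and $$A_D(\alpha;\gamma)=\prod_{P\ \mathrm{monic\ irreducible}}\Big(1-\tfrac1{|P|^{1+\alpha+\gamma}}\Big)^{-1}\Big(1-\tfrac1{(|P|+1)|P|^{1+2\alpha}}-\tfrac1{(|P|+1)|P|^{\alpha+\gamma}}\Big),\qquad A_D'(r;r)=\tfrac{\partial}{\partial\alpha}A_D(\alpha;\gamma)\Big|_{\alpha=\gamma=r}.$$ **Assume the ratios conjecture:** for all constants $c,C,\varepsilon>0$, as $g\to\infty$,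 $$\sum_{D\in\mathcal H_{2g+1,q}}\frac{L(\frac12+\alpha,\chi_D)}{L(\frac12+\gamma,\chi_D)}=\sum_{D\in\mathcal H_{2g+1,q}}\Big(\frac{\zeta_A(1+2\alpha)}{\zeta_A(1+\alpha+\gamma)}A_D(\alpha;\gamma)+|D|^{-\alpha}X(\tfrac12+\alpha)\frac{\zeta_A(1-2\alpha)}{\zeta_A(1-\alpha+\gamma)}A_D(-\alpha;\gamma)\Big)+o(|D|)$$ uniformly for $-\frac14<\Re\alpha<\frac14$, $\frac{c}{\log|D|}\le\Re\gamma<\frac14$, $|\Im\alpha|,|\Im\gamma|\le C|D|^{1-\varepsilon}$ (apart from the removable singularities $q^{2\alpha}=1$). Let $\gamma_D$ run over the ordinates, in $(-\pi/\log q,\pi/\log q]$, of the zeros of $L(s,\chi_D)$, counted with multiplicity. **(1)** Let $f$ be an even, $(2\pi/\log q)$-periodic function that is holomorphic in a strip $|\Im z|<\delta$ for some $\delta>0$. Then, as $g\to\infty$, $$\sum_{D\in\mathcal H_{2g+1,q}}\sum_{\gamma_D}f(\gamma_D)=\frac1{2\pi}\int_{-\pi/\log q}^{\pi/\log q}f(t)\sum_{D\in\mathcal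 H_{2g+1,q}}\Big(\log|D|-\frac{X'}{X}(\tfrac12-it)+2\Big(\frac{\zeta_A'(1+2it)}{\zeta_A(1+2it)}+A_D'(it;it)-(\log q)|D|^{-it}X(\tfrac12+it)\zeta_A(1-2it)A_D(-it;it)\Big)\Big)dt+o(|D|),$$ where the integrand is integrable for every $g$. **(2)** Let $h:\mathbb R\to\mathbb C$ be continuous and even with $h(x)=O(1/(1+x^2))$. Then $$\lim_{g\to\infty}\frac1{\#\mathcal H_{2g+1,q}}\sum_{D\in\mathcal H_{2g+1,q}}\sum_{\gamma_D}h\Big(\gamma_D\,\frac{2g\log q}{2\pi}\Big)=\int_{-\infty}^{\infty}h(\tau)\Big(1-\frac{\sin(2\pi\tau)}{2\pi\tau}\Big)d\tau .$$ -/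

import Mathlib

open Polynomial Filter Topology Asymptotics

namespace HyperellipticEnsemble

noncomputable section

/-- There are finitely many monic polynomials of a given degree over a finite field. -/
theorem finite_monic_natDegree (F : Type*) [Field F] [Fintype F] (n : ℕ) :
    {f : F[X] | f.Monic ∧ f.natDegree = n}.Finite := by
  refine Set.Finite.subset (Set.finite_range
    (fun c : Fin (n + 1) → F => ∑ i : Fin (n + 1), Polynomial.monomial (i : ℕ) (c i))) ?_
  rintro f ⟨-, hn⟩
  refine ⟨fun i => f.coeff i, ?_⟩
  have h := f.as_sum_range' (n + 1) (by omega)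
  rw [Finset.sum_range] at h
  exact h.symm

/-- The monic polynomials of degree `n` in `𝔽_q[x]`. -/
def monicOfDegree (F : Type*) [Field F] [Fintype F] (n : ℕ) : Finset F[X] :=
  (finite_monic_natDegree F n).toFinset

open Classical in
/-- The hyperelliptic ensemble `H_{2g+1,q}`: monic square-free polynomials of degree `2g+1`. -/
def ensemble (F : Type*) [Field F] [Fintype F] (g : ℕ) : Finset F[X] :=
  (monicOfDegree F (2 * g + 1)).filter Squarefree

/-- The norm `|f| = q ^ deg f` of a polynomial `f ≠ 0`, and `|0| = 0`. -/
def polyNorm {F : Type*} [Field F] [Fintype F] (f : F[X]) : ℝ :=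
  open Classical in if f = 0 then 0 else (Fintype.card F : ℝ) ^ f.natDegree

open Classical in
/-- The quadratic residue symbol `(D / P)` for a prime polynomial `P`: it is `0` if `P ∣ D`, and
otherwise `1` or `-1` according to whether `D` is a square modulo `P`. -/
def residueSymbol {F : Type*} [Field F] (D P : F[X]) : ℤ :=
  if P ∣ D then 0 else if ∃ h : F[X], P ∣ D - h ^ 2 then 1 else -1

open Classical in
/-- The quadratic character `χ_D(f) = (D / f)` on monic polynomials `f` (Jacobi symbol): the product
of `(D / P)` over the monic irreducible factors `P` of `f`, with multiplicity. -/
def quadChar {F : Type*} [Field F] (D f : F[X]) : ℤ :=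
  ((UniqueFactorizationMonoid.normalizedFactors f).map (residueSymbol D)).prod

/-- `A_D(n)`, the sum of `χ_D(f)` over the monic `f` of degree `n`. -/
def charSum {F : Type*} [Field F] [Fintype F] (D : F[X]) (n : ℕ) : ℤ :=
  ∑ f ∈ monicOfDegree F n, quadChar D f

/-- `𝓛(u, χ_D) = ∑ A_D(n) u ^ n`. For a non-square `D` of positive degree only finitely many of
the coefficients are nonzero, so the sum makes sense for all complex `u`. -/
def LPoly {F : Type*} [Field F] [Fintype F] (D : F[X]) (u : ℂ) : ℂ :=
  ∑' n : ℕ, (charSum D n : ℂ) * u ^ n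

/-- `L(s, χ_D) = 𝓛(q ^ (-s), χ_D)`. -/
def LFun {F : Type*} [Field F] [Fintype F] (D : F[X]) (s : ℂ) : ℂ :=
  LPoly D ((Fintype.card F : ℂ) ^ (-s))

/-- The zeta function `ζ_A(s) = 1 / (1 - q ^ (1 - s))` of `A = 𝔽_q[x]`, i.e. the meromorphic
continuation of `∑ |f| ^ (-s)`, the sum being over all monic `f`. -/
def zetaA (F : Type*) [Fintype F] (s : ℂ) : ℂ :=
  1 / (1 - (Fintype.card F : ℂ) ^ (1 - s))

/-- `X(s) = q ^ (-1/2 + s)`; the functional equation of the `L`-functions of the ensemble is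
`L(s, χ_D) = |D| ^ (1/2 - s) X(s) L(1 - s, χ_D)`. -/
def XFactor (F : Type*) [Fintype F] (s : ℂ) : ℂ :=
  (Fintype.card F : ℂ) ^ (-1 / 2 + s)

/-- The Euler product `A_D(α; γ)` over the monic irreducible polynomials. -/
def eulerA (F : Type*) [Field F] [Fintype F] (α γ : ℂ) : ℂ :=
  ∏' P : {P : F[X] // P.Monic ∧ Irreducible P},
    (1 - 1 / (polyNorm P.1 : ℂ) ^ (1 + α + γ))⁻¹ *
      (1 - 1 / (((polyNorm P.1 : ℂ) + 1) * (polyNorm P.1 : ℂ) ^ (1 + 2 * α))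
        - 1 / (((polyNorm P.1 : ℂ) + 1) * (polyNorm P.1 : ℂ) ^ (α + γ)))

/-- `A_D'(r; r)`: the derivative of `A_D(α; γ)` in `α`, at `α = γ = r`. -/
def eulerA' (F : Type*) [Field F] [Fintype F] (r : ℂ) : ℂ :=
  deriv (fun α => eulerA F α r) r

/-- The main term that the ratios conjecture predicts for `L(1/2+α, χ_D) / L(1/2+γ, χ_D)`. -/
def ratioMainTerm {F : Type*} [Field F] [Fintype F] (D : F[X]) (α γ : ℂ) : ℂ :=
  zetaA F (1 + 2 * α) / zetaA F (1 + α + γ) * eulerA F α γ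
    + (polyNorm D : ℂ) ^ (-α) * XFactor F (1 / 2 + α)
      * (zetaA F (1 - 2 * α) / zetaA F (1 - α + γ)) * eulerA F (-α) γ

/-- The ratios conjecture with one `L`-function in the numerator and one in the denominator: for
`-1/4 < Re α < 1/4`, `1 / log |D| ≪ Re γ < 1/4` and `Im α, Im γ ≪ |D| ^ (1 - ε)`, for any `ε > 0`,
the sum of the ratios is the sum of the main terms up to an error `o(|D|)`, as `g → ∞` with `q`
fixed. The error is uniform in `α, γ` for fixed `ε` and fixed implied constants `c`, `C`.
At the points with `q ^ (2α) = 1` the two parts of the main term have poles that cancel. These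
removable singularities are left out. -/
def RatiosConjecture (F : Type*) [Field F] [Fintype F] : Prop :=
  ∀ c > (0 : ℝ), ∀ ε > (0 : ℝ), ∀ C > (0 : ℝ), ∀ κ > (0 : ℝ), ∀ᶠ g : ℕ in atTop,
    ∀ normD : ℝ, normD = (Fintype.card F : ℝ) ^ (2 * g + 1) →
    ∀ α γ : ℂ, -1 / 4 < α.re → α.re < 1 / 4 →
      c / Real.log normD ≤ γ.re → γ.re < 1 / 4 →
      |α.im| ≤ C * normD ^ (1 - ε) → |γ.im| ≤ C * normD ^ (1 - ε) →
      (Fintype.card F : ℂ) ^ (2 * α) ≠ 1 →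
      ‖∑ D ∈ ensemble F g, LFun D (1 / 2 + α) / LFun D (1 / 2 + γ)
          - ∑ D ∈ ensemble F g, ratioMainTerm D α γ‖ ≤ κ * normD

/-- The zeros of `L(s, χ_D)` in one period `-π / log q < Im s ≤ π / log q`. (By the Riemann
hypothesis for curves over finite fields, they all have real part `1/2`.) -/
def zeroSet {F : Type*} [Field F] [Fintype F] (D : F[X]) : Set ℂ :=
  {ρ : ℂ | LFun D ρ = 0 ∧ ρ.im ∈ Set.Ioc (-(Real.pi / Real.log (Fintype.card F)))
    (Real.pi / Real.log (Fintype.card F))}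

/-- `∑ φ(γ_D)`, over the ordinates `γ_D` of the zeros of `L(s, χ_D)` in one period, each zero
being counted with its multiplicity. -/
def zeroSum {F : Type*} [Field F] [Fintype F] (D : F[X]) (φ : ℝ → ℂ) : ℂ :=
  ∑ᶠ ρ ∈ zeroSet D, (analyticOrderNatAt (LFun D) ρ : ℂ) * φ ρ.im

/-- The one-level density `S₁(f)`, the sum of `f(γ_D)` over the zeros of all the `L(s, χ_D)` with
`D` in the ensemble. -/
def oneLevelDensity (F : Type*) [Field F] [Fintype F] (g : ℕ) (f : ℝ → ℂ) : ℂ :=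
  ∑ D ∈ ensemble F g, zeroSum D f

/-- The density that the integral formula predicts for the zeros of `L(s, χ_D)`. -/
def densityIntegrand {F : Type*} [Field F] [Fintype F] (D : F[X]) (t : ℝ) : ℂ :=
  (Real.log (polyNorm D) : ℂ) - logDeriv (XFactor F) (1 / 2 - Complex.I * t)
    + 2 * (logDeriv (zetaA F) (1 + 2 * (Complex.I * t)) + eulerA' F (Complex.I * t)
      - (Real.log (Fintype.card F) : ℂ) * (polyNorm D : ℂ) ^ (-(Complex.I * t))
        * XFactor F (1 / 2 + Complex.I * t) * zetaA F (1 - 2 * (Complex.I * t))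
        * eulerA F (-(Complex.I * t)) (Complex.I * t))

end

end HyperellipticEnsemble

open HyperellipticEnsemble

/-! In the variable y = q^(1/2-s) each L-function of the ensemble is a polynomial of degree 2g with
constant term 1, and its zeros are permuted by y ↦ 1/y. Both facts come from writing the Jacobi
symbol as the quadratic character of a resultant (`quadChar_eq_resultant`): exchanging the arguments
gives reciprocity, and a Gauss sum modulo D gives the functional equation
(`exists_resSum_functional_equation`). The Riemann hypothesis for curves is not used. What replaces
it is extracted from the ratios conjecture.

On the annulus q^(-1/4) < |y| < 1 (`RatiosConjecture.disc`), Cauchy's estimate in the numerator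
variable turns the conjecture into an asymptotic for the average of L'/L
(`RatiosConjecture.norm_sum_logDeriv_le`). A zero would be a pole of this average, since positive
multiplicities cannot cancel. Hence every zero with q^(-1/4) < |y| < q^(1/4) is, for large g, within
O(c₀/g) of the unit circle, for any fixed c₀ > 0 (`RatiosConjecture.norm_midRoots`). Counting these
zeros by a contour integral and comparing with the degree 2g leaves only o(|D|) other zeros in the
whole ensemble (`RatiosConjecture.sum_card_outliers_le`).

For part (1), f becomes a holomorphic function on an annulus around the unit circle, invariant under
inversion. The residue theorem and the functional equation express its sum over the near zeros by
L'/L on a single inner circle, where the conjecture applies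
(`RatiosConjecture.norm_sum_midRoots_sub_le`). The main term extends holomorphically across the unit
circle, so the contour moves out to it and becomes the stated integral (`integral_density_eq`).
Replacing the complex zeros by their ordinates and adding the outliers costs o(|D|)
(`RatiosConjecture.norm_oneLevelDensity_sub_le`).

For part (2), h is merely continuous, so no contour can be moved. Instead, the real part of L'/L at
|y| = exp(-πε/g) is, up to normalization, a sum of Poisson kernels of width about ε on the scale of
the mean spacing. Its average tends to the density 1 + Re((exp(-w) - 1)/w) with w = 2π(ε - iτ)
(`RatiosConjecture.tendsto_zeroAvg_circleKernel`), and ε → 0 gives 1 - sin(2πτ)/(2πτ). Positivity of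
the kernel bounds the zeros against a Cauchy weight (`RatiosConjecture.zeroAvg_cauchy_le`), which
controls both the smoothing error and the tail of h. -/

namespace HyperellipticEnsemble

/-! ### Resultants, norms and the Jacobi symbol. -/

section Algebra

variable {F : Type*} [Field F]

/-- Over an algebraic closure D splits, and being monic it contributes no power of a leading
coefficient. Multiplicativity in both arguments and invariance modulo D are read off from this
formula, even though the default degree arguments of `resultant` change with f. -/
theorem algebraMap_resultant {D f : F[X]} (hD : D.Monic) :
    algebraMap F (AlgebraicClosure F) (resultant D f) =
      ((D.aroots (AlgebraicClosure F)).map (fun θ => aeval θ f)).prod := by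
  have h := resultant_eq_prod_eval (D.map (algebraMap F (AlgebraicClosure F)))
    (f.map (algebraMap F (AlgebraicClosure F))) f.natDegree natDegree_map_le
    (IsAlgClosed.splits _)
  rw [natDegree_map, resultant_map_map, (hD.map _).leadingCoeff, one_pow, one_mul] at h
  rw [h]
  simp [aroots, eval_map_algebraMap]

theorem resultant_mul_right_of_monic {D : F[X]} (hD : D.Monic) (f g : F[X]) :
    resultant D (f * g) = resultant D f * resultant D g := by
  apply (algebraMap F (AlgebraicClosure F)).injective
  rw [map_mul, algebraMap_resultant hD, algebraMap_resultant hD, algebraMap_resultant hD]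
  simp

theorem resultant_mul_left_of_monic {D E : F[X]} (hD : D.Monic) (hE : E.Monic) (f : F[X]) :
    resultant (D * E) f = resultant D f * resultant E f := by
  apply (algebraMap F (AlgebraicClosure F)).injective
  rw [map_mul, algebraMap_resultant hD, algebraMap_resultant hE, algebraMap_resultant (hD.mul hE),
    aroots_mul (mul_ne_zero hD.ne_zero hE.ne_zero)]
  simp

theorem resultant_eq_of_dvd_sub {D f g : F[X]} (hD : D.Monic) (h : D ∣ f - g) :
    resultant D f = resultant D g := by
  apply (algebraMap F (AlgebraicClosure F)).injective
  rw [algebraMap_resultant hD, algebraMap_resultant hD]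
  congr 1
  refine Multiset.map_congr rfl fun θ hθ => ?_
  obtain ⟨k, hk⟩ := h
  have h0 : aeval θ D = 0 := (mem_aroots.1 hθ).2
  have : aeval θ (f - g) = 0 := by rw [hk, map_mul, h0, zero_mul]
  rwa [map_sub, sub_eq_zero] at this

theorem resultant_C_of_monic {D : F[X]} (hD : D.Monic) (c : F) :
    resultant D (C c) = c ^ D.natDegree := by
  rw [resultant_C_right]; simp [hD.leadingCoeff]

variable [Fintype F]

theorem ringChar_ne_two (hq : Odd (Fintype.card F)) : ringChar F ≠ 2 := by
  intro h
  have := FiniteField.even_card_of_char_two h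
  rw [Nat.odd_iff] at hq
  omega

/-- The norm is a product over the embeddings of F[X]/P. These correspond to the roots of P, which
are distinct because a finite field is perfect. -/
theorem algebraMap_norm_adjoinRoot {P : F[X]} (hP : P.Monic) (hirr : Irreducible P) (f : F[X]) :
    Algebra.norm F (AdjoinRoot.mk P f) = resultant P f := by
  have : Fact (Irreducible P) := ⟨hirr⟩
  have := (AdjoinRoot.powerBasis hirr.ne_zero).finite
  have : Finite (AdjoinRoot P) := Module.finite_of_finite F
  apply (algebraMap F (AlgebraicClosure F)).injective
  rw [Algebra.norm_eq_prod_embeddings, algebraMap_resultant hP]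
  have hsep : P.Separable := PerfectField.separable_of_irreducible hirr
  have hnd : (P.aroots (AlgebraicClosure F)).Nodup := nodup_aroots_iff_of_splits hP.ne_zero
    (IsAlgClosed.splits _) |>.2 hsep
  classical
  change _ = ∏ θ ∈ (⟨P.aroots (AlgebraicClosure F), hnd⟩ : Finset (AlgebraicClosure F)),
    (aeval θ) f
  refine Eq.trans ?_ (Finset.prod_coe_sort (⟨P.aroots (AlgebraicClosure F), hnd⟩ :
    Finset (AlgebraicClosure F)) (fun θ => aeval θ f))
  -- The bijection is bundled with the only property of it that is needed, so its definition stays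
  -- opaque.
  have e : {e : (AdjoinRoot P →ₐ[F] AlgebraicClosure F) ≃
      {x // x ∈ (⟨P.aroots (AlgebraicClosure F), hnd⟩ : Finset (AlgebraicClosure F))} //
      ∀ σ, (e σ).1 = σ (AdjoinRoot.root P)} :=
    ⟨AdjoinRoot.equiv (AlgebraicClosure F) F P hP.ne_zero, fun _ => rfl⟩
  refine Fintype.prod_equiv e.1 _ _ fun σ => ?_
  rw [e.2]
  rw [← AdjoinRoot.aeval_eq, aeval_algHom_apply]

/-- Euler's criterion in both fields: the norm is the power map with exponent (|L|-1)/(|F|-1), and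
this exponent times (|F|-1)/2 is (|L|-1)/2. -/
theorem quadraticChar_norm [DecidableEq F] (hq : Odd (Fintype.card F)) {L : Type*} [Field L]
    [Fintype L] [DecidableEq L] [Algebra F L] (a : L) :
    quadraticChar F (Algebra.norm F a) = quadraticChar L a := by
  have hF := ringChar_ne_two hq
  have hL : ringChar L ≠ 2 := by
    rw [← Algebra.ringChar_eq F L]; exact hF
  by_cases ha : a = 0
  · subst ha; rw [Algebra.norm_zero]; simp
  have h1 := quadraticChar_eq_pow_of_char_ne_two' hL a
  have h2 := congrArg (algebraMap F L)
    (quadraticChar_eq_pow_of_char_ne_two' hF (Algebra.norm F a))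
  rw [map_pow, FiniteField.algebraMap_norm_eq_pow, ← pow_mul, map_intCast] at h2
  have h3 : (Nat.card L - 1) / (Nat.card F - 1) * (Fintype.card F / 2) = Fintype.card L / 2 := by
    rw [Nat.card_eq_fintype_card, Nat.card_eq_fintype_card]
    have hd : (Fintype.card F - 1) ∣ (Fintype.card L - 1) := by
      rw [Module.card_eq_pow_finrank (K := F) (V := L)]
      simpa using Nat.sub_dvd_pow_sub_pow (Fintype.card F) 1 (Module.finrank F L)
    obtain ⟨k, hk⟩ := hd
    have h1F := Fintype.one_lt_card (α := F)
    have h1L := Fintype.one_lt_card (α := L)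
    rw [hk, Nat.mul_div_cancel_left _ (by omega)]
    obtain ⟨j, hj⟩ := hq
    rw [hj] at hk ⊢
    have e1 : (2 * j + 1) / 2 = j := by omega
    have e2 : Fintype.card L = 2 * (j * k) + 1 := by
      have : (2 * j + 1 - 1) * k = 2 * (j * k) := by simp; ring
      omega
    rw [e1, e2]
    have : (2 * (j * k) + 1) / 2 = j * k := by omega
    rw [this, mul_comm]
  rw [h3, ← h1] at h2
  rcases quadraticChar_dichotomy (F := F) (a := Algebra.norm F a)
    (by rwa [Ne, Algebra.norm_eq_zero_iff]) with e | e <;>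
  rcases quadraticChar_dichotomy (F := L) ha with e' | e' <;> rw [e, e'] at h2 ⊢
  · exfalso
    push_cast at h2
    exact Ring.neg_one_ne_one_of_char_ne_two hL h2.symm
  · exfalso
    push_cast at h2
    exact Ring.neg_one_ne_one_of_char_ne_two hL h2

theorem residueSymbol_eq [DecidableEq F] (hq : Odd (Fintype.card F)) (D : F[X]) {P : F[X]}
    (hP : P.Monic) (hirr : Irreducible P) :
    residueSymbol D P = quadraticChar F (resultant P D) := by
  classical
  have : Fact (Irreducible P) := ⟨hirr⟩
  have := (AdjoinRoot.powerBasis hirr.ne_zero).finite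
  have : Finite (AdjoinRoot P) := Module.finite_of_finite F
  have : Fintype (AdjoinRoot P) := Fintype.ofFinite _
  rw [← algebraMap_norm_adjoinRoot hP hirr, quadraticChar_norm hq, quadraticChar_apply,
    quadraticCharFun, residueSymbol]
  have h0 : AdjoinRoot.mk P D = 0 ↔ P ∣ D := AdjoinRoot.mk_eq_zero
  have hs : IsSquare (AdjoinRoot.mk P D) ↔ ∃ h : F[X], P ∣ D - h ^ 2 := by
    constructor
    · rintro ⟨r, hr⟩
      obtain ⟨h, rfl⟩ := AdjoinRoot.mk_surjective r
      refine ⟨h, ?_⟩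
      rw [← AdjoinRoot.mk_eq_zero, map_sub, map_pow, hr]; ring
    · rintro ⟨h, hh⟩
      refine ⟨AdjoinRoot.mk P h, ?_⟩
      rw [← AdjoinRoot.mk_eq_zero, map_sub, map_pow, sub_eq_zero] at hh
      rw [hh]; ring
  simp only [h0, hs]

/-- Both sides are multiplicative over the monic prime factors of f. The gain is that quadratic
reciprocity becomes the symmetry of the resultant up to sign. -/
theorem quadChar_eq_resultant [DecidableEq F] (hq : Odd (Fintype.card F)) (D : F[X]) {f : F[X]}
    (hf : f.Monic) : quadChar D f = quadraticChar F (resultant f D) := by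
  classical
  have key : ∀ s : Multiset F[X], (∀ P ∈ s, P.Monic ∧ Irreducible P) →
      (s.map (residueSymbol D)).prod = quadraticChar F (resultant s.prod D) := by
    intro s
    induction s using Multiset.induction with
    | empty => intro _; simp
    | cons P s ih =>
      intro h
      have hs : s.prod.Monic := by
        simpa using monic_multiset_prod_of_monic s (fun Q : F[X] => Q)
          (fun Q hQ => (h Q (Multiset.mem_cons_of_mem hQ)).1)
      rw [Multiset.map_cons, Multiset.prod_cons, Multiset.prod_cons,
        ih (fun Q hQ => h Q (Multiset.mem_cons_of_mem hQ)),
        resultant_mul_left_of_monic (h P (Multiset.mem_cons_self _ _)).1 hs, map_mul,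
        residueSymbol_eq hq D (h P (Multiset.mem_cons_self _ _)).1
          (h P (Multiset.mem_cons_self _ _)).2]
  have hmem : ∀ P ∈ UniqueFactorizationMonoid.normalizedFactors f, P.Monic ∧ Irreducible P := by
    intro P hP
    have hirr := UniqueFactorizationMonoid.irreducible_of_normalized_factor P hP
    refine ⟨?_, hirr⟩
    rw [← UniqueFactorizationMonoid.normalize_normalized_factor P hP]
    exact monic_normalize hirr.ne_zero
  have := key _ hmem
  rw [UniqueFactorizationMonoid.prod_normalizedFactors_eq hf.ne_zero,
    hf.normalize_eq_self] at this
  rw [quadChar]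
  convert this

end Algebra

end HyperellipticEnsemble

namespace HyperellipticEnsemble

/-! ### Sums over polynomials of bounded degree. -/

section FunctionalEquation

variable {F : Type*} [Field F] [Fintype F]

theorem mem_monicOfDegree {n : ℕ} {f : F[X]} :
    f ∈ monicOfDegree F n ↔ f.Monic ∧ f.natDegree = n := by
  simp [monicOfDegree]

open Classical in
/-- The polynomials of degree less than `n`. -/
noncomputable def polysLT (F : Type*) [Field F] [Fintype F] (n : ℕ) : Finset F[X] :=
  (monicOfDegree F n).image (fun f => f - X ^ n)

theorem mem_polysLT {n : ℕ} {f : F[X]} : f ∈ polysLT F n ↔ f.degree < n := by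
  simp only [polysLT, Finset.mem_image, mem_monicOfDegree]
  constructor
  · rintro ⟨h, ⟨hm, hn⟩, rfl⟩
    have hd : h.degree = n := by rw [degree_eq_natDegree hm.ne_zero, hn]
    rw [← hd]
    exact degree_sub_lt_left (by rw [hd, degree_X_pow]) hm.ne_zero (by simp [hm.leadingCoeff])
  · intro h
    refine ⟨X ^ n + f, ⟨monic_X_pow_add h, natDegree_eq_of_degree_eq_some ?_⟩, by ring⟩
    rw [degree_add_eq_left_of_degree_lt (by rwa [degree_X_pow]), degree_X_pow]

theorem sum_monicOfDegree {M : Type*} [AddCommMonoid M] (n : ℕ) (Φ : F[X] → M) :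
    ∑ f ∈ monicOfDegree F n, Φ f = ∑ v ∈ polysLT F n, Φ (X ^ n + v) := by
  classical
  rw [polysLT, Finset.sum_image (by intro a _ b _ h; simpa using h)]
  simp

theorem sum_polysLT_comp {M : Type*} [AddCommMonoid M] {n : ℕ} (T : F[X] → F[X])
    (hT : ∀ v ∈ polysLT F n, T v ∈ polysLT F n) (hinj : Set.InjOn T (polysLT F n))
    (Φ : F[X] → M) : ∑ v ∈ polysLT F n, Φ (T v) = ∑ v ∈ polysLT F n, Φ v :=
  Finset.sum_nbij T hT hinj (Finset.surjOn_of_injOn_of_card_le T hT hinj le_rfl) fun _ _ => rfl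

theorem sum_polysLT_C_mul {M : Type*} [AddCommMonoid M] {n : ℕ} {c : F} (hc : c ≠ 0)
    (Φ : F[X] → M) : ∑ v ∈ polysLT F n, Φ (C c * v) = ∑ v ∈ polysLT F n, Φ v := by
  refine sum_polysLT_comp (fun v => C c * v) (fun v hv => ?_) (fun a _ b _ h => ?_) Φ
  · rw [mem_polysLT] at *
    rwa [degree_C_mul hc]
  · exact mul_left_cancel₀ (C_ne_zero.2 hc) h

theorem sum_polysLT_add {M : Type*} [AddCommMonoid M] {n : ℕ} {w : F[X]} (hw : w.degree < n)
    (Φ : F[X] → M) : ∑ v ∈ polysLT F n, Φ (v + w) = ∑ v ∈ polysLT F n, Φ v := by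
  refine sum_polysLT_comp (fun v => v + w) (fun v hv => ?_) (fun a _ b _ h => ?_) Φ
  · rw [mem_polysLT] at *
    exact (degree_add_le _ _).trans_lt (max_lt hv hw)
  · exact add_right_cancel h

theorem sum_polysLT_succ {M : Type*} [AddCommMonoid M] (n : ℕ) (Φ : F[X] → M) :
    ∑ v ∈ polysLT F (n + 1), Φ v = ∑ c : F, ∑ v ∈ polysLT F n, Φ (C c * X ^ n + v) := by
  rw [← Finset.sum_product', eq_comm]
  refine Finset.sum_bij' (fun p _ => C p.1 * X ^ n + p.2)
    (fun v _ => (v.coeff n, v - C (v.coeff n) * X ^ n)) ?_ ?_ ?_ ?_ ?_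
  · rintro ⟨c, v⟩ h
    simp only [Finset.mem_product, mem_polysLT] at h ⊢
    refine (degree_add_le _ _).trans_lt (max_lt ?_ (h.2.trans (by exact_mod_cast Nat.lt_succ_self n)))
    exact (degree_C_mul_X_pow_le _ _).trans_lt (by exact_mod_cast Nat.lt_succ_self n)
  · intro v hv
    simp only [Finset.mem_product, Finset.mem_univ, true_and, mem_polysLT] at hv ⊢
    rw [degree_lt_iff_coeff_zero] at hv ⊢
    intro k hk
    rcases hk.eq_or_lt with rfl | hk'
    · simp
    · simp [coeff_X_pow, hv k hk', hk'.ne']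
  · rintro ⟨c, v⟩ h
    simp only [Finset.mem_product, mem_polysLT] at h
    have : v.coeff n = 0 := coeff_eq_zero_of_degree_lt h.2
    simp [this]
  · intro v _; simp
  · intro p _; rfl

theorem card_polysLT (n : ℕ) : (polysLT F n).card = Fintype.card F ^ n := by
  induction n with
  | zero =>
    have : polysLT F 0 = {0} := by
      ext f
      rw [mem_polysLT, Finset.mem_singleton]
      simp [Nat.WithBot.lt_zero_iff]
    simp [this]
  | succ n ih =>
    rw [Finset.card_eq_sum_ones, sum_polysLT_succ]
    simp [ih, pow_succ, mul_comm]

theorem card_monicOfDegree (n : ℕ) : (monicOfDegree F n).card = Fintype.card F ^ n := by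
  rw [← card_polysLT, Finset.card_eq_sum_ones, sum_monicOfDegree, ← Finset.card_eq_sum_ones]

/-- The polynomials of degree below deg D represent the residue classes modulo D, and a unit c
permutes these classes. -/
theorem sum_polysLT_modByMonic {M : Type*} [AddCommMonoid M] {D c : F[X]} (hD : D.Monic)
    (hc : IsCoprime c D) (Φ : F[X] → M) (hΦ : ∀ f, Φ (f %ₘ D) = Φ f) :
    ∑ v ∈ polysLT F D.natDegree, Φ (c * v) = ∑ v ∈ polysLT F D.natDegree, Φ v := by
  rw [← sum_polysLT_comp (fun v => (c * v) %ₘ D) (fun v _ => ?_) (fun a ha b hb h => ?_) Φ]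
  · exact Finset.sum_congr rfl fun v _ => (hΦ _).symm
  · rw [mem_polysLT, ← degree_eq_natDegree hD.ne_zero]
    exact degree_modByMonic_lt _ hD
  · have h1 : D ∣ c * (a - b) := by
      rw [← modByMonic_eq_zero_iff_dvd hD, mul_sub, sub_modByMonic, sub_eq_zero]
      exact h
    have h2 : D ∣ a - b := hc.symm.dvd_of_dvd_mul_left h1
    by_contra hne
    have := degree_le_of_dvd h2 (sub_ne_zero.2 hne)
    simp only [Finset.mem_coe, mem_polysLT] at ha hb
    rw [degree_eq_natDegree hD.ne_zero] at this
    exact absurd ((degree_sub_le a b).trans_lt (max_lt ha hb)) this.not_gt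

end FunctionalEquation

end HyperellipticEnsemble

namespace HyperellipticEnsemble

/-! ### Reciprocity and the vanishing of long character sums. -/

section FunctionalEquation

variable {F : Type*} [Field F] [Fintype F]

open Classical in
/-- The reciprocal symbol `(f / D)`, as the quadratic character of a resultant. -/
noncomputable def resChar (D f : F[X]) : ℤ := quadraticChar F (resultant D f)

theorem resChar_mul {D : F[X]} (hD : D.Monic) (f g : F[X]) :
    resChar D (f * g) = resChar D f * resChar D g := by
  rw [resChar, resultant_mul_right_of_monic hD, map_mul]; rfl

theorem resChar_congr {D f g : F[X]} (hD : D.Monic) (h : D ∣ f - g) :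
    resChar D f = resChar D g := by
  rw [resChar, resultant_eq_of_dvd_sub hD h]; rfl

theorem resChar_modByMonic {D : F[X]} (hD : D.Monic) (f : F[X]) :
    resChar D (f %ₘ D) = resChar D f := by
  refine resChar_congr hD ⟨-(f /ₘ D), ?_⟩
  have := modByMonic_add_div f D
  linear_combination this

-- An odd power of ±1 is itself. Odd degree is essential here: it makes a nonsquare constant have
-- symbol -1, which drives every sign-change argument below.
open Classical in
theorem resChar_C {D : F[X]} (hD : D.Monic) (hodd : Odd D.natDegree) (c : F) :
    resChar D (C c) = quadraticChar F c := by
  rw [resChar, resultant_C_of_monic hD, map_pow]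
  by_cases hc : c = 0
  · subst hc; simp [hodd.pos.ne']
  · rcases quadraticChar_dichotomy hc with h | h <;> rw [h]
    · simp
    · exact hodd.neg_one_pow

theorem isCoprime_of_resChar_ne_zero {D f : F[X]} (hD : D.Monic) (h : resChar D f ≠ 0) :
    IsCoprime f D := by
  by_contra hc
  apply h
  have : resultant D f = 0 := resultant_eq_zero_iff.2
    ⟨Or.inl hD.ne_zero, fun h' => hc h'.symm⟩
  rw [resChar, this]; simp

theorem resChar_eq_zero_of_not_isCoprime {D f : F[X]} (hD : D.Monic) (h : ¬ IsCoprime f D) :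
    resChar D f = 0 := by
  by_contra h0
  exact h (isCoprime_of_resChar_ne_zero hD h0)

theorem resChar_sq {D f : F[X]} (h : IsCoprime f D) : resChar D f * resChar D f = 1 := by
  classical
  have : resultant D f ≠ 0 := resultant_ne_zero _ _ h.symm
  rw [← sq, resChar]
  convert quadraticChar_sq_one this

-- Exchanging the arguments of the resultant costs (-1)^(deg f · deg D), and deg D is odd.
open Classical in
theorem quadChar_eq_resChar (hq : Odd (Fintype.card F)) {D : F[X]} (hD : D.Monic)
    (hodd : Odd D.natDegree) {f : F[X]} (hf : f.Monic) :
    quadChar D f = quadraticChar F (-1) ^ f.natDegree * resChar D f := by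
  rw [quadChar_eq_resultant hq D hf, resultant_comm, map_mul, map_pow, pow_mul, resChar]
  have h2 : (quadraticChar F (-1 : F)) ^ D.natDegree = quadraticChar F (-1) := by
    rcases quadraticChar_dichotomy (neg_ne_zero.2 (one_ne_zero (α := F))) with h | h <;> rw [h]
    · simp
    · exact hodd.neg_one_pow
  rw [pow_right_comm, h2]

/-- The sum of `(f / D)` over the monic `f` of degree `n`. -/
noncomputable def resSum (D : F[X]) (n : ℕ) : ℤ := ∑ f ∈ monicOfDegree F n, resChar D f

open Classical in
theorem charSum_eq_resSum (hq : Odd (Fintype.card F)) {D : F[X]} (hD : D.Monic)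
    (hodd : Odd D.natDegree) (n : ℕ) :
    charSum D n = quadraticChar F (-1) ^ n * resSum D n := by
  rw [charSum, resSum, Finset.mul_sum]
  refine Finset.sum_congr rfl fun f hf => ?_
  obtain ⟨h1, h2⟩ := mem_monicOfDegree.1 hf
  rw [quadChar_eq_resChar hq hD hodd h1, h2]

-- Keep the quotient of f by D and multiply the remainder by a nonsquare constant. Since n ≥ deg D
-- the leading coefficient sits in the quotient, so this permutes the monic polynomials of degree n,
-- while it reverses the sign of the symbol.
open Classical in
theorem resSum_eq_zero (hq : Odd (Fintype.card F)) {D : F[X]} (hD : D.Monic)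
    (hodd : Odd D.natDegree) {n : ℕ} (hn : D.natDegree ≤ n) : resSum D n = 0 := by
  obtain ⟨c, hc⟩ := quadraticChar_exists_neg_one (ringChar_ne_two hq)
  have hc0 : c ≠ 0 := by rintro rfl; simp at hc
  have hDpos : 0 < D.degree := natDegree_pos_iff_degree_pos.1 hodd.pos
  set T : F[X] → F[X] := fun f => D * (f /ₘ D) + C c * (f %ₘ D) with hT
  have hTd : ∀ f, (C c * (f %ₘ D)).degree < D.degree := fun f => by
    rw [degree_C_mul hc0]; exact degree_modByMonic_lt _ hD
  have hdiv : ∀ f, T f /ₘ D = f /ₘ D ∧ T f %ₘ D = C c * (f %ₘ D) := fun f =>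
    div_modByMonic_unique _ _ hD ⟨by rw [hT]; ring, hTd f⟩
  have hmem : ∀ f ∈ monicOfDegree F n, T f ∈ monicOfDegree F n := by
    intro f hf
    obtain ⟨h1, h2⟩ := mem_monicOfDegree.1 hf
    have hdf : f.degree = n := by rw [degree_eq_natDegree h1.ne_zero, h2]
    have e : T f = f + (C c - 1) * (f %ₘ D) := by
      have := modByMonic_add_div f D
      rw [hT]; linear_combination this
    have hlt : ((C c - 1) * (f %ₘ D)).degree < f.degree := by
      refine lt_of_lt_of_le ?_ (show D.degree ≤ f.degree by
        rw [hdf, degree_eq_natDegree hD.ne_zero]; exact_mod_cast hn)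
      rw [show (C c - 1 : F[X]) = C (c - 1) by simp]
      by_cases h : c - 1 = 0
      · rw [h]; simpa using bot_lt_iff_ne_bot.2 hDpos.ne_bot
      · rw [degree_C_mul h]; exact degree_modByMonic_lt _ hD
    rw [mem_monicOfDegree, e]
    exact ⟨h1.add_of_left hlt, by rw [natDegree_eq_of_degree_eq_some]
                                  rw [degree_add_eq_left_of_degree_lt hlt, hdf]⟩
  have hinj : Set.InjOn T (monicOfDegree F n) := by
    intro a _ b _ h
    have ha := hdiv a
    have hb := hdiv b
    rw [h] at ha
    have e1 : a /ₘ D = b /ₘ D := ha.1.symm.trans hb.1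
    have e2 : a %ₘ D = b %ₘ D := mul_left_cancel₀ (C_ne_zero.2 hc0) (ha.2.symm.trans hb.2)
    rw [← modByMonic_add_div a D, ← modByMonic_add_div b D, e1, e2]
  have h1 : ∑ f ∈ monicOfDegree F n, resChar D (T f) = resSum D n :=
    Finset.sum_nbij T hmem hinj (Finset.surjOn_of_injOn_of_card_le T hmem hinj le_rfl)
      fun _ _ => rfl
  have h2 : ∑ f ∈ monicOfDegree F n, resChar D (T f) = - resSum D n := by
    rw [resSum, ← Finset.sum_neg_distrib]
    refine Finset.sum_congr rfl fun f _ => ?_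
    rw [← resChar_modByMonic hD (T f), (hdiv f).2, resChar_mul hD, resChar_C hD hodd, hc,
      resChar_modByMonic hD]
    ring
  linarith

/-- Primitivity of the symbol. With P a common prime factor and D = PE, squarefreeness makes P and E
coprime, and the Chinese remainder theorem gives c that is a nonresidue modulo P and is 1 modulo E.
Such a c cannot be told from 1 after multiplication by f. -/
theorem exists_resChar_eq_neg_one (hq : Odd (Fintype.card F)) {D : F[X]} (hD : D.Monic)
    (hsq : Squarefree D) {f : F[X]} (hf : ¬ IsCoprime f D) :
    ∃ c : F[X], resChar D c = -1 ∧ D ∣ (c - 1) * f := by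
  classical
  obtain ⟨P, hPm, hP, hPf, hPD⟩ : ∃ P : F[X], P.Monic ∧ Irreducible P ∧ P ∣ f ∧ P ∣ D := by
    have hg : ¬ IsUnit (gcd f D) := by
      rwa [gcd_isUnit_iff]
    have hg0 : gcd f D ≠ 0 := fun h => hD.ne_zero ((gcd_eq_zero_iff _ _).1 h).2
    obtain ⟨P, hP, hPg⟩ := WfDvdMonoid.exists_irreducible_factor hg hg0
    have hn : Associated (normalize P) P := normalize_associated P
    exact ⟨normalize P, monic_normalize hP.ne_zero, hn.symm.irreducible hP,
      hn.dvd.trans (hPg.trans (gcd_dvd_left _ _)), hn.dvd.trans (hPg.trans (gcd_dvd_right _ _))⟩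
  obtain ⟨E, hE⟩ := hPD
  have hEm : E.Monic := by
    rw [hE] at hD
    exact hPm.of_mul_monic_left hD
  have hPE : IsCoprime P E := by
    rw [hP.coprime_iff_not_dvd]
    rintro ⟨k, hk⟩
    exact hP.not_isUnit (hsq P ⟨k, by rw [hE, hk]; ring⟩)
  obtain ⟨k, hk⟩ : ∃ k : F[X], resChar P k = -1 := by
    have : Fact (Irreducible P) := ⟨hP⟩
    have := (AdjoinRoot.powerBasis hP.ne_zero).finite
    have : Finite (AdjoinRoot P) := Module.finite_of_finite F
    have : Fintype (AdjoinRoot P) := Fintype.ofFinite _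
    have hL : ringChar (AdjoinRoot P) ≠ 2 := by
      rw [← Algebra.ringChar_eq F (AdjoinRoot P)]; exact ringChar_ne_two hq
    obtain ⟨a, ha⟩ := quadraticChar_exists_neg_one hL
    obtain ⟨k, rfl⟩ := AdjoinRoot.mk_surjective a
    refine ⟨k, ?_⟩
    rw [← quadraticChar_norm hq, algebraMap_norm_adjoinRoot hPm hP] at ha
    exact ha
  obtain ⟨u, v, huv⟩ := hPE
  refine ⟨k * (v * E) + u * P, ?_, ?_⟩
  · have h1 : resChar D (k * (v * E) + u * P) =
        resChar P (k * (v * E) + u * P) * resChar E (k * (v * E) + u * P) := by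
      rw [resChar, hE, resultant_mul_left_of_monic hPm hEm, map_mul]; rfl
    rw [h1, resChar_congr hPm (g := k) ⟨u - k * u, by linear_combination k * huv⟩, hk,
      resChar_congr hEm (g := 1) ⟨k * v - v, by linear_combination huv⟩]
    have : resChar E (1 : F[X]) = 1 := by
      rw [resChar, ← C_1, resultant_C_of_monic hEm]; simp
    rw [this]; rfl
  · obtain ⟨j, rfl⟩ := hPf
    rw [hE]
    exact ⟨(k * v - v) * j, by linear_combination P * j * huv⟩

end FunctionalEquation

end HyperellipticEnsemble

namespace HyperellipticEnsemble

/-! ### Gauss sums modulo D and the functional equation. -/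

section FunctionalEquation

variable {F : Type*} [Field F] [Fintype F]

/-- The additive character of `F[X] / D` attached to the residue at infinity of `f / D`. -/
noncomputable def residueChar (ψ : AddChar F ℂ) (D f : F[X]) : ℂ :=
  ψ ((f %ₘ D).coeff (D.natDegree - 1))

theorem residueChar_add (ψ : AddChar F ℂ) (D f g : F[X]) :
    residueChar ψ D (f + g) = residueChar ψ D f * residueChar ψ D g := by
  rw [residueChar, add_modByMonic, coeff_add, AddChar.map_add_eq_mul]; rfl

theorem residueChar_congr (ψ : AddChar F ℂ) {D f g : F[X]} (hD : D.Monic) (h : D ∣ f - g) :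
    residueChar ψ D f = residueChar ψ D g := by
  have : f %ₘ D = g %ₘ D := by
    rw [← sub_eq_zero, ← sub_modByMonic, modByMonic_eq_zero_iff_dvd hD]; exact h
  rw [residueChar, this]; rfl

theorem residueChar_of_degree_lt (ψ : AddChar F ℂ) {D f : F[X]} (hD : D.Monic)
    (h : f.degree < D.natDegree) : residueChar ψ D f = ψ (f.coeff (D.natDegree - 1)) := by
  rw [residueChar, (modByMonic_eq_self_iff hD).2]
  rwa [degree_eq_natDegree hD.ne_zero]

/-- Separability of the Gauss sum. If f is a unit modulo D, replace b by fb. Otherwise the element c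
of `exists_resChar_eq_neg_one` fixes the additive character and negates the symbol, so the sum is
its own negative. -/
theorem sum_resChar_mul_residueChar (hq : Odd (Fintype.card F)) (ψ : AddChar F ℂ) {D : F[X]}
    (hD : D.Monic) (hsq : Squarefree D) (f : F[X]) :
    ∑ b ∈ polysLT F D.natDegree, (resChar D b : ℂ) * residueChar ψ D (b * f) =
      resChar D f * ∑ b ∈ polysLT F D.natDegree, (resChar D b : ℂ) * residueChar ψ D b := by
  have hdvd : ∀ g : F[X], D ∣ g %ₘ D - g := fun g =>
    ⟨-(g /ₘ D), by linear_combination modByMonic_add_div g D⟩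
  by_cases hf : IsCoprime f D
  · have h := sum_polysLT_modByMonic hD hf
      (fun b => (resChar D b : ℂ) * residueChar ψ D b) (fun g => by
        rw [resChar_modByMonic hD, residueChar_congr ψ hD (hdvd g)])
    rw [← h, Finset.mul_sum]
    refine Finset.sum_congr rfl fun b _ => ?_
    have h1 : ((resChar D f * resChar D f : ℤ) : ℂ) = 1 := by rw [resChar_sq hf]; simp
    push_cast at h1
    rw [resChar_mul hD, mul_comm b f]
    push_cast
    linear_combination (-(resChar D b : ℂ) * residueChar ψ D (f * b)) * h1
  · obtain ⟨c, hc, hcf⟩ := exists_resChar_eq_neg_one hq hD hsq hf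
    have hcop : IsCoprime c D := isCoprime_of_resChar_ne_zero hD (by rw [hc]; norm_num)
    have h := sum_polysLT_modByMonic hD hcop
      (fun b => (resChar D b : ℂ) * residueChar ψ D (b * f)) (fun g => by
        rw [resChar_modByMonic hD, residueChar_congr ψ hD (f := g %ₘ D * f) (g := g * f)]
        rw [← sub_mul]; exact (hdvd g).mul_right f)
    rw [resChar_eq_zero_of_not_isCoprime hD hf, Int.cast_zero, zero_mul]
    have h2 : ∑ v ∈ polysLT F D.natDegree, (resChar D (c * v) : ℂ) * residueChar ψ D (c * v * f)
        = - ∑ v ∈ polysLT F D.natDegree, (resChar D v : ℂ) * residueChar ψ D (v * f) := by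
      rw [← Finset.sum_neg_distrib]
      refine Finset.sum_congr rfl fun b _ => ?_
      rw [resChar_mul hD, hc, residueChar_congr ψ hD (f := c * b * f) (g := b * f)]
      · push_cast; ring
      · rw [show c * b * f - b * f = (c - 1) * f * b by ring]; exact hcf.mul_right b
    linear_combination (h2 - h) / 2

/-- Orthogonality. For deg b < deg D - n the product bv has degree below deg D - 1 and every term is
1. For larger b some shift of v multiplies the sum by a value of ψ other than 1. -/
theorem sum_residueChar {ψ : AddChar F ℂ} (hψ : ψ ≠ 1) {D : F[X]} (hD : D.Monic) {n : ℕ}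
    (hn : n + 1 ≤ D.natDegree) {b : F[X]} (hb : b.degree < D.natDegree) [Decidable
      (b ∈ polysLT F (D.natDegree - n))] :
    ∑ v ∈ polysLT F n, residueChar ψ D (b * v) =
      if b ∈ polysLT F (D.natDegree - n) then (Fintype.card F : ℂ) ^ n else 0 := by
  split_ifs with h
  · rw [mem_polysLT] at h
    rw [Finset.sum_congr rfl (g := fun _ => (1 : ℂ))]
    · simp [card_polysLT]
    · intro v hv
      rw [mem_polysLT] at hv
      by_cases h0 : b * v = 0
      · simp [h0, residueChar]
      have hb0 := left_ne_zero_of_mul h0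
      have hv0 := right_ne_zero_of_mul h0
      rw [degree_eq_natDegree hb0] at h
      rw [degree_eq_natDegree hv0] at hv
      have h1 : b.natDegree < D.natDegree - n := by exact_mod_cast h
      have h2 : v.natDegree < n := by exact_mod_cast hv
      have h3 : (b * v).degree < ((D.natDegree - 1 : ℕ) : WithBot ℕ) := by
        rw [degree_eq_natDegree h0, natDegree_mul hb0 hv0]
        exact_mod_cast (by omega : b.natDegree + v.natDegree < D.natDegree - 1)
      rw [residueChar_of_degree_lt ψ hD (h3.trans_le (by exact_mod_cast Nat.sub_le _ _)),
        coeff_eq_zero_of_degree_lt h3, AddChar.map_zero_eq_one]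
  · rw [mem_polysLT] at h
    have hb0 : b ≠ 0 := by
      rintro rfl
      exact h (by simp [WithBot.bot_lt_coe])
    rw [degree_eq_natDegree hb0] at h hb
    have h1 : D.natDegree - n ≤ b.natDegree := by
      by_contra hc; exact h (by exact_mod_cast not_le.1 hc)
    have h2 : b.natDegree < D.natDegree := by exact_mod_cast hb
    obtain ⟨t, ht⟩ : ∃ t, ψ t ≠ 1 := by
      by_contra hc; push Not at hc
      exact hψ (by ext x; simpa using hc x)
    -- Chosen so that bw has degree at most deg D - 1 with coefficient t in that place.
    set w : F[X] := C (t / b.leadingCoeff) * X ^ (D.natDegree - 1 - b.natDegree) with hw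
    have hlc : b.leadingCoeff ≠ 0 := leadingCoeff_ne_zero.2 hb0
    have hwd : w.degree < n := by
      refine (degree_C_mul_X_pow_le _ _).trans_lt ?_
      exact_mod_cast (by omega : D.natDegree - 1 - b.natDegree < n)
    have hbw : residueChar ψ D (b * w) = ψ t := by
      rw [residueChar_of_degree_lt ψ hD]
      · rw [hw, ← mul_assoc, mul_right_comm]
        have e : D.natDegree - 1 = b.natDegree + (D.natDegree - 1 - b.natDegree) := by omega
        conv_lhs => rw [e]
        rw [add_tsub_cancel_left, coeff_mul_C, coeff_mul_X_pow, coeff_natDegree,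
          mul_div_cancel₀ _ hlc]
      · refine (degree_mul_le _ _).trans_lt ?_
        rw [degree_eq_natDegree hb0]
        refine (add_le_add le_rfl (degree_C_mul_X_pow_le _ _)).trans_lt ?_
        exact_mod_cast (by omega :
          b.natDegree + (D.natDegree - 1 - b.natDegree) < D.natDegree)
    have h3 := sum_polysLT_add hwd (fun v => residueChar ψ D (b * v))
    simp only [mul_add, residueChar_add, hbw] at h3
    rw [← Finset.sum_mul] at h3
    have h4 : (∑ v ∈ polysLT F n, residueChar ψ D (b * v)) * (ψ t - 1) = 0 := by
      linear_combination h3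
    exact (mul_eq_zero.1 h4).resolve_right (sub_ne_zero.2 ht)

-- Scaling by c ≠ 0 reduces to the monic case. For c = 0, scaling by a nonsquare shows that the sum
-- is its own negative.
open Classical in
theorem sum_resChar_C_mul_X_pow_add (hq : Odd (Fintype.card F)) {D : F[X]} (hD : D.Monic)
    (hodd : Odd D.natDegree) (k : ℕ) (c : F) :
    ∑ v ∈ polysLT F k, (resChar D (C c * X ^ k + v)) = quadraticChar F c * resSum D k := by
  by_cases hc : c = 0
  · subst hc
    obtain ⟨c, hc⟩ := quadraticChar_exists_neg_one (ringChar_ne_two hq)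
    have hc0 : c ≠ 0 := by rintro rfl; simp at hc
    have := sum_polysLT_C_mul (n := k) hc0 (resChar D)
    simp only [resChar_mul hD, resChar_C hD hodd, hc] at this
    rw [← Finset.mul_sum] at this
    simp only [map_zero, zero_mul, zero_add, MulChar.map_zero]
    linarith
  · rw [← sum_polysLT_C_mul hc, resSum, sum_monicOfDegree, Finset.mul_sum]
    refine Finset.sum_congr rfl fun v _ => ?_
    rw [← mul_add, resChar_mul hD, resChar_C hD hodd]

/-- The functional equation of the character sums, up to a constant. -/
theorem exists_resSum_functional_equation (hq : Odd (Fintype.card F)) {D : F[X]} (hD : D.Monic)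
    (hsq : Squarefree D) {g : ℕ} (hdeg : D.natDegree = 2 * g + 1) :
    ∃ G τ : ℂ, τ ≠ 0 ∧ ∀ n ≤ 2 * g, (resSum D n : ℂ) * G =
      (Fintype.card F : ℂ) ^ n * τ * resSum D (2 * g - n) := by
  classical
  obtain ⟨ψ, hψ1⟩ := (AddChar.exists_apply_ne_zero (α := F) (a := 1)).2 one_ne_zero
  have hψ : ψ ≠ 1 := by rintro rfl; simp at hψ1
  have hodd : Odd D.natDegree := ⟨g, hdeg⟩
  set χ : MulChar F ℂ := (quadraticChar F).ringHomComp (Int.castRingHom ℂ) with hχdef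
  have hχ : χ ≠ 1 := by
    rw [hχdef, MulChar.ringHomComp_ne_one_iff (RingHom.injective_int _)]
    exact quadraticChar_ne_one (ringChar_ne_two hq)
  have hτ : gaussSum χ ψ ≠ 0 := gaussSum_ne_zero_of_nontrivial
    (by exact_mod_cast Fintype.card_ne_zero) hχ (AddChar.IsPrimitive.of_ne_one hψ)
  -- G is the Gauss sum modulo D and τ that of F. Multiplying by G expands each symbol into additive
  -- characters; summing over the lower coefficients of f leaves the b of degree at most 2g - n, and
  -- summing over the coefficient of X^(2g-n) in b produces τ. Only τ ≠ 0 is known at this stage.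
  refine ⟨∑ b ∈ polysLT F D.natDegree, (resChar D b : ℂ) * residueChar ψ D b, gaussSum χ ψ, hτ,
    fun n hn => ?_⟩
  rw [resSum, sum_monicOfDegree, Int.cast_sum, Finset.sum_mul]
  simp_rw [← sum_resChar_mul_residueChar hq ψ hD hsq]
  rw [Finset.sum_comm]
  simp_rw [mul_add, residueChar_add, ← Finset.mul_sum]
  have h1 : ∀ b ∈ polysLT F D.natDegree, (resChar D b : ℂ) * (residueChar ψ D (b * X ^ n) *
      ∑ v ∈ polysLT F n, residueChar ψ D (b * v)) = if b ∈ polysLT F (D.natDegree - n) then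
        (resChar D b : ℂ) * ψ (b.coeff (2 * g - n)) * (Fintype.card F : ℂ) ^ n else 0 := by
    intro b hb
    rw [sum_residueChar hψ hD (by omega) (mem_polysLT.1 hb)]
    split_ifs with h
    · rw [residueChar_of_degree_lt ψ hD, show D.natDegree - 1 = 2 * g - n + n by omega,
        coeff_mul_X_pow]
      · ring
      · by_cases hb0 : b = 0
        · simp [hb0, WithBot.bot_lt_coe]
        rw [mem_polysLT, degree_eq_natDegree hb0] at h
        have h' : b.natDegree < D.natDegree - n := by exact_mod_cast h
        rw [degree_mul, degree_eq_natDegree hb0, degree_X_pow]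
        exact_mod_cast (by omega : b.natDegree + n < D.natDegree)
    · simp
  rw [Finset.sum_congr rfl h1, ← Finset.sum_filter]
  have h2 : (polysLT F D.natDegree).filter (fun b => b ∈ polysLT F (D.natDegree - n)) =
      polysLT F (2 * g - n + 1) := by
    ext b
    rw [Finset.mem_filter, show D.natDegree - n = 2 * g - n + 1 by omega]
    simp only [mem_polysLT, and_iff_right_iff_imp]
    intro h
    exact h.trans_le (by exact_mod_cast (by omega : 2 * g - n + 1 ≤ D.natDegree))
  rw [h2, ← Finset.sum_mul, sum_polysLT_succ]
  have h3 : ∀ c : F, ∑ v ∈ polysLT F (2 * g - n), (resChar D (C c * X ^ (2 * g - n) + v) : ℂ) *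
      ψ ((C c * X ^ (2 * g - n) + v).coeff (2 * g - n)) =
        χ c * ψ c * resSum D (2 * g - n) := by
    intro c
    have h4 := congrArg (Int.cast : ℤ → ℂ) (sum_resChar_C_mul_X_pow_add hq hD hodd (2 * g - n) c)
    push_cast at h4
    rw [show χ c = ((quadraticChar F c : ℤ) : ℂ) from rfl, mul_right_comm, ← h4, Finset.sum_mul]
    refine Finset.sum_congr rfl fun v hv => ?_
    have : v.coeff (2 * g - n) = 0 := coeff_eq_zero_of_degree_lt (mem_polysLT.1 hv)
    simp [this]
  simp_rw [h3]
  rw [← Finset.sum_mul, gaussSum]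
  ring

end FunctionalEquation

end HyperellipticEnsemble

namespace HyperellipticEnsemble

/-! ### The size of the ensemble and the normalized L-polynomial. -/

section LPolynomial

variable {F : Type*} [Field F] [Fintype F]

theorem three_le_card (hq : Odd (Fintype.card F)) : 3 ≤ Fintype.card F := by
  have := Fintype.one_lt_card (α := F)
  obtain ⟨k, hk⟩ := hq
  omega

theorem mem_ensemble {g : ℕ} {D : F[X]} :
    D ∈ ensemble F g ↔ (D.Monic ∧ D.natDegree = 2 * g + 1) ∧ Squarefree D := by
  simp [ensemble, mem_monicOfDegree]

/-- A polynomial that is not squarefree is h²k with h monic of degree d ≥ 1, which leaves at most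
q^(2g+1-d) choices for each d. As q ≥ 3, these add up to at most half of all monic polynomials.
Errors that are o(|D|) therefore stay o(1) after averaging. -/
theorem card_pow_le_two_mul_card_ensemble (hq : Odd (Fintype.card F)) (g : ℕ) :
    Fintype.card F ^ (2 * g + 1) ≤ 2 * (ensemble F g).card := by
  classical
  have hq3 := three_le_card hq
  set q := Fintype.card F
  have hsub : monicOfDegree F (2 * g + 1) ⊆ ensemble F g ∪ (Finset.Icc 1 g).biUnion (fun d =>
      (monicOfDegree F d ×ˢ monicOfDegree F (2 * g + 1 - 2 * d)).image
        (fun p => p.1 ^ 2 * p.2)) := by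
    intro f hf
    rw [mem_monicOfDegree] at hf
    rw [Finset.mem_union]
    by_cases hs : Squarefree f
    · exact Or.inl (mem_ensemble.2 ⟨hf, hs⟩)
    · right
      rw [Squarefree] at hs
      push Not at hs
      obtain ⟨h, ⟨k, hk⟩, hu⟩ := hs
      have hh0 : h ≠ 0 := by rintro rfl; exact hf.1.ne_zero (by simp [hk])
      have hnm := normalize_associated h
      obtain ⟨k', hk'⟩ : normalize h ^ 2 ∣ f := by
        rw [hk, sq]; exact ((hnm.mul_mul hnm).dvd).mul_right k
      have hm : (normalize h).Monic := monic_normalize hh0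
      have hk'm : k'.Monic := (hm.pow 2).of_mul_monic_left (hk' ▸ hf.1)
      have hdeg : 2 * (normalize h).natDegree + k'.natDegree = 2 * g + 1 := by
        rw [← hf.2, hk', (hm.pow 2).natDegree_mul hk'm, hm.natDegree_pow]
      have hpos : 0 < (normalize h).natDegree := by
        rw [Nat.pos_iff_ne_zero]
        intro h0
        exact hu (hnm.isUnit (by rw [hm.natDegree_eq_zero.1 h0]; exact isUnit_one))
      rw [Finset.mem_biUnion]
      refine ⟨(normalize h).natDegree, Finset.mem_Icc.2 ⟨hpos, by omega⟩, ?_⟩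
      rw [Finset.mem_image]
      refine ⟨(normalize h, k'), ?_, hk'.symm⟩
      rw [Finset.mem_product, mem_monicOfDegree, mem_monicOfDegree]
      exact ⟨⟨hm, rfl⟩, hk'm, by dsimp; omega⟩
  have h1 := Finset.card_le_card hsub
  have h2 : ((Finset.Icc 1 g).biUnion (fun d =>
      (monicOfDegree F d ×ˢ monicOfDegree F (2 * g + 1 - 2 * d)).image
        (fun p => p.1 ^ 2 * p.2))).card ≤ ∑ d ∈ Finset.Icc 1 g, q ^ (2 * g + 1 - d) := by
    refine Finset.card_biUnion_le.trans (Finset.sum_le_sum fun d hd => ?_)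
    refine Finset.card_image_le.trans ?_
    rw [Finset.card_product, card_monicOfDegree, card_monicOfDegree, ← pow_add]
    have := Finset.mem_Icc.1 hd
    rw [show d + (2 * g + 1 - 2 * d) = 2 * g + 1 - d by omega]
  -- The additional last term closes the induction: 2q^m + q^m ≤ q^(m+1) because q ≥ 3.
  have h3 : ∀ j ≤ 2 * g + 1, 2 * ∑ d ∈ Finset.Icc 1 j, q ^ (2 * g + 1 - d) +
      q ^ (2 * g + 1 - j) ≤ q ^ (2 * g + 1) := by
    intro j
    induction j with
    | zero => simp
    | succ j ih =>
      intro hj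
      have := ih (by omega)
      rw [Finset.sum_Icc_succ_top (by omega)]
      rw [show 2 * g + 1 - j = (2 * g + 1 - (j + 1)) + 1 by omega, pow_succ] at this
      nlinarith [Nat.mul_le_mul_left (q ^ (2 * g + 1 - (j + 1))) hq3]
  have h4 := h3 g (by omega)
  change q ^ (2 * g + 1) ≤ _
  rw [card_monicOfDegree] at h1
  change q ^ (2 * g + 1) ≤ _ at h1
  have h5 := h1.trans (Finset.card_union_le _ _)
  omega

/-- The `L`-polynomial in the variable `y = q ^ (1/2 - s)`, so that its zeros should lie on the
unit circle. -/
noncomputable def normLPoly (D : F[X]) : ℂ[X] :=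
  ∑ n ∈ Finset.range D.natDegree,
    C ((charSum D n : ℂ) * (Fintype.card F : ℂ) ^ (-(n : ℂ) / 2)) * X ^ n

theorem card_ne_zero' : (Fintype.card F : ℂ) ≠ 0 := by exact_mod_cast Fintype.card_ne_zero

theorem eval_normLPoly (D : F[X]) (y : ℂ) : (normLPoly D).eval y =
    ∑ n ∈ Finset.range D.natDegree,
      (charSum D n : ℂ) * (Fintype.card F : ℂ) ^ (-(n : ℂ) / 2) * y ^ n := by
  simp [normLPoly, eval_finsetSum]

theorem charSum_eq_zero (hq : Odd (Fintype.card F)) {g : ℕ} {D : F[X]} (hD : D ∈ ensemble F g)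
    {n : ℕ} (hn : D.natDegree ≤ n) : charSum D n = 0 := by
  classical
  obtain ⟨⟨h1, h2⟩, h3⟩ := mem_ensemble.1 hD
  have hodd : Odd D.natDegree := ⟨g, h2⟩
  rw [charSum_eq_resSum hq h1 hodd, resSum_eq_zero hq h1 hodd hn, mul_zero]

theorem LFun_eq (hq : Odd (Fintype.card F)) {g : ℕ} {D : F[X]} (hD : D ∈ ensemble F g) (s : ℂ) :
    LFun D s = (normLPoly D).eval ((Fintype.card F : ℂ) ^ (1 / 2 - s)) := by
  rw [LFun, LPoly, tsum_eq_sum (s := Finset.range D.natDegree), eval_normLPoly]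
  · refine Finset.sum_congr rfl fun n _ => ?_
    rw [mul_assoc]
    congr 1
    rw [← Complex.cpow_nat_mul, ← Complex.cpow_nat_mul, ← Complex.cpow_add _ _ card_ne_zero']
    congr 1
    ring
  · intro n hn
    rw [charSum_eq_zero hq hD (by simpa using hn)]
    simp

theorem charSum_zero (D : F[X]) : charSum D 0 = 1 := by
  have : monicOfDegree F 0 = {1} := by
    ext f
    rw [mem_monicOfDegree, Finset.mem_singleton]
    constructor
    · rintro ⟨h1, h2⟩; exact h1.natDegree_eq_zero.1 h2
    · rintro rfl; simp
  rw [charSum, this]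
  simp [quadChar]

/-- The sign relating the two kinds of character sum depends only on the parity of n, and n and 2g -
n have the same parity. -/
theorem exists_charSum_functional_equation (hq : Odd (Fintype.card F)) {g : ℕ} {D : F[X]}
    (hD : D ∈ ensemble F g) : ∃ κ : ℂ, κ ≠ 0 ∧ ∀ n ≤ 2 * g, (charSum D n : ℂ) =
      κ * (Fintype.card F : ℂ) ^ n * charSum D (2 * g - n) := by
  classical
  obtain ⟨⟨h1, h2⟩, h3⟩ := mem_ensemble.1 hD
  have hodd : Odd D.natDegree := ⟨g, h2⟩
  obtain ⟨G, τ, hτ, h⟩ := exists_resSum_functional_equation hq h1 h3 h2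
  have hres0 : resSum D 0 = 1 := by
    have := charSum_eq_resSum hq h1 hodd 0
    rw [charSum_zero] at this
    simpa using this.symm
  -- Take n = 2g in the functional equation: the right side is then q^(2g) τ, which is nonzero.
  have hG : G ≠ 0 := by
    rintro rfl
    have := h (2 * g) le_rfl
    simp [hres0, hτ] at this
  refine ⟨τ / G, div_ne_zero hτ hG, fun n hn => ?_⟩
  rw [charSum_eq_resSum hq h1 hodd, charSum_eq_resSum hq h1 hodd]
  have hpar : (quadraticChar F (-1 : F)) ^ n = (quadraticChar F (-1 : F)) ^ (2 * g - n) := by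
    rcases quadraticChar_dichotomy (neg_ne_zero.2 (one_ne_zero (α := F))) with h | h <;> rw [h]
    · simp
    · rw [neg_one_pow_eq_pow_mod_two, neg_one_pow_eq_pow_mod_two (n := 2 * g - n)]
      congr 1
      omega
  rw [hpar]
  push_cast
  have := h n hn
  field_simp
  linear_combination ((quadraticChar F (-1 : F) : ℤ) : ℂ) ^ (2 * g - n) * this

theorem natDegree_normLPoly (hq : Odd (Fintype.card F)) {g : ℕ} {D : F[X]}
    (hD : D ∈ ensemble F g) : (normLPoly D).natDegree = 2 * g := by
  have h2 := (mem_ensemble.1 hD).1.2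
  obtain ⟨κ, hκ, h⟩ := exists_charSum_functional_equation hq hD
  refine natDegree_eq_of_le_of_coeff_ne_zero ?_ ?_
  · refine natDegree_sum_le_of_forall_le _ _ fun n hn => ?_
    refine (natDegree_C_mul_X_pow_le _ _).trans ?_
    have := Finset.mem_range.1 hn
    omega
  · have hc : (normLPoly D).coeff (2 * g) =
        (charSum D (2 * g) : ℂ) * (Fintype.card F : ℂ) ^ (-((2 * g : ℕ) : ℂ) / 2) := by
      rw [normLPoly, finsetSum_coeff]
      simp only [coeff_C_mul, coeff_X_pow]
      rw [Finset.sum_eq_single (2 * g)]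
      · simp
      · intro b _ hb; simp [hb.symm]
      · intro hb; exact absurd (Finset.mem_range.2 (by omega)) hb
    rw [hc, h _ le_rfl, tsub_self, charSum_zero]
    have := card_ne_zero' (F := F)
    have h3 : (Fintype.card F : ℂ) ^ (-((2 * g : ℕ) : ℂ) / 2) ≠ 0 := by
      rw [Complex.cpow_ne_zero_iff]; exact Or.inl this
    simp only [Int.cast_one, mul_one]
    positivity

theorem eval_zero_normLPoly (D : F[X]) (hD : D.natDegree ≠ 0) : (normLPoly D).eval 0 = 1 := by
  rw [eval_normLPoly, Finset.sum_eq_single 0]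
  · simp [charSum_zero]
  · intro b _ hb; simp [hb]
  · intro hb; exact absurd (Finset.mem_range.2 (by omega)) hb

/-- The value of κ is never needed. Only two consequences are used: inversion preserves the zeros,
and the logarithmic derivatives at y and 1/y add up to 2g. -/
theorem normLPoly_functional_equation (hq : Odd (Fintype.card F)) {g : ℕ} {D : F[X]}
    (hD : D ∈ ensemble F g) : ∃ κ : ℂ, κ ≠ 0 ∧ ∀ y : ℂ, y ≠ 0 →
      (normLPoly D).eval y = κ * y ^ (2 * g) * (normLPoly D).eval y⁻¹ := by
  have h2 := (mem_ensemble.1 hD).1.2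
  obtain ⟨κ, hκ, h⟩ := exists_charSum_functional_equation hq hD
  have hq0 := card_ne_zero' (F := F)
  refine ⟨κ * (Fintype.card F : ℂ) ^ g, by positivity, fun y hy => ?_⟩
  rw [eval_normLPoly, eval_normLPoly, ← Finset.sum_range_reflect, Finset.mul_sum]
  refine Finset.sum_congr rfl fun n hn => ?_
  have hn' : n ≤ 2 * g := by have := Finset.mem_range.1 hn; omega
  rw [show D.natDegree - 1 - n = 2 * g - n by omega, h _ (Nat.sub_le _ _),
    Nat.sub_sub_self hn']
  have e1 : (Fintype.card F : ℂ) ^ (2 * g - n) * (Fintype.card F : ℂ) ^ (-((2 * g - n : ℕ) : ℂ) / 2)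
      = (Fintype.card F : ℂ) ^ g * (Fintype.card F : ℂ) ^ (-(n : ℂ) / 2) := by
    rw [← Complex.cpow_natCast, ← Complex.cpow_natCast, ← Complex.cpow_add _ _ hq0,
      ← Complex.cpow_add _ _ hq0, Nat.cast_sub hn']
    congr 1
    push_cast
    ring
  have e2 : y ^ (2 * g - n) = y ^ (2 * g) * (y⁻¹) ^ n := by
    rw [pow_sub₀ _ hy hn', inv_pow]
  rw [e2]
  linear_combination (κ * charSum D n * y ^ (2 * g) * (y⁻¹) ^ n) * e1

end LPolynomial

end HyperellipticEnsemble

namespace HyperellipticEnsemble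

/-! ### Zeros of L(s, χ_D) as roots of the normalized L-polynomial. -/

section Zeros

/-- `log q`. -/
noncomputable def logCard (F : Type*) [Fintype F] : ℝ := Real.log (Fintype.card F)

variable {F : Type*} [Field F] [Fintype F]

theorem logCard_pos : 0 < logCard F :=
  Real.log_pos (by exact_mod_cast Fintype.one_lt_card)

theorem card_cpow (z : ℂ) : (Fintype.card F : ℂ) ^ z = Complex.exp (logCard F * z) := by
  rw [Complex.cpow_def_of_ne_zero card_ne_zero', ← Complex.natCast_log]; rfl

theorem analyticOrderAt_eval {p : ℂ[X]} (hp : p ≠ 0) (v : ℂ) :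
    analyticOrderAt (fun y => p.eval y) v = p.rootMultiplicity v := by
  obtain ⟨r, hr, hdvd⟩ := exists_eq_pow_rootMultiplicity_mul_and_not_dvd p hp v
  have han : AnalyticAt ℂ (fun y => p.eval y) v := (p.differentiable.analyticAt v)
  rw [han.analyticOrderAt_eq_natCast]
  refine ⟨fun y => r.eval y, r.differentiable.analyticAt v, ?_, Eventually.of_forall fun y => ?_⟩
  · rwa [dvd_iff_isRoot] at hdvd
  · conv_lhs => rw [hr]
    simp

/-- The change of variable s ↦ q^(1/2-s) has nowhere vanishing derivative and so preserves orders of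
vanishing. -/
theorem analyticOrderNatAt_LFun (hq : Odd (Fintype.card F)) {g : ℕ} {D : F[X]}
    (hD : D ∈ ensemble F g) (ρ : ℂ) : analyticOrderNatAt (LFun D) ρ =
      (normLPoly D).rootMultiplicity (Complex.exp (logCard F * (1 / 2 - ρ))) := by
  have hP : normLPoly D ≠ 0 := by
    intro h
    have := eval_zero_normLPoly D (by rw [(mem_ensemble.1 hD).1.2]; omega)
    simp [h] at this
  have h1 : LFun D = (fun y => (normLPoly D).eval y) ∘
      (fun s => Complex.exp (logCard F * (1 / 2 - s))) := by
    ext s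
    rw [LFun_eq hq hD, card_cpow]; rfl
  have hd : HasDerivAt (fun s : ℂ => Complex.exp (logCard F * (1 / 2 - s)))
      (Complex.exp (logCard F * (1 / 2 - ρ)) * (logCard F * (-1))) ρ := by
    have := ((hasDerivAt_id ρ).const_sub (1 / 2)).const_mul (logCard F : ℂ)
    exact this.cexp
  rw [analyticOrderNatAt, h1, analyticOrderAt_comp_of_deriv_ne_zero]
  · rw [analyticOrderAt_eval hP]; rfl
  · refine Differentiable.analyticAt ?_ ρ
    fun_prop
  · rw [hd.deriv]
    have : (logCard F : ℂ) ≠ 0 := by exact_mod_cast logCard_pos.ne'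
    simp [this, Complex.exp_ne_zero]

/-- The sum over the zeros as a sum over the roots of the normalized `L`-polynomial. -/
theorem zeroSum_eq (hq : Odd (Fintype.card F)) {g : ℕ} {D : F[X]}
    (hD : D ∈ ensemble F g) {φ : ℝ → ℂ} (hφ : ∀ x, φ (-x) = φ x) :
    zeroSum D φ = ((normLPoly D).roots.map fun v => φ (v.arg / logCard F)).sum := by
  classical
  have hl := logCard_pos (F := F)
  have hlc : (logCard F : ℂ) ≠ 0 := by exact_mod_cast hl.ne'
  have h0 : (normLPoly D).eval 0 = 1 :=
    eval_zero_normLPoly D (by rw [(mem_ensemble.1 hD).1.2]; omega)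
  have hP : normLPoly D ≠ 0 := by
    intro h; simp [h] at h0
  have hmemz : ∀ ρ : ℂ, LFun D ρ = 0 ↔
      Complex.exp (logCard F * (1 / 2 - ρ)) ∈ (normLPoly D).roots := fun ρ => by
    rw [LFun_eq hq hD, card_cpow, mem_roots hP]; rfl
  have him : ∀ ρ : ℂ, ((logCard F : ℂ) * (1 / 2 - ρ)).im = -(logCard F * ρ.im) := by
    intro ρ
    rw [Complex.im_ofReal_mul]
    simp
  have hbd : ∀ ρ ∈ zeroSet D, -Real.pi < logCard F * ρ.im ∧ logCard F * ρ.im ≤ Real.pi := by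
    intro ρ hρ
    obtain ⟨h1, h2⟩ := hρ.2
    change -(Real.pi / logCard F) < ρ.im at h1
    change ρ.im ≤ Real.pi / logCard F at h2
    rw [← neg_div, div_lt_iff₀ hl] at h1
    rw [le_div_iff₀ hl] at h2
    constructor <;> linarith
  have hbij : Set.BijOn (fun ρ : ℂ => Complex.exp (logCard F * (1 / 2 - ρ))) (zeroSet D)
      ((normLPoly D).roots.toFinset : Set ℂ) := by
    refine ⟨fun ρ hρ => ?_, fun ρ hρ ρ' hρ' h => ?_, fun v hv => ?_⟩
    · simpa using (hmemz ρ).1 hρ.1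
    · obtain ⟨n, hn⟩ := Complex.exp_eq_exp_iff_exists_int.1 h
      have h1 := congrArg Complex.im hn
      rw [Complex.add_im, him, him] at h1
      have h2 : ((n : ℂ) * (2 * Real.pi * Complex.I)).im = n * (2 * Real.pi) := by
        simp
      rw [h2] at h1
      obtain ⟨b1, b2⟩ := hbd ρ hρ
      obtain ⟨b1', b2'⟩ := hbd ρ' hρ'
      have n1 : (n : ℝ) < 1 := by nlinarith [Real.pi_pos]
      have n2 : (-1 : ℝ) < n := by nlinarith [Real.pi_pos]
      have n0 : n = 0 := by
        have : n < 1 := by exact_mod_cast n1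
        have : -1 < n := by exact_mod_cast n2
        omega
      rw [n0] at hn
      have h3 := mul_left_cancel₀ hlc (by simpa using hn :
        (logCard F : ℂ) * (2⁻¹ - ρ) = logCard F * (2⁻¹ - ρ'))
      linear_combination -h3
    · have hv' : v ∈ (normLPoly D).roots := by simpa using hv
      have hv0 : v ≠ 0 := by
        rintro rfl
        rw [mem_roots hP, IsRoot, h0] at hv'
        exact one_ne_zero hv'
      have key : ∀ w : ℂ, Complex.exp w = v → -Real.pi ≤ w.im → w.im < Real.pi →
          v ∈ (fun ρ : ℂ => Complex.exp (logCard F * (1 / 2 - ρ))) '' zeroSet D := by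
        intro w hw h1 h2
        have e : (logCard F : ℂ) * (1 / 2 - (1 / 2 - w / logCard F)) = w := by
          field_simp; ring
        refine ⟨1 / 2 - w / logCard F, ⟨?_, ?_⟩, by dsimp; rw [e, hw]⟩
        · rw [hmemz, e, hw]; exact hv'
        · have : (1 / 2 - w / (logCard F : ℂ)).im = -w.im / logCard F := by
            rw [Complex.sub_im, Complex.div_ofReal_im]; simp [neg_div]
          rw [this]
          constructor
          · rw [← neg_div]; exact (div_lt_div_iff_of_pos_right hl).2 (by linarith)
          · exact (div_le_div_iff_of_pos_right hl).2 (by linarith)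
      -- Passing from v to ρ reverses the sign of the imaginary part, so the principal logarithm of
      -- a negative real v would give the excluded endpoint of the period. The logarithm lower by
      -- 2πi is used instead.
      by_cases harg : v.arg = Real.pi
      · refine key (Complex.log v - 2 * Real.pi * Complex.I) ?_ ?_ ?_
        · rw [Complex.exp_sub, Complex.exp_log hv0, Complex.exp_two_pi_mul_I, div_one]
        · simp [Complex.log_im, harg]; linarith
        · simp [Complex.log_im, harg]; linarith [Real.pi_pos]
      · refine key (Complex.log v) (Complex.exp_log hv0) ?_ ?_
        · rw [Complex.log_im]; exact (Complex.neg_pi_lt_arg v).le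
        · rw [Complex.log_im]; exact lt_of_le_of_ne (Complex.arg_le_pi v) harg
  have h2 : ∀ ρ ∈ zeroSet D, (analyticOrderNatAt (LFun D) ρ : ℂ) * φ ρ.im =
      (fun v : ℂ => ((normLPoly D).roots.count v : ℂ) * φ (v.arg / logCard F))
        (Complex.exp (logCard F * (1 / 2 - ρ))) := by
    intro ρ hρ
    dsimp only
    rw [analyticOrderNatAt_LFun hq hD, count_roots]
    congr 1
    obtain ⟨b1, b2⟩ := hbd ρ hρ
    rcases b2.eq_or_lt with h | h
    · have : (Complex.exp (logCard F * (1 / 2 - ρ))).arg = Real.pi := by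
        have e : Complex.exp (logCard F * (1 / 2 - ρ)) =
            Complex.exp (logCard F * (1 / 2 - ρ) + 2 * Real.pi * Complex.I) := by
          rw [Complex.exp_add, Complex.exp_two_pi_mul_I, mul_one]
        have i1 : (logCard F * (1 / 2 - ρ) + 2 * Real.pi * Complex.I).im = Real.pi := by
          rw [Complex.add_im, him, h]; simp; ring
        rw [e, Complex.arg_exp, i1, toIocMod_eq_self]
        constructor <;> linarith [Real.pi_pos]
      rw [this, ← h, mul_div_cancel_left₀ _ hl.ne']
    · have : (Complex.exp (logCard F * (1 / 2 - ρ))).arg = -(logCard F * ρ.im) := by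
        rw [Complex.arg_exp, him, toIocMod_eq_self]
        constructor <;> linarith [Real.pi_pos]
      rw [this, neg_div, hφ, mul_div_cancel_left₀ _ hl.ne']
  rw [zeroSum, finsum_mem_eq_of_bijOn (g := fun v : ℂ =>
      ((normLPoly D).roots.count v : ℂ) * φ (v.arg / logCard F)) _ hbij h2, finsum_mem_coe_finset,
    Finset.sum_multiset_map_count]
  simp

end Zeros

end HyperellipticEnsemble

namespace HyperellipticEnsemble

/-! ### Convergence and differentiation of the Euler product. -/

section EulerProduct

variable {F : Type*} [Field F] [Fintype F]

/-- The monic irreducible polynomials. -/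
abbrev PrimePoly (F : Type*) [Field F] := {P : F[X] // P.Monic ∧ Irreducible P}

theorem one_lt_cardReal : (1 : ℝ) < Fintype.card F := by
  exact_mod_cast Fintype.one_lt_card

theorem PrimePoly.natDegree_pos (P : PrimePoly F) : 0 < P.1.natDegree := P.2.2.natDegree_pos

/-- There are at most q^n primes of degree n, simply because there are q^n monic polynomials; no
prime number theorem is needed. -/
theorem summable_primePoly {u : ℕ → ℝ} (hu0 : ∀ n, 0 ≤ u n)
    (hu : Summable fun n => (Fintype.card F : ℝ) ^ n * u n) :
    Summable fun P : PrimePoly F => u P.1.natDegree := by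
  have h : Summable fun x : (Σ n : ℕ, monicOfDegree F n) => u x.1 := by
    rw [summable_sigma_of_nonneg (fun x => hu0 _)]
    refine ⟨fun n => Summable.of_finite, ?_⟩
    refine hu.congr fun n => ?_
    rw [tsum_fintype]
    simp [card_monicOfDegree]
  let i : PrimePoly F → (Σ n : ℕ, monicOfDegree F n) :=
    fun P => ⟨P.1.natDegree, P.1, mem_monicOfDegree.2 ⟨P.2.1, rfl⟩⟩
  have hi : Function.Injective i := fun P Q hPQ => by
    have := congrArg (fun x : (Σ n : ℕ, monicOfDegree F n) => (x.2 : F[X])) hPQ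
    exact Subtype.ext this
  exact h.comp_injective hi

/-- The Euler factor of `A_D(α; γ)`, minus `1`, in the variables `x = q ^ (-2α)` and
`y = q ^ (-α-γ)`. -/
noncomputable def eulerTerm (P : PrimePoly F) (x y : ℂ) : ℂ :=
  (y ^ P.1.natDegree - x ^ P.1.natDegree) /
    (((Fintype.card F : ℂ) ^ P.1.natDegree + 1) *
      ((Fintype.card F : ℂ) ^ P.1.natDegree - y ^ P.1.natDegree))

/-- `A_D(α; γ)` in the variables `x = q ^ (-2α)` and `y = q ^ (-α-γ)`. -/
noncomputable def eulerProd (F : Type*) [Field F] [Fintype F] (x y : ℂ) : ℂ :=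
  ∏' P : PrimePoly F, (1 + eulerTerm P x y)

/-- The summand of `A_D'(r; r) / log q` in the variable `x = q ^ (-2r)`. -/
noncomputable def arithTerm (P : PrimePoly F) (x : ℂ) : ℂ :=
  P.1.natDegree * x ^ P.1.natDegree / (((Fintype.card F : ℂ) ^ P.1.natDegree + 1) *
      ((Fintype.card F : ℂ) ^ P.1.natDegree - x ^ P.1.natDegree))

/-- `A_D'(r; r) / log q` in the variable `x = q ^ (-2r)`. -/
noncomputable def arithSum (F : Type*) [Field F] [Fintype F] (x : ℂ) : ℂ :=
  ∑' P : PrimePoly F, arithTerm P x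

theorem pow_sub_ne_zero {y : ℂ} (hy : ‖y‖ < Fintype.card F) {d : ℕ} (hd : 0 < d) :
    (Fintype.card F : ℂ) ^ d - y ^ d ≠ 0 := by
  intro h
  have h1 := congrArg norm (sub_eq_zero.1 h)
  rw [norm_pow, norm_pow, Complex.norm_natCast] at h1
  exact absurd h1 (pow_lt_pow_left₀ hy (norm_nonneg _) hd.ne').ne'

theorem pow_add_one_ne_zero (d : ℕ) : (Fintype.card F : ℂ) ^ d + 1 ≠ 0 := by
  exact_mod_cast Nat.succ_ne_zero (Fintype.card F ^ d)

/-- The denominator is of size q^(2d) while |y| stays below q. Against q^d primes of degree d this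
leaves a geometric series of ratio σ/q, so the product and the arithmetic sum converge for arguments
of modulus below q, well past the unit circle. -/
theorem inv_norm_le {σ : ℝ} (hσ0 : 0 ≤ σ) (hσ : σ < Fintype.card F) {y : ℂ} (hy : ‖y‖ ≤ σ)
    {d : ℕ} (hd : 0 < d) :
    ‖((Fintype.card F : ℂ) ^ d + 1) * ((Fintype.card F : ℂ) ^ d - y ^ d)‖⁻¹ ≤
      (1 - σ / Fintype.card F)⁻¹ * (((Fintype.card F : ℝ) ^ 2)⁻¹) ^ d := by
  set q : ℝ := (Fintype.card F : ℝ) with hqdef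
  have hq0 : 0 < q := lt_of_le_of_lt hσ0 hσ
  have h1 : q ^ d * (1 - σ / q) ≤ ‖(Fintype.card F : ℂ) ^ d - y ^ d‖ := by
    have h2 : ‖(Fintype.card F : ℂ) ^ d‖ - ‖y ^ d‖ ≤ ‖(Fintype.card F : ℂ) ^ d - y ^ d‖ :=
      norm_sub_norm_le _ _
    rw [norm_pow, norm_pow, Complex.norm_natCast] at h2
    have h3 : ‖y‖ ^ d ≤ q ^ d * (σ / q) := by
      have e : (σ / q) ^ d ≤ σ / q :=
        pow_le_of_le_one (by positivity) ((div_le_one hq0).2 hσ.le) hd.ne'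
      calc ‖y‖ ^ d ≤ σ ^ d := pow_le_pow_left₀ (norm_nonneg _) hy d
        _ = q ^ d * (σ / q) ^ d := by rw [← mul_pow, mul_div_cancel₀ _ hq0.ne']
        _ ≤ _ := by gcongr
    linarith
  have h4 : q ^ d ≤ ‖(Fintype.card F : ℂ) ^ d + 1‖ := by
    have : (Fintype.card F : ℂ) ^ d + 1 = ((q ^ d + 1 : ℝ) : ℂ) := by
      rw [hqdef]; push_cast; rfl
    rw [this, Complex.norm_of_nonneg (by positivity)]
    linarith
  have h5 : 0 < 1 - σ / q := by
    rw [sub_pos, div_lt_one hq0]; exact hσ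
  rw [norm_mul, inv_pow, ← mul_inv]
  apply inv_anti₀ (by positivity)
  calc (1 - σ / q) * (q ^ 2) ^ d = q ^ d * (q ^ d * (1 - σ / q)) := by ring
    _ ≤ _ := by gcongr

theorem norm_eulerTerm_le {σ : ℝ} (hσ0 : 0 ≤ σ) (hσ : σ < Fintype.card F) {x y : ℂ}
    (hx : ‖x‖ ≤ σ) (hy : ‖y‖ ≤ σ) (P : PrimePoly F) : ‖eulerTerm P x y‖ ≤
      2 * (1 - σ / Fintype.card F)⁻¹ * (σ / (Fintype.card F : ℝ) ^ 2) ^ P.1.natDegree := by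
  rw [eulerTerm, norm_div, div_eq_mul_inv]
  have h1 : ‖y ^ P.1.natDegree - x ^ P.1.natDegree‖ ≤ 2 * σ ^ P.1.natDegree := by
    refine (norm_sub_le _ _).trans ?_
    rw [norm_pow, norm_pow, two_mul]
    gcongr
  calc _ ≤ 2 * σ ^ P.1.natDegree * ((1 - σ / Fintype.card F)⁻¹ *
        (((Fintype.card F : ℝ) ^ 2)⁻¹) ^ P.1.natDegree) :=
        mul_le_mul h1 (inv_norm_le hσ0 hσ hy P.natDegree_pos) (by positivity) (by positivity)
    _ = _ := by rw [div_eq_mul_inv σ (_ ^ 2), mul_pow]; ring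

theorem norm_arithTerm_le {σ : ℝ} (hσ0 : 0 ≤ σ) (hσ : σ < Fintype.card F) {x : ℂ}
    (hx : ‖x‖ ≤ σ) (P : PrimePoly F) : ‖arithTerm P x‖ ≤
      (1 - σ / Fintype.card F)⁻¹ *
        (P.1.natDegree * (σ / (Fintype.card F : ℝ) ^ 2) ^ P.1.natDegree) := by
  rw [arithTerm, norm_div, div_eq_mul_inv, norm_mul, norm_pow, Complex.norm_natCast]
  calc _ ≤ P.1.natDegree * σ ^ P.1.natDegree * ((1 - σ / Fintype.card F)⁻¹ *
        (((Fintype.card F : ℝ) ^ 2)⁻¹) ^ P.1.natDegree) :=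
        mul_le_mul (by gcongr) (inv_norm_le hσ0 hσ hx P.natDegree_pos) (by positivity)
          (by positivity)
    _ = _ := by rw [div_eq_mul_inv σ (_ ^ 2), mul_pow]; ring

theorem summable_eulerBound {σ : ℝ} (hσ0 : 0 ≤ σ) (hσ : σ < Fintype.card F) :
    Summable fun P : PrimePoly F =>
      2 * (1 - σ / Fintype.card F)⁻¹ * (σ / (Fintype.card F : ℝ) ^ 2) ^ P.1.natDegree := by
  have hq0 : (0 : ℝ) < Fintype.card F := lt_of_le_of_lt hσ0 hσ
  refine (summable_primePoly (u := fun n => (σ / (Fintype.card F : ℝ) ^ 2) ^ n)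
    (fun n => by positivity) ?_).mul_left _
  have : Summable fun n : ℕ => (σ / (Fintype.card F : ℝ)) ^ n :=
    summable_geometric_of_lt_one (by positivity) ((div_lt_one hq0).2 hσ)
  refine this.congr fun n => ?_
  rw [← mul_pow]; congr 1; field_simp

theorem summable_arithBound {σ : ℝ} (hσ0 : 0 ≤ σ) (hσ : σ < Fintype.card F) :
    Summable fun P : PrimePoly F => (1 - σ / Fintype.card F)⁻¹ *
        (P.1.natDegree * (σ / (Fintype.card F : ℝ) ^ 2) ^ P.1.natDegree) := by
  have hq0 : (0 : ℝ) < Fintype.card F := lt_of_le_of_lt hσ0 hσ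
  refine (summable_primePoly (u := fun n => n * (σ / (Fintype.card F : ℝ) ^ 2) ^ n)
    (fun n => by positivity) ?_).mul_left _
  have : Summable fun n : ℕ => (n : ℝ) ^ 1 * (σ / (Fintype.card F : ℝ)) ^ n := by
    apply summable_pow_mul_geometric_of_norm_lt_one
    rw [Real.norm_of_nonneg (by positivity)]
    exact (div_lt_one hq0).2 hσ
  refine this.congr fun n => ?_
  rw [pow_one, mul_left_comm, ← mul_pow]; congr 2; field_simp

theorem differentiableAt_eulerTerm (P : PrimePoly F) {φ ψ : ℂ → ℂ} {a : ℂ}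
    (hφ : DifferentiableAt ℂ φ a) (hψ : DifferentiableAt ℂ ψ a) (h : ‖ψ a‖ < Fintype.card F) :
    DifferentiableAt ℂ (fun a => eulerTerm P (φ a) (ψ a)) a := by
  unfold eulerTerm
  refine DifferentiableAt.div (by fun_prop) (by fun_prop)
    (mul_ne_zero (pow_add_one_ne_zero _) (pow_sub_ne_zero h P.natDegree_pos))

/-- Near each point the Euler product converges uniformly. -/
theorem exists_multipliable_eulerTerm {U : Set ℂ} (hU : IsOpen U) {φ ψ : ℂ → ℂ}
    (hφ : DifferentiableOn ℂ φ U) (hψ : DifferentiableOn ℂ ψ U) {a : ℂ} (ha : a ∈ U)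
    (hφa : ‖φ a‖ < Fintype.card F) (hψa : ‖ψ a‖ < Fintype.card F) :
    ∃ V : Set ℂ, IsOpen V ∧ a ∈ V ∧
      (∀ P : PrimePoly F, DifferentiableOn ℂ (fun a => 1 + eulerTerm P (φ a) (ψ a)) V) ∧
      MultipliableLocallyUniformlyOn
        (fun (P : PrimePoly F) a => 1 + eulerTerm P (φ a) (ψ a)) V := by
  obtain ⟨σ, hσ1, hσ2⟩ := exists_between (max_lt hφa hψa)
  have hσ0 : 0 ≤ σ := (norm_nonneg (φ a)).trans ((le_max_left _ _).trans hσ1.le)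
  have hnb : ∀ᶠ b in 𝓝 a, b ∈ U ∧ ‖φ b‖ < σ ∧ ‖ψ b‖ < σ := by
    refine (hU.mem_nhds ha |> fun h => (h : ∀ᶠ b in 𝓝 a, b ∈ U)).and (Eventually.and ?_ ?_)
    · exact ((hφ.differentiableAt (hU.mem_nhds ha)).continuousAt.norm).eventually_lt
        continuousAt_const ((le_max_left _ _).trans_lt hσ1)
    · exact ((hψ.differentiableAt (hU.mem_nhds ha)).continuousAt.norm).eventually_lt
        continuousAt_const ((le_max_right _ _).trans_lt hσ1)
  obtain ⟨V, hV, hVo, haV⟩ := eventually_nhds_iff.1 hnb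
  have hdiff : ∀ P : PrimePoly F, DifferentiableOn ℂ (fun a => eulerTerm P (φ a) (ψ a)) V :=
    fun P b hb => (differentiableAt_eulerTerm P (hφ.differentiableAt (hU.mem_nhds (hV b hb).1))
      (hψ.differentiableAt (hU.mem_nhds (hV b hb).1))
      ((hV b hb).2.2.trans hσ2)).differentiableWithinAt
  refine ⟨V, hVo, haV, fun P => (hdiff P).const_add 1, ?_⟩
  refine Summable.multipliableLocallyUniformlyOn_one_add hVo (summable_eulerBound hσ0 hσ2)
    (Eventually.of_forall fun P b hb => norm_eulerTerm_le hσ0 hσ2 (hV b hb).2.1.le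
      (hV b hb).2.2.le P) fun P => (hdiff P).continuousOn

theorem differentiableOn_eulerProd {U : Set ℂ} (hU : IsOpen U) {φ ψ : ℂ → ℂ}
    (hφ : DifferentiableOn ℂ φ U) (hψ : DifferentiableOn ℂ ψ U)
    (hφa : ∀ a ∈ U, ‖φ a‖ < Fintype.card F) (hψa : ∀ a ∈ U, ‖ψ a‖ < Fintype.card F) :
    DifferentiableOn ℂ (fun a => eulerProd F (φ a) (ψ a)) U := by
  intro a ha
  obtain ⟨V, hVo, haV, hd, hm⟩ :=
    exists_multipliable_eulerTerm hU hφ hψ ha (hφa a ha) (hψa a ha)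
  have := hm.hasProdLocallyUniformlyOn.differentiableOn
    (.of_forall fun s => by simpa [Finset.prod_fn] using
      DifferentiableOn.finsetProd (fun P _ => hd P)) hVo
  exact (this.differentiableAt (hVo.mem_nhds haV)).differentiableWithinAt

theorem eulerProd_self (x : ℂ) : eulerProd F x x = 1 := by
  simp [eulerProd, eulerTerm]

theorem differentiableAt_arithTerm (P : PrimePoly F) {x : ℂ} (hx : ‖x‖ < Fintype.card F) :
    DifferentiableAt ℂ (arithTerm P) x := by
  have : arithTerm P = fun x : ℂ => P.1.natDegree * x ^ P.1.natDegree /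
    (((Fintype.card F : ℂ) ^ P.1.natDegree + 1) *
      ((Fintype.card F : ℂ) ^ P.1.natDegree - x ^ P.1.natDegree)) := rfl
  rw [this]
  exact DifferentiableAt.div (by fun_prop) (by fun_prop) (mul_ne_zero (pow_add_one_ne_zero _)
    (pow_sub_ne_zero hx P.natDegree_pos))

theorem differentiableOn_arithSum :
    DifferentiableOn ℂ (arithSum F) {x | ‖x‖ < Fintype.card F} := by
  intro a ha
  obtain ⟨σ, hσ1, hσ2⟩ := exists_between (show ‖a‖ < (Fintype.card F : ℝ) from ha)
  have hσ0 : 0 ≤ σ := (norm_nonneg a).trans hσ1.le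
  have hopen : IsOpen {x : ℂ | ‖x‖ < σ} := isOpen_lt continuous_norm continuous_const
  have := Complex.differentiableOn_tsum_of_summable_norm (summable_arithBound hσ0 hσ2)
    (F := fun P : PrimePoly F => arithTerm P) (U := {x : ℂ | ‖x‖ < σ})
    (fun P b hb => (differentiableAt_arithTerm P
      (lt_trans (show ‖b‖ < σ from hb) hσ2)).differentiableWithinAt)
    hopen (fun P b hb => norm_arithTerm_le hσ0 hσ2 (le_of_lt hb) P)
  exact (this.differentiableAt (hopen.mem_nhds hσ1)).differentiableWithinAt

theorem arithSum_zero : arithSum F 0 = 0 := by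
  rw [arithSum]
  convert tsum_zero with P
  simp [arithTerm, P.natDegree_pos.ne']

/-- At a = c every Euler factor equals 1, and so does the product. Hence its derivative is its
logarithmic derivative, which is the sum of the derivatives of the factors. -/
theorem hasDerivAt_eulerProd {c : ℂ} (hc0 : c ≠ 0) (hc : ‖c ^ 2‖ < Fintype.card F) :
    HasDerivAt (fun a => eulerProd F (a ^ 2) (a * c)) (-(arithSum F (c ^ 2) / c)) c := by
  have hcc : ‖c * c‖ < Fintype.card F := by rwa [← sq]
  obtain ⟨V, hVo, haV, hd, hm⟩ := exists_multipliable_eulerTerm (F := F) isOpen_univ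
    (φ := fun a => a ^ 2) (ψ := fun a => a * c) (by fun_prop) (by fun_prop) (Set.mem_univ c) hc hcc
  have hder : ∀ P : PrimePoly F, HasDerivAt (fun a => 1 + eulerTerm P (a ^ 2) (a * c))
      (-(arithTerm P (c ^ 2) / c)) c := by
    intro P
    unfold eulerTerm arithTerm
    set d := P.1.natDegree with hddef
    have hd0 : 0 < d := P.natDegree_pos
    have hne := mul_ne_zero (pow_add_one_ne_zero (F := F) d) (pow_sub_ne_zero hc hd0)
    have hne' := mul_ne_zero (pow_add_one_ne_zero (F := F) d) (pow_sub_ne_zero hcc hd0)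
    have n1 : HasDerivAt (fun a : ℂ => (a * c) ^ d - (a ^ 2) ^ d)
        ((d : ℂ) * (c * c) ^ (d - 1) * (1 * c) - (d : ℂ) * (c ^ 2) ^ (d - 1) * (2 * c)) c := by
      have e1 := ((hasDerivAt_id c).mul_const c).fun_pow d
      have e2 := ((hasDerivAt_pow 2 c)).fun_pow d
      convert! e1.sub e2 using 1
      simp
    have n2 : DifferentiableAt ℂ (fun a : ℂ => ((Fintype.card F : ℂ) ^ d + 1) *
      ((Fintype.card F : ℂ) ^ d - (a * c) ^ d)) c := by fun_prop
    have n3 := (n1.div n2.hasDerivAt hne').const_add 1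
    convert! n3 using 1
    have e : (c * c) ^ d - (c ^ 2) ^ d = 0 := by rw [← sq, sub_self]
    rw [e, zero_mul, sub_zero, ← sq]
    obtain ⟨k, hk⟩ : ∃ k, d = k + 1 := ⟨d - 1, by omega⟩
    rw [hk] at hne ⊢
    rw [add_tsub_cancel_right]
    generalize ((Fintype.card F : ℂ) ^ (k + 1) + 1) *
      ((Fintype.card F : ℂ) ^ (k + 1) - (c ^ 2) ^ (k + 1)) = Q at hne ⊢
    field_simp
    ring
  have hval : ∀ P : PrimePoly F, 1 + eulerTerm P (c ^ 2) (c * c) = 1 := fun P => by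
    simp [eulerTerm, ← sq]
  have hlog : ∀ P : PrimePoly F, logDeriv (fun a => 1 + eulerTerm P (a ^ 2) (a * c)) c =
      -(arithTerm P (c ^ 2) / c) := fun P => by
    rw [logDeriv_apply, (hder P).deriv, hval, div_one]
  have hsum : Summable fun P : PrimePoly F => -(arithTerm P (c ^ 2) / c) := by
    refine (Summable.div_const ?_ c).neg
    refine Summable.of_norm_bounded (summable_arithBound (norm_nonneg _) hc) fun P =>
      norm_arithTerm_le (norm_nonneg _) hc le_rfl P
  have h1 : eulerProd F (c ^ 2) (c * c) = 1 := by rw [← sq, eulerProd_self]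
  have key := logDeriv_tprod_eq_tsum hVo haV
    (f := fun (P : PrimePoly F) a => 1 + eulerTerm P (a ^ 2) (a * c))
    (fun P => by rw [hval]; exact one_ne_zero) hd (by simpa only [hlog] using hsum) hm
    (by change eulerProd F (c ^ 2) (c * c) ≠ 0; rw [h1]; exact one_ne_zero)
  have hdiff : DifferentiableAt ℂ (fun a => eulerProd F (a ^ 2) (a * c)) c := by
    have := differentiableOn_eulerProd (F := F) (U := {a | ‖a ^ 2‖ < Fintype.card F} ∩
      {a | ‖a * c‖ < Fintype.card F})
      ((isOpen_lt (by fun_prop) continuous_const).inter (isOpen_lt (by fun_prop) continuous_const))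
      (φ := fun a => a ^ 2) (ψ := fun a => a * c) (by fun_prop) (by fun_prop)
      (fun a ha => ha.1) (fun a ha => ha.2)
    exact this.differentiableAt (((isOpen_lt (by fun_prop) continuous_const).inter
      (isOpen_lt (by fun_prop) continuous_const)).mem_nhds ⟨hc, hcc⟩)
  have h2 := hdiff.hasDerivAt
  have h3 : deriv (fun a => eulerProd F (a ^ 2) (a * c)) c = -(arithSum F (c ^ 2) / c) := by
    have : logDeriv (fun a => eulerProd F (a ^ 2) (a * c)) c = -(arithSum F (c ^ 2) / c) := by
      change logDeriv (fun a => ∏' P : PrimePoly F, (1 + eulerTerm P (a ^ 2) (a * c))) c = _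
      rw [key]
      simp only [hlog]
      rw [tsum_neg, tsum_div_const]; rfl
    rw [← this, logDeriv_apply, h1, div_one]
  rwa [h3] at h2

end EulerProduct

end HyperellipticEnsemble

namespace HyperellipticEnsemble

/-! ### The ratios conjecture in exponential variables. -/

section MainTerms

variable {F : Type*} [Field F] [Fintype F]

theorem logCard_ne_zero : (logCard F : ℂ) ≠ 0 := by exact_mod_cast logCard_pos.ne'

theorem polyNorm_eq {f : F[X]} (hf : f ≠ 0) :
    polyNorm f = (Fintype.card F : ℝ) ^ f.natDegree := by
  rw [polyNorm, if_neg hf]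

theorem polyNorm_cpow {f : F[X]} (hf : f ≠ 0) (z : ℂ) :
    (polyNorm f : ℂ) ^ z = Complex.exp (logCard F * z) ^ f.natDegree := by
  have hq := one_lt_cardReal (F := F)
  have h0 : (polyNorm f : ℂ) ≠ 0 := by
    rw [polyNorm_eq hf]
    exact_mod_cast (pow_pos (show (0 : ℝ) < Fintype.card F by linarith) f.natDegree).ne'
  rw [Complex.cpow_def_of_ne_zero h0, ← Complex.ofReal_log (by rw [polyNorm_eq hf]; positivity),
    polyNorm_eq hf, Real.log_pow, ← Complex.exp_nat_mul, logCard]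
  push_cast
  ring_nf

theorem exp_neg_sq (z : ℂ) : Complex.exp (-z) ^ 2 = Complex.exp (-(2 * z)) := by
  rw [← Complex.exp_nat_mul]; congr 1; push_cast; ring

/-- The identity holds factor by factor. The bound on the modulus is needed only to invert the zeta
factor of each prime. -/
theorem eulerA_eq {α γ : ℂ}
    (h : ‖Complex.exp (-(logCard F * α)) * Complex.exp (-(logCard F * γ))‖ < Fintype.card F) :
    eulerA F α γ = eulerProd F (Complex.exp (-(logCard F * α)) ^ 2)
      (Complex.exp (-(logCard F * α)) * Complex.exp (-(logCard F * γ))) := by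
  rw [eulerA, eulerProd]
  refine tprod_congr fun P => ?_
  set y := Complex.exp (-(logCard F * α)) * Complex.exp (-(logCard F * γ)) with hy
  set x := Complex.exp (-(logCard F * α)) ^ 2 with hx
  set d := P.1.natDegree with hd
  have hP0 : P.1 ≠ 0 := P.2.2.ne_zero
  have hx0 : x ≠ 0 := pow_ne_zero _ (Complex.exp_ne_zero _)
  have hy0 : y ≠ 0 := mul_ne_zero (Complex.exp_ne_zero _) (Complex.exp_ne_zero _)
  have hexpl : Complex.exp (logCard F) = Fintype.card F := by
    rw [← mul_one (logCard F : ℂ), ← card_cpow, Complex.cpow_one]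
  have e1 : (polyNorm P.1 : ℂ) ^ (1 + α + γ) = (Fintype.card F : ℂ) ^ d / y ^ d := by
    rw [polyNorm_cpow hP0, ← div_pow, hy, ← hexpl, ← Complex.exp_add, ← Complex.exp_sub]
    congr 2; ring
  have e2 : (polyNorm P.1 : ℂ) ^ (1 + 2 * α) = (Fintype.card F : ℂ) ^ d / x ^ d := by
    rw [polyNorm_cpow hP0, ← div_pow, hx, exp_neg_sq, ← hexpl, ← Complex.exp_sub]
    congr 2; ring
  have e3 : (polyNorm P.1 : ℂ) ^ (α + γ) = 1 / y ^ d := by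
    rw [polyNorm_cpow hP0, one_div, ← inv_pow, hy, ← Complex.exp_add, ← Complex.exp_neg]
    congr 2; ring
  have e4 : (polyNorm P.1 : ℂ) = (Fintype.card F : ℂ) ^ d := by
    rw [polyNorm_eq hP0]; push_cast; rfl
  rw [e1, e2, e3, e4, eulerTerm]
  have n1 := pow_sub_ne_zero h P.2.2.natDegree_pos
  have n2 := pow_add_one_ne_zero (F := F) d
  have n3 : (Fintype.card F : ℂ) ^ d ≠ 0 := pow_ne_zero _ card_ne_zero'
  rw [← hd] at n1 ⊢
  have hxd : x ^ d ≠ 0 := pow_ne_zero _ hx0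
  have hyd : y ^ d ≠ 0 := pow_ne_zero _ hy0
  generalize (Fintype.card F : ℂ) ^ d = N at *
  generalize x ^ d = X at *
  generalize y ^ d = Y at *
  have n4 : 1 - 1 / (N / Y) ≠ 0 := by
    rw [one_div_div, one_sub_div n3]
    exact div_ne_zero n1 n3
  rw [inv_mul_eq_iff_eq_mul₀ n4]
  field_simp
  ring

/-- The main term of the ratios conjecture in the variables `a = q ^ (-α)`, `c = q ^ (-γ)`. -/
noncomputable def ratioMain (F : Type*) [Field F] [Fintype F] (g : ℕ) (a c : ℂ) : ℂ :=
  (1 - a * c) / (1 - a ^ 2) * eulerProd F (a ^ 2) (a * c) +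
    a ^ (2 * g) * ((1 - a⁻¹ * c) / (1 - a⁻¹ ^ 2)) * eulerProd F (a⁻¹ ^ 2) (a⁻¹ * c)

theorem zetaA_one_add (z : ℂ) : zetaA F (1 + z) = 1 / (1 - Complex.exp (-(logCard F * z))) := by
  rw [zetaA, card_cpow]
  congr 3; ring_nf

/-- The main term depends on D only through its degree, with |D|^(-α) X(1/2+α) = a^(2g+1) a⁻¹.
Summation over the ensemble is then multiplication by its size. -/
theorem ratioMainTerm_eq {g : ℕ} {D : F[X]} (hD : D ∈ ensemble F g) {α γ a c : ℂ}
    (ha : a = Complex.exp (-(logCard F * α))) (hc : c = Complex.exp (-(logCard F * γ)))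
    (h1 : ‖a * c‖ < Fintype.card F) (h2 : ‖a⁻¹ * c‖ < Fintype.card F) :
    ratioMainTerm D α γ = ratioMain F g a c := by
  have ha0 : a ≠ 0 := by rw [ha]; exact Complex.exp_ne_zero _
  have hainv : a⁻¹ = Complex.exp (-(logCard F * (-α))) := by
    rw [ha, ← Complex.exp_neg]; congr 1; ring
  have hE1 : eulerA F α γ = eulerProd F (a ^ 2) (a * c) := by
    rw [ha, hc]; exact eulerA_eq (by rwa [← ha, ← hc])
  have hE2 : eulerA F (-α) γ = eulerProd F (a⁻¹ ^ 2) (a⁻¹ * c) := by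
    rw [hainv, hc]; exact eulerA_eq (by rwa [← hainv, ← hc])
  have hz1 : zetaA F (1 + 2 * α) = 1 / (1 - a ^ 2) := by
    rw [zetaA_one_add, ha, exp_neg_sq]; congr 3; ring_nf
  have hz2 : zetaA F (1 + α + γ) = 1 / (1 - a * c) := by
    rw [add_assoc, zetaA_one_add, ha, hc, ← Complex.exp_add]; congr 3; ring
  have hz3 : zetaA F (1 - 2 * α) = 1 / (1 - a⁻¹ ^ 2) := by
    rw [sub_eq_add_neg, zetaA_one_add, hainv, exp_neg_sq]; congr 3; ring_nf
  have hz4 : zetaA F (1 - α + γ) = 1 / (1 - a⁻¹ * c) := by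
    rw [sub_eq_add_neg, add_assoc, zetaA_one_add, hainv, hc, ← Complex.exp_add]; congr 3; ring
  have hD0 : D ≠ 0 := (mem_ensemble.1 hD).1.1.ne_zero
  have hN : (polyNorm D : ℂ) ^ (-α) = a ^ (2 * g + 1) := by
    rw [polyNorm_cpow hD0, (mem_ensemble.1 hD).1.2, ha]; congr 2; ring
  have hX : XFactor F (1 / 2 + α) = a⁻¹ := by
    rw [XFactor, card_cpow, hainv]; congr 1; ring
  rw [ratioMainTerm, ratioMain, hE1, hE2, hz1, hz2, hz3, hz4, hN, hX]
  have e : a ^ (2 * g + 1) * a⁻¹ = a ^ (2 * g) := by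
    rw [pow_succ, mul_assoc, mul_inv_cancel₀ ha0, mul_one]
  rw [e]
  simp only [one_div, div_inv_eq_mul]
  ring

/-- `q ^ (-1/4)`. -/
noncomputable def innerRadius (F : Type*) [Fintype F] : ℝ := Real.exp (-(logCard F / 4))

theorem innerRadius_pos : 0 < innerRadius F := Real.exp_pos _

theorem innerRadius_lt_one : innerRadius F < 1 := by
  rw [innerRadius, Real.exp_lt_one_iff]
  linarith [logCard_pos (F := F)]

/-- The restriction Re α < 1/4 keeps |a⁻²| below q^(1/2), inside the region where the dual Euler
product converges. -/
theorem inv_sq_lt {a : ℂ} (ha : innerRadius F < ‖a‖) : ‖a⁻¹ ^ 2‖ < Fintype.card F := by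
  have h0 := innerRadius_pos (F := F)
  rw [norm_pow, norm_inv]
  have h1 : ‖a‖⁻¹ < (innerRadius F)⁻¹ := inv_strictAnti₀ h0 ha
  have h2 : (innerRadius F)⁻¹ ^ 2 ≤ Fintype.card F := by
    rw [innerRadius, ← Real.exp_neg, ← Real.exp_nat_mul,
      ← Real.le_log_iff_exp_le (by linarith [one_lt_cardReal (F := F)])]
    change _ ≤ logCard F
    push_cast
    linarith [logCard_pos (F := F)]
  exact (pow_lt_pow_left₀ h1 (by positivity) two_ne_zero).trans_le h2

/-- The ratios conjecture in the variables `a = q ^ (-α)`, `c = q ^ (-γ)`. -/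
theorem RatiosConjecture.disc (hq : Odd (Fintype.card F)) (hratios : RatiosConjecture F)
    {c₀ κ : ℝ} (hc₀ : 0 < c₀) (hκ : 0 < κ) : ∀ᶠ g : ℕ in atTop, ∀ a c : ℂ,
      innerRadius F < ‖a‖ → ‖a‖ < 1 → innerRadius F < ‖c‖ →
      ‖c‖ ≤ Real.exp (-(c₀ / (2 * g + 1))) →
      ‖∑ D ∈ ensemble F g, (normLPoly D).eval a / (normLPoly D).eval c
        - (ensemble F g).card * ratioMain F g a c‖ ≤ κ * (Fintype.card F : ℝ) ^ (2 * g + 1) := by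
  have hl := logCard_pos (F := F)
  have hq1 := one_lt_cardReal (F := F)
  -- The exponents α and γ are taken from principal logarithms, so their imaginary parts are at most
  -- π/log q; any ε ≤ 1 would do. The excluded points q^(2α) = 1 have |a| = 1 and do not occur.
  filter_upwards [hratios c₀ hc₀ (1 / 2) (by norm_num) (Real.pi / logCard F)
    (by positivity) κ hκ] with g hg a c ha1 ha2 hc1 hc2
  have hr0 := innerRadius_pos (F := F)
  have ha0 : a ≠ 0 := norm_pos_iff.1 (hr0.trans ha1)
  have hc0 : c ≠ 0 := norm_pos_iff.1 (hr0.trans hc1)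
  have hc3 : ‖c‖ < 1 := hc2.trans_lt (by
    rw [Real.exp_lt_one_iff, neg_lt_zero]; positivity)
  have hlog : ∀ z : ℂ, z ≠ 0 → z = Complex.exp (-(logCard F * (-(Complex.log z) / logCard F))) := by
    intro z hz
    rw [mul_div_cancel₀ _ logCard_ne_zero, neg_neg, Complex.exp_log hz]
  have hre : ∀ z : ℂ, (-(Complex.log z) / logCard F).re = -Real.log ‖z‖ / logCard F := fun z => by
    rw [Complex.div_ofReal_re, Complex.neg_re, Complex.log_re]
  have him : ∀ z : ℂ, |(-(Complex.log z) / logCard F).im| ≤ Real.pi / logCard F := fun z => by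
    rw [Complex.div_ofReal_im, Complex.neg_im, Complex.log_im, abs_div, abs_neg, abs_of_pos hl]
    gcongr
    exact Complex.abs_arg_le_pi z
  have hlow : ∀ z : ℂ, innerRadius F < ‖z‖ → -Real.log ‖z‖ / logCard F < 1 / 4 := fun z hz => by
    have := Real.log_lt_log hr0 hz
    rw [innerRadius, Real.log_exp] at this
    rw [div_lt_iff₀ hl]
    linarith
  have hbound : Real.pi / logCard F ≤
      Real.pi / logCard F * ((Fintype.card F : ℝ) ^ (2 * g + 1)) ^ ((1 : ℝ) - 1 / 2) := by
    refine le_mul_of_one_le_right (by positivity) ?_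
    exact Real.one_le_rpow (one_le_pow₀ hq1.le) (by norm_num)
  have h := hg _ rfl (-(Complex.log a) / logCard F) (-(Complex.log c) / logCard F)
    (by
      rw [hre]
      have : 0 < -Real.log ‖a‖ / logCard F :=
        div_pos (by linarith [Real.log_neg (norm_pos_iff.2 ha0) ha2]) hl
      linarith)
    (by rw [hre]; exact hlow a ha1)
    (by
      rw [hre, Real.log_pow]
      have := Real.log_le_log (norm_pos_iff.2 hc0) hc2
      rw [Real.log_exp] at this
      change c₀ / (_ * logCard F) ≤ _
      rw [← div_div]
      refine div_le_div_of_nonneg_right ?_ hl.le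
      push_cast
      linarith)
    (by rw [hre]; exact hlow c hc1)
    ((him a).trans hbound) ((him c).trans hbound)
    (by
      rw [card_cpow]
      intro h
      have := congrArg (‖·‖) h
      rw [show (logCard F : ℂ) * (2 * (-Complex.log a / logCard F)) = -(2 * Complex.log a) by
        field_simp [logCard_ne_zero (F := F)], ← exp_neg_sq, Complex.exp_neg, Complex.exp_log ha0,
        norm_pow, norm_inv, norm_one] at this
      have h2 : 1 < ‖a‖⁻¹ := (one_lt_inv₀ (norm_pos_iff.2 ha0)).2 ha2
      exact (one_lt_pow₀ h2 two_ne_zero).ne' this)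
  have hac : ‖a * c‖ < Fintype.card F := by
    rw [norm_mul]
    have : ‖a‖ * ‖c‖ < 1 := mul_lt_one_of_nonneg_of_lt_one_left (norm_nonneg _) ha2 hc3.le
    linarith
  have hac' : ‖a⁻¹ * c‖ < Fintype.card F := by
    refine lt_of_le_of_lt ?_ (inv_sq_lt ha1)
    rw [norm_mul, norm_pow, norm_inv, sq]
    have h2 : 1 < ‖a‖⁻¹ := (one_lt_inv₀ (norm_pos_iff.2 ha0)).2 ha2
    gcongr
    linarith
  have e1 : ∑ D ∈ ensemble F g, ratioMainTerm D (-(Complex.log a) / logCard F)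
      (-(Complex.log c) / logCard F) = (ensemble F g).card * ratioMain F g a c := by
    rw [Finset.sum_congr rfl fun D hD => ratioMainTerm_eq hD (hlog a ha0) (hlog c hc0) hac hac']
    simp
  have e2 : ∀ D ∈ ensemble F g, ∀ z : ℂ, z ≠ 0 →
      LFun D (1 / 2 + -(Complex.log z) / logCard F) = (normLPoly D).eval z := fun D hD z hz => by
    rw [LFun_eq hq hD, card_cpow]
    congr 1
    conv_rhs => rw [hlog z hz]
    congr 1; ring
  rw [e1, Finset.sum_congr rfl fun D hD => by rw [e2 D hD a ha0, e2 D hD c hc0]] at h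
  exact h

end MainTerms

end HyperellipticEnsemble

namespace HyperellipticEnsemble

/-! ### The average of L'/L and a zero-free annulus. -/

section LogDerivative

variable {F : Type*} [Field F] [Fintype F]

/-- The main term of the average of `L'/L`, divided by `log q`, in the variable
`y = q ^ (1/2 - s)`. -/
noncomputable def logDerivMain (F : Type*) [Field F] [Fintype F] (g : ℕ) (y : ℂ) : ℂ :=
  arithSum F (y ^ 2) + y ^ 2 / (1 - y ^ 2) * (y ^ (2 * g) * eulerProd F (y⁻¹ ^ 2) 1 - 1)

/-- The annulus `q ^ (-1/4) < ‖y‖ < 1`. -/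
def openAnnulus (F : Type*) [Fintype F] : Set ℂ := {y | innerRadius F < ‖y‖ ∧ ‖y‖ < 1}

theorem isOpen_openAnnulus : IsOpen (openAnnulus F) :=
  (isOpen_lt continuous_const continuous_norm).inter (isOpen_lt continuous_norm continuous_const)

theorem ne_zero_of_mem_openAnnulus {y : ℂ} (hy : y ∈ openAnnulus F) : y ≠ 0 :=
  norm_pos_iff.1 (innerRadius_pos.trans hy.1)

theorem sq_ne_one_of_norm_lt {y : ℂ} (hy : ‖y‖ < 1) : 1 - y ^ 2 ≠ 0 := by
  intro h
  have h1 := congrArg norm (sub_eq_zero.1 h)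
  rw [norm_one, norm_pow] at h1
  exact absurd h1 (pow_lt_one₀ (norm_nonneg _) hy two_ne_zero).ne'

theorem inv_sq_ne_one {y : ℂ} (hy : y ≠ 0) (h : 1 - y ^ 2 ≠ 0) : 1 - y⁻¹ ^ 2 ≠ 0 := by
  intro h1
  apply h
  have : y ^ 2 * (1 - y⁻¹ ^ 2) = y ^ 2 - 1 := by field_simp
  rw [h1, mul_zero] at this
  linear_combination this

theorem norm_sq_lt_card {y : ℂ} (hy : ‖y‖ < 1) : ‖y ^ 2‖ < Fintype.card F := by
  rw [norm_pow]
  exact (pow_lt_one₀ (norm_nonneg _) hy two_ne_zero).trans one_lt_cardReal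

theorem differentiableOn_ratioMain (g : ℕ) {c : ℂ} (hc : ‖c‖ < 1) :
    DifferentiableOn ℂ (fun a => ratioMain F g a c) (openAnnulus F) := by
  have hq1 := one_lt_cardReal (F := F)
  have hinv : DifferentiableOn ℂ (fun a : ℂ => a⁻¹) (openAnnulus F) :=
    differentiableOn_inv.mono fun a ha => ne_zero_of_mem_openAnnulus ha
  have hE1 : DifferentiableOn ℂ (fun a => eulerProd F (a ^ 2) (a * c)) (openAnnulus F) := by
    refine differentiableOn_eulerProd isOpen_openAnnulus (φ := fun a => a ^ 2)
      (ψ := fun a => a * c) (by fun_prop) (by fun_prop) (fun a ha => norm_sq_lt_card ha.2)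
      (fun a ha => ?_)
    rw [norm_mul]
    exact (mul_lt_one_of_nonneg_of_lt_one_left (norm_nonneg _) ha.2 hc.le).trans hq1
  have hE2 : DifferentiableOn ℂ (fun a => eulerProd F (a⁻¹ ^ 2) (a⁻¹ * c)) (openAnnulus F) := by
    refine differentiableOn_eulerProd isOpen_openAnnulus (φ := fun a => a⁻¹ ^ 2)
      (ψ := fun a => a⁻¹ * c) (hinv.pow 2) (hinv.mul_const c) (fun a ha => inv_sq_lt ha.1)
      (fun a ha => ?_)
    refine lt_of_le_of_lt ?_ (inv_sq_lt ha.1)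
    rw [norm_mul, norm_pow, norm_inv, sq]
    have h2 : 1 < ‖a‖⁻¹ :=
      (one_lt_inv₀ (norm_pos_iff.2 (ne_zero_of_mem_openAnnulus ha))).2 ha.2
    gcongr
    linarith
  unfold ratioMain
  refine DifferentiableOn.add (DifferentiableOn.mul (DifferentiableOn.div (by fun_prop)
    (by fun_prop) fun a ha => sq_ne_one_of_norm_lt ha.2) hE1)
    (DifferentiableOn.mul (DifferentiableOn.mul (by fun_prop)
      (DifferentiableOn.div ((hinv.mul_const c).const_sub 1) ((hinv.pow 2).const_sub 1)
        fun a ha => ?_)) hE2)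
  exact inv_sq_ne_one (ne_zero_of_mem_openAnnulus ha) (sq_ne_one_of_norm_lt ha.2)

theorem hasDerivAt_mul_of_eq_zero {u v : ℂ → ℂ} {u' c : ℂ} (hu : HasDerivAt u u' c)
    (hu0 : u c = 0) (hv : DifferentiableAt ℂ v c) :
    HasDerivAt (fun a => u a * v a) (u' * v c) c := by
  have := hu.mul hv.hasDerivAt
  rw [hu0, zero_mul, add_zero] at this
  exact this

/-- In the first summand the zeta quotient and the Euler product both equal 1 at a = c. The second
summand contains the factor 1 - c/a, which vanishes there, so only the derivative of that factor
contributes. -/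
theorem hasDerivAt_ratioMain (g : ℕ) {c : ℂ} (hc : c ∈ openAnnulus F) :
    HasDerivAt (fun a => ratioMain F g a c) (-(logDerivMain F g c / c)) c := by
  have hc0 := ne_zero_of_mem_openAnnulus hc
  have h1 := sq_ne_one_of_norm_lt hc.2
  have h2 := inv_sq_ne_one hc0 h1
  have d1 : HasDerivAt (fun a : ℂ => (1 - a * c) / (1 - a ^ 2)) (c / (1 - c ^ 2)) c := by
    have e1 : HasDerivAt (fun a : ℂ => 1 - a * c) (-(1 * c)) c :=
      ((hasDerivAt_id c).mul_const c).const_sub 1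
    have e2 : HasDerivAt (fun a : ℂ => 1 - a ^ 2) (-(2 * c)) c := by
      simpa using (hasDerivAt_pow 2 c).const_sub 1
    convert! e1.div e2 h1 using 1
    field_simp
    ring
  have d2 := d1.mul (hasDerivAt_eulerProd hc0 (norm_sq_lt_card (F := F) hc.2))
  have d3 : HasDerivAt (fun a : ℂ => 1 - a⁻¹ * c) (1 / c) c := by
    have := ((hasDerivAt_inv hc0).mul_const c).const_sub 1
    convert! this using 1
    field_simp
  have hE2 : DifferentiableAt ℂ (fun a => eulerProd F (a⁻¹ ^ 2) (a⁻¹ * c)) c := by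
    have hU : IsOpen (openAnnulus F) := isOpen_openAnnulus
    have hinv : DifferentiableOn ℂ (fun a : ℂ => a⁻¹) (openAnnulus F) :=
      differentiableOn_inv.mono fun a ha => ne_zero_of_mem_openAnnulus ha
    refine (differentiableOn_eulerProd (F := F) hU (φ := fun a => a⁻¹ ^ 2)
      (ψ := fun a => a⁻¹ * c) (hinv.pow 2) (hinv.mul_const c) (fun a ha => inv_sq_lt ha.1)
      (fun a ha => ?_)).differentiableAt (hU.mem_nhds hc)
    refine lt_of_le_of_lt ?_ (inv_sq_lt ha.1)
    rw [norm_mul, norm_pow, norm_inv, sq]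
    have h2 : 1 < ‖a‖⁻¹ :=
      (one_lt_inv₀ (norm_pos_iff.2 (ne_zero_of_mem_openAnnulus ha))).2 ha.2
    gcongr
    linarith [hc.2]
  have hv : DifferentiableAt ℂ (fun a : ℂ => a ^ (2 * g) * (1 / (1 - a⁻¹ ^ 2)) *
      eulerProd F (a⁻¹ ^ 2) (a⁻¹ * c)) c := by
    refine DifferentiableAt.mul (DifferentiableAt.mul (by fun_prop) (DifferentiableAt.div
      (by fun_prop) ?_ h2)) hE2
    exact ((differentiableAt_inv hc0).pow 2).const_sub 1
  have d4 := hasDerivAt_mul_of_eq_zero d3 (by field_simp; ring) hv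
  have d5 := d2.add d4
  have e : eulerProd F (c ^ 2) (c * c) = 1 := by rw [← sq, eulerProd_self]
  rw [e] at d5
  have hf : (fun a => ratioMain F g a c) = ((fun a : ℂ => (1 - a * c) / (1 - a ^ 2)) *
      fun a => eulerProd F (a ^ 2) (a * c)) + fun a => (1 - a⁻¹ * c) *
        (a ^ (2 * g) * (1 / (1 - a⁻¹ ^ 2)) * eulerProd F (a⁻¹ ^ 2) (a⁻¹ * c)) := by
    ext a
    simp only [ratioMain, Pi.add_apply, Pi.mul_apply]
    ring
  rw [hf]
  convert! d5 using 1
  rw [logDerivMain, inv_mul_cancel₀ hc0]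
  have h3 : (1 : ℂ) / (1 - c⁻¹ ^ 2) = -(c ^ 2 / (1 - c ^ 2)) := by
    rw [eq_comm, ← neg_div, div_eq_div_iff h1 h2]
    field_simp
    ring
  rw [h3]
  have h4 : (1 - c * c) / (1 - c ^ 2) = 1 := by rw [← sq, div_self h1]
  rw [h4]
  field_simp
  ring

/-- The average of the logarithmic derivatives, from the ratios conjecture by Cauchy's estimate. -/
theorem RatiosConjecture.norm_sum_logDeriv_le (hq : Odd (Fintype.card F))
    (hratios : RatiosConjecture F) {c₀ κ : ℝ} (hc₀ : 0 < c₀) (hκ : 0 < κ) :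
    ∀ᶠ g : ℕ in atTop, ∀ (c : ℂ) (δ : ℝ), 0 < δ → Metric.closedBall c δ ⊆ openAnnulus F →
      ‖c‖ ≤ Real.exp (-(c₀ / (2 * g + 1))) →
      ‖∑ D ∈ ensemble F g, (normLPoly D).derivative.eval c / (normLPoly D).eval c
        + (ensemble F g).card * (logDerivMain F g c / c)‖ ≤
          κ * (Fintype.card F : ℝ) ^ (2 * g + 1) / δ := by
  filter_upwards [hratios.disc hq hc₀ hκ] with g hg c δ hδ hsub hc
  have hcm : c ∈ openAnnulus F := hsub (Metric.mem_closedBall_self hδ.le)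
  -- The denominators do not involve a, so f is holomorphic in a even when some of them vanish, with
  -- x/0 = 0. No information about zeros is assumed, which lets this estimate be used to exclude
  -- them.
  set f : ℂ → ℂ := fun a => ∑ D ∈ ensemble F g, (normLPoly D).eval a / (normLPoly D).eval c
        - (ensemble F g).card * ratioMain F g a c with hf
  have hd : DifferentiableOn ℂ f (openAnnulus F) := by
    refine DifferentiableOn.sub (DifferentiableOn.fun_sum fun D _ => ?_)
      ((differentiableOn_ratioMain g hcm.2).const_mul _)
    exact ((normLPoly D).differentiable.differentiableOn).div_const _
  have hdcl : DiffContOnCl ℂ f (Metric.ball c δ) :=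
    DifferentiableOn.diffContOnCl (hd.mono (Metric.closure_ball_subset_closedBall.trans hsub))
  have h1 := Complex.norm_deriv_le_of_forall_mem_sphere_norm_le hδ hdcl (fun z hz =>
    hg z c (hsub (Metric.sphere_subset_closedBall hz)).1
      (hsub (Metric.sphere_subset_closedBall hz)).2 hcm.1 hc)
  have h2 : HasDerivAt f (∑ D ∈ ensemble F g,
      (normLPoly D).derivative.eval c / (normLPoly D).eval c -
        (ensemble F g).card * (-(logDerivMain F g c / c))) c := by
    refine HasDerivAt.sub (HasDerivAt.fun_sum fun D _ => ?_)
      ((hasDerivAt_ratioMain g hcm).const_mul _)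
    exact ((normLPoly D).hasDerivAt c).div_const _
  rw [h2.deriv] at h1
  simpa using h1

/-- The residue of p'/p is the multiplicity, including multiplicity 0. -/
theorem tendsto_sub_mul_logDeriv {p : ℂ[X]} (hp : p ≠ 0) (v : ℂ) :
    Tendsto (fun y => (y - v) * (p.derivative.eval y / p.eval y)) (𝓝[≠] v)
      (𝓝 (p.rootMultiplicity v)) := by
  obtain ⟨r, hr, hdvd⟩ := exists_eq_pow_rootMultiplicity_mul_and_not_dvd p hp v
  set k := p.rootMultiplicity v
  have hrv : r.eval v ≠ 0 := by rwa [dvd_iff_isRoot] at hdvd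
  have hlim : Tendsto (fun y => (k : ℂ) + (y - v) * (r.derivative.eval y / r.eval y)) (𝓝[≠] v)
      (𝓝 k) := by
    have : ContinuousAt (fun y => (k : ℂ) + (y - v) * (r.derivative.eval y / r.eval y)) v :=
      continuousAt_const.add ((continuousAt_id.sub continuousAt_const).mul
        (r.derivative.continuous.continuousAt.div r.continuous.continuousAt hrv))
    have h := this.tendsto
    simp only [sub_self, zero_mul, add_zero] at h
    exact h.mono_left nhdsWithin_le_nhds
  refine hlim.congr' ?_
  have h1 : ∀ᶠ y in 𝓝[≠] v, r.eval y ≠ 0 :=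
    (r.continuous.continuousAt.eventually_ne hrv).filter_mono nhdsWithin_le_nhds
  filter_upwards [h1, self_mem_nhdsWithin] with y hy1 hy2
  have hyv : y - v ≠ 0 := sub_ne_zero.2 hy2
  rw [hr, derivative_mul, derivative_X_sub_C_pow]
  rcases Nat.eq_zero_or_pos k with h0 | h0
  · simp only [h0, pow_zero]; simp
  · obtain ⟨j, hj⟩ : ∃ j, k = j + 1 := ⟨k - 1, by omega⟩
    rw [hj]
    simp only [eval_add, eval_mul, eval_pow, eval_sub, eval_X, eval_C, add_tsub_cancel_right]
    field_simp
    push_cast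
    ring

theorem normLPoly_ne_zero {g : ℕ} {D : F[X]} (hD : D ∈ ensemble F g) : normLPoly D ≠ 0 := by
  intro h
  have := eval_zero_normLPoly D (by rw [(mem_ensemble.1 hD).1.2]; omega)
  simp [h] at this

theorem continuousAt_logDerivMain (g : ℕ) {c : ℂ} (hc : c ∈ openAnnulus F) :
    ContinuousAt (logDerivMain F g) c := by
  have hc0 := ne_zero_of_mem_openAnnulus hc
  have h1 : DifferentiableAt ℂ (fun y : ℂ => arithSum F (y ^ 2)) c := by
    refine DifferentiableAt.comp (g := arithSum F) c (differentiableOn_arithSum.differentiableAt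
      ((isOpen_lt continuous_norm continuous_const).mem_nhds (norm_sq_lt_card hc.2))) (by fun_prop)
  have h2 : DifferentiableAt ℂ (fun y : ℂ => eulerProd F (y⁻¹ ^ 2) 1) c := by
    refine (differentiableOn_eulerProd (F := F) isOpen_openAnnulus (φ := fun a => a⁻¹ ^ 2)
      (ψ := fun a => 1) ?_ (by fun_prop) (fun a ha => inv_sq_lt ha.1)
      (fun a ha => by simpa using one_lt_cardReal)).differentiableAt
      (isOpen_openAnnulus.mem_nhds hc)
    exact (differentiableOn_inv.mono fun a ha => ne_zero_of_mem_openAnnulus ha).pow 2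
  refine h1.continuousAt.add (ContinuousAt.mul (ContinuousAt.div (by fun_prop) (by fun_prop)
    (sq_ne_one_of_norm_lt hc.2)) ?_)
  exact ((by fun_prop : ContinuousAt (fun y : ℂ => y ^ (2 * g)) c).mul h2.continuousAt).sub
    continuousAt_const

/-- The ratios conjecture keeps the zeros with real part less than `3/4` within a distance
`c₀ / log |D|` of the critical line. -/
theorem RatiosConjecture.eval_ne_zero (hq : Odd (Fintype.card F)) (hratios : RatiosConjecture F)
    {c₀ : ℝ} (hc₀ : 0 < c₀) : ∀ᶠ g : ℕ in atTop, ∀ D ∈ ensemble F g, ∀ v : ℂ,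
      innerRadius F < ‖v‖ → ‖v‖ ≤ Real.exp (-(c₀ / (2 * g + 1))) → (normLPoly D).eval v ≠ 0 := by
  -- With c₀/2 in place of c₀ the estimate holds on a whole neighbourhood of v, also when v lies on
  -- the bounding circle. The averaged L'/L is then bounded near v, so its residue there is 0.
  filter_upwards [hratios.norm_sum_logDeriv_le hq (half_pos hc₀) one_pos] with g hg D₀ hD₀ v h1 h2
    hroot
  have hlt : Real.exp (-(c₀ / (2 * g + 1))) < Real.exp (-(c₀ / 2 / (2 * g + 1))) := by
    rw [Real.exp_lt_exp, neg_lt_neg_iff]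
    gcongr
    linarith
  have hle1 : Real.exp (-(c₀ / 2 / (2 * g + 1))) < 1 := by
    rw [Real.exp_lt_one_iff, neg_lt_zero]; positivity
  have hv : v ∈ openAnnulus F := ⟨h1, h2.trans_lt (hlt.trans hle1)⟩
  have hv0 := ne_zero_of_mem_openAnnulus hv
  obtain ⟨δ, hδ, hball⟩ := Metric.isOpen_iff.1 (isOpen_openAnnulus (F := F)) v hv
  have hcont := (continuousAt_logDerivMain g hv).div continuousAt_id hv0
  have hbd : ∀ᶠ y in 𝓝 v, ‖∑ D ∈ ensemble F g,
      (normLPoly D).derivative.eval y / (normLPoly D).eval y‖ ≤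
        1 * (Fintype.card F : ℝ) ^ (2 * g + 1) / (δ / 3) +
          (ensemble F g).card * (‖logDerivMain F g v / v‖ + 1) := by
    have e1 : ∀ᶠ y in 𝓝 v, ‖y‖ < Real.exp (-(c₀ / 2 / (2 * g + 1))) :=
      continuous_norm.continuousAt.eventually_lt continuousAt_const (h2.trans_lt hlt)
    have e2 : ∀ᶠ y in 𝓝 v, ‖logDerivMain F g y / y‖ < ‖logDerivMain F g v / v‖ + 1 :=
      hcont.norm.eventually_lt continuousAt_const (by simp)
    filter_upwards [e1, e2, Metric.ball_mem_nhds v (by positivity : 0 < δ / 3)] with y hy1 hy2 hy3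
    have h3 := hg y (δ / 3) (by positivity) (fun z hz => hball (by
      rw [Metric.mem_ball] at *
      rw [Metric.mem_closedBall] at hz
      linarith [dist_triangle z y v])) hy1.le
    have h4 : ‖((ensemble F g).card : ℂ) * (logDerivMain F g y / y)‖ ≤
        (ensemble F g).card * (‖logDerivMain F g v / v‖ + 1) := by
      rw [norm_mul, Complex.norm_natCast]
      gcongr
    have h5 := norm_sub_le (∑ D ∈ ensemble F g,
      (normLPoly D).derivative.eval y / (normLPoly D).eval y
        + (ensemble F g).card * (logDerivMain F g y / y))
        (((ensemble F g).card : ℂ) * (logDerivMain F g y / y))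
    rw [add_sub_cancel_right] at h5
    linarith
  have hlim1 : Tendsto (fun y => (y - v) * ∑ D ∈ ensemble F g,
      (normLPoly D).derivative.eval y / (normLPoly D).eval y) (𝓝[≠] v) (𝓝 0) := by
    refine Tendsto.zero_mul_isBoundedUnder_le ?_ ?_
    · have : Tendsto (fun y : ℂ => y - v) (𝓝 v) (𝓝 (v - v)) :=
        (continuous_id.sub continuous_const).tendsto v
      rw [sub_self] at this
      exact this.mono_left nhdsWithin_le_nhds
    · exact ⟨_, eventually_map.2 (hbd.filter_mono nhdsWithin_le_nhds)⟩
  have hlim2 : Tendsto (fun y => (y - v) * ∑ D ∈ ensemble F g,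
      (normLPoly D).derivative.eval y / (normLPoly D).eval y) (𝓝[≠] v)
      (𝓝 (∑ D ∈ ensemble F g, ((normLPoly D).rootMultiplicity v : ℂ))) := by
    simp_rw [Finset.mul_sum]
    exact tendsto_finsetSum _ fun D hD => tendsto_sub_mul_logDeriv (normLPoly_ne_zero hD) v
  have h6 := tendsto_nhds_unique hlim1 hlim2
  -- The residues are natural numbers, so they cannot cancel between different D and each of them
  -- vanishes.
  have h7 : ∑ D ∈ ensemble F g, (normLPoly D).rootMultiplicity v = 0 := by exact_mod_cast h6.symm
  have h8 := Finset.sum_eq_zero_iff.1 h7 D₀ hD₀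
  have h9 : 0 < (normLPoly D₀).rootMultiplicity v :=
    (rootMultiplicity_pos (normLPoly_ne_zero hD₀)).2 hroot
  omega

end LogDerivative

end HyperellipticEnsemble

namespace HyperellipticEnsemble

/-! ### Sums over zeros as contour integrals. -/

section Contour

open Real (circleAverage)

theorem circleAverage_eq_of_annulus {h : ℂ → ℂ} {U : Set ℂ} (hU : IsOpen U)
    (hd : DifferentiableOn ℂ h U) {r R : ℝ} (hr : 0 < r) (hrR : r ≤ R)
    (hsub : ∀ z : ℂ, r ≤ ‖z‖ → ‖z‖ ≤ R → z ∈ U) :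
    circleAverage h 0 R = circleAverage h 0 r := by
  rw [Real.circleAverage_eq_circleIntegral (hr.trans_le hrR).ne',
    Real.circleAverage_eq_circleIntegral hr.ne']
  congr 1
  refine Complex.circleIntegral_sub_center_inv_smul_eq_of_differentiable_on_annulus_off_countable
    hr hrR Set.countable_empty (hd.continuousOn.mono fun z hz => ?_) fun z hz => ?_
  · simp only [Set.mem_sdiff, Metric.mem_closedBall, Metric.mem_ball, dist_zero_right, not_lt] at hz
    exact hsub z hz.2 hz.1
  · simp only [Set.mem_sdiff, Metric.mem_closedBall, Metric.mem_ball, dist_zero_right, not_le] at hz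
    exact hd.differentiableAt (hU.mem_nhds (hsub z hz.1.2.le hz.1.1.le))

theorem circleAverage_inv (f : ℂ → ℂ) (ρ : ℝ) :
    circleAverage f 0 ρ⁻¹ = circleAverage (fun z => f z⁻¹) 0 ρ := by
  rw [Real.circleAverage_eq_circleAverage_zero_one,
    Real.circleAverage_eq_circleAverage_zero_one (R := ρ),
    ← Real.circleAverage_zero_one_congr_inv]
  congr 1
  ext z
  simp only [add_zero, Complex.ofReal_inv, mul_inv, mul_comm]

theorem norm_circleAverage_le {f : ℂ → ℂ} {r C : ℝ} (hr : 0 ≤ r)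
    (h : ∀ z : ℂ, ‖z‖ = r → ‖f z‖ ≤ C) : ‖circleAverage f 0 r‖ ≤ C := by
  rw [Real.circleAverage, norm_smul, Real.norm_of_nonneg (by positivity)]
  have := intervalIntegral.norm_integral_le_of_norm_le_const (a := 0) (b := 2 * Real.pi)
    (f := fun θ => f (circleMap 0 r θ)) (C := C) fun θ _ => h _ (by simp [abs_of_nonneg hr])
  rw [sub_zero, abs_of_pos Real.two_pi_pos] at this
  rw [inv_mul_le_iff₀ Real.two_pi_pos]
  linarith

theorem circleIntegrable_of_continuousOn {f : ℂ → ℂ} {r : ℝ} (hr : 0 ≤ r)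
    (h : ∀ z : ℂ, ‖z‖ = r → ContinuousAt f z) : CircleIntegrable f 0 r :=
  ContinuousOn.circleIntegrable hr fun z hz => (h z (by simpa using hz)).continuousWithinAt

theorem circleAverage_of_differentiableOn_closedBall {f : ℂ → ℂ} {r : ℝ} (hr : 0 ≤ r)
    (h : DifferentiableOn ℂ f (Metric.closedBall 0 r)) : circleAverage f 0 r = f 0 := by
  refine DiffContOnCl.circleAverage (DifferentiableOn.diffContOnCl ?_)
  rw [abs_of_nonneg hr]
  exact h.mono Metric.closure_ball_subset_closedBall

-- Residue theorem for one pole. Splitting off f(v) leaves y · `dslope f v y`, holomorphic on the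
-- annulus and so with equal averages on both circles, plus f(v) · y/(y - v), whose average is 1 on
-- a circle around v and 0 on a circle that leaves v outside.
open Classical in
theorem circleAverage_mul_div_sub {f : ℂ → ℂ} {U : Set ℂ} (hU : IsOpen U)
    (hd : DifferentiableOn ℂ f U) {ρ : ℝ} (hρ0 : 0 < ρ) (hρ1 : ρ < 1)
    (hsub : ∀ z : ℂ, ρ ≤ ‖z‖ → ‖z‖ ≤ ρ⁻¹ → z ∈ U) {v : ℂ} (h1 : ‖v‖ ≠ ρ) (h2 : ‖v‖ ≠ ρ⁻¹) :
    circleAverage (fun y => f y * (y / (y - v))) 0 ρ⁻¹ -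
      circleAverage (fun y => f y * (y / (y - v))) 0 ρ =
        if ρ < ‖v‖ ∧ ‖v‖ < ρ⁻¹ then f v else 0 := by
  have hinv : 1 < ρ⁻¹ := (one_lt_inv₀ hρ0).2 hρ1
  have hle : ρ ≤ ρ⁻¹ := (hρ1.trans hinv).le
  split_ifs with hv
  · have hvU : v ∈ U := hsub v hv.1.le hv.2.le
    have hds : DifferentiableOn ℂ (dslope f v) U :=
      (Complex.differentiableOn_dslope (hU.mem_nhds hvU)).2 hd
    have key : ∀ r : ℝ, 0 < r → ρ ≤ r → r ≤ ρ⁻¹ → ‖v‖ ≠ r →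
        circleAverage (fun y => f y * (y / (y - v))) 0 r =
          circleAverage (fun y => y * dslope f v y) 0 r +
            f v * circleAverage (fun y => y / (y - v)) 0 r := by
      intro r hr ha hb hne
      have hne' : ∀ z : ℂ, ‖z‖ = r → z - v ≠ 0 := fun z hz h => by
        rw [sub_eq_zero] at h; exact hne (h ▸ hz)
      rw [← smul_eq_mul (f v), ← Real.circleAverage_fun_smul, ← Real.circleAverage_fun_add]
      · refine Real.circleAverage_congr_sphere fun z hz => ?_
        have hz' : ‖z‖ = r := by simpa [abs_of_pos hr] using hz
        have hzv := hne' z hz'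
        rw [dslope_of_ne _ (sub_ne_zero.1 hzv), slope_def_field, smul_eq_mul]
        field_simp
        ring
      · refine circleIntegrable_of_continuousOn hr.le fun z hz => continuousAt_id.mul ?_
        exact (hds.differentiableAt (hU.mem_nhds (hsub z (hz ▸ ha) (hz ▸ hb)))).continuousAt
      · refine circleIntegrable_of_continuousOn hr.le fun z hz => ContinuousAt.fun_const_smul ?_ _
        exact continuousAt_id.div (continuousAt_id.sub continuousAt_const) (hne' z hz)
    rw [key ρ⁻¹ (by positivity) hle le_rfl h2, key ρ hρ0 le_rfl hle h1]
    have e1 : circleAverage (fun y => y * dslope f v y) 0 ρ⁻¹ =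
        circleAverage (fun y => y * dslope f v y) 0 ρ :=
      circleAverage_eq_of_annulus hU (differentiableOn_id.mul hds) hρ0 hle hsub
    have e2 : circleAverage (fun y => y / (y - v)) 0 ρ⁻¹ = 1 := by
      have := DiffContOnCl.circleAverage_smul_div (f := fun _ : ℂ => (1 : ℂ)) (c := 0) (R := ρ⁻¹)
        (w := v) diffContOnCl_const (by
          rw [abs_of_pos (by positivity), Metric.mem_ball, dist_zero_right]; exact hv.2)
      simpa using this
    have e3 : circleAverage (fun y => y / (y - v)) 0 ρ = 0 := by
      rw [circleAverage_of_differentiableOn_closedBall hρ0.le]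
      · simp
      · refine DifferentiableOn.div (by fun_prop) (by fun_prop) fun z hz h => ?_
        rw [sub_eq_zero] at h
        rw [Metric.mem_closedBall, dist_zero_right, h] at hz
        exact absurd hz hv.1.not_ge
    rw [e1, e2, e3]
    ring
  · rw [sub_eq_zero]
    refine circleAverage_eq_of_annulus (U := U ∩ {v}ᶜ) (hU.inter isOpen_compl_singleton) ?_ hρ0 hle
      fun z hz1 hz2 => ⟨hsub z hz1 hz2, fun h => ?_⟩
    · refine (hd.mono Set.inter_subset_left).mul (DifferentiableOn.div (by fun_prop) (by fun_prop)
        fun z hz => sub_ne_zero.2 hz.2)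
    · rw [Set.mem_singleton_iff] at h
      subst h
      exact hv ⟨lt_of_le_of_ne hz1 h1.symm, lt_of_le_of_ne hz2 h2⟩

variable {F : Type*} [Field F] [Fintype F]

/-- The logarithmic derivative `y P'(y) / P(y)` of the normalized `L`-polynomial. -/
noncomputable def logDer (D : F[X]) (y : ℂ) : ℂ :=
  y * ((normLPoly D).derivative.eval y / (normLPoly D).eval y)

theorem logDer_eq_sum {D : F[X]} {y : ℂ} (hy : (normLPoly D).eval y ≠ 0) :
    logDer D y = ((normLPoly D).roots.map fun v => y / (y - v)).sum := by
  rw [logDer, (IsAlgClosed.splits _).eval_derivative_div_eval_of_ne_zero hy,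
    ← Multiset.sum_map_mul_left]
  simp [div_eq_mul_inv]

theorem eval_inv_ne_zero (hq : Odd (Fintype.card F)) {g : ℕ} {D : F[X]} (hD : D ∈ ensemble F g)
    {y : ℂ} (hy0 : y ≠ 0) (hy : (normLPoly D).eval y ≠ 0) : (normLPoly D).eval y⁻¹ ≠ 0 := by
  obtain ⟨κ, hκ, h⟩ := normLPoly_functional_equation hq hD
  intro h0
  rw [h y hy0, h0, mul_zero] at hy
  exact hy rfl

/-- Logarithmic differentiation of the functional equation, in which the constant κ drops out. -/
theorem logDer_add_logDer_inv (hq : Odd (Fintype.card F)) {g : ℕ} {D : F[X]}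
    (hD : D ∈ ensemble F g) {y : ℂ} (hy0 : y ≠ 0) (hy : (normLPoly D).eval y ≠ 0) :
    logDer D y⁻¹ = 2 * g - logDer D y := by
  obtain ⟨κ, hκ, h⟩ := normLPoly_functional_equation hq hD
  have hy' := eval_inv_ne_zero hq hD hy0 hy
  have d1 : HasDerivAt (fun y => κ * y ^ (2 * g) * (normLPoly D).eval y⁻¹)
      (κ * ((2 * g : ℕ) * y ^ (2 * g - 1)) * (normLPoly D).eval y⁻¹ +
        κ * y ^ (2 * g) * ((normLPoly D).derivative.eval y⁻¹ * (-(y ^ 2)⁻¹))) y :=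
    ((hasDerivAt_pow (2 * g) y).const_mul κ).mul
      (((normLPoly D).hasDerivAt y⁻¹).comp y (hasDerivAt_inv hy0))
  have d2 := (normLPoly D).hasDerivAt y
  have heq : (fun y => (normLPoly D).eval y) =ᶠ[𝓝 y]
      fun y => κ * y ^ (2 * g) * (normLPoly D).eval y⁻¹ := by
    filter_upwards [isOpen_ne.mem_nhds hy0] with z hz using h z hz
  have d3 := d2.unique (d1.congr_of_eventuallyEq heq)
  rw [logDer, logDer, d3, h y hy0]
  rcases Nat.eq_zero_or_pos g with h0 | h0
  · subst h0
    simp only [mul_zero, pow_zero, Nat.cast_zero, zero_mul, zero_add, mul_one]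
    field_simp
    ring
  · have e : y ^ (2 * g) = y ^ (2 * g - 1) * y := by
      rw [← pow_succ]; congr 1; omega
    rw [e]
    generalize (normLPoly D).eval y⁻¹ = A at hy'
    generalize (normLPoly D).derivative.eval y⁻¹ = B
    have hyp : y ^ (2 * g - 1) ≠ 0 := pow_ne_zero _ hy0
    generalize y ^ (2 * g - 1) = Y at hyp
    push_cast
    field_simp
    ring

open Classical in
/-- A sum over the zeros near the critical line as a contour integral. -/
theorem sum_roots_eq_circleAverage (hq : Odd (Fintype.card F)) {g : ℕ} {D : F[X]}
    (hD : D ∈ ensemble F g) {f : ℂ → ℂ} {U : Set ℂ} (hU : IsOpen U)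
    (hd : DifferentiableOn ℂ f U) (hf : ∀ z, f z⁻¹ = f z) {ρ : ℝ} (hρ0 : 0 < ρ) (hρ1 : ρ < 1)
    (hsub : ∀ z : ℂ, ρ ≤ ‖z‖ → ‖z‖ ≤ ρ⁻¹ → z ∈ U)
    (hne : ∀ z : ℂ, ‖z‖ = ρ → (normLPoly D).eval z ≠ 0) :
    ((normLPoly D).roots.map fun v => if ρ < ‖v‖ ∧ ‖v‖ < ρ⁻¹ then f v else 0).sum =
      circleAverage (fun y => f y * (2 * g - 2 * logDer D y)) 0 ρ := by
  have hinv : 1 < ρ⁻¹ := (one_lt_inv₀ hρ0).2 hρ1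
  have hle : ρ ≤ ρ⁻¹ := (hρ1.trans hinv).le
  have hz0 : ∀ z : ℂ, ‖z‖ = ρ → z ≠ 0 := fun z hz => norm_pos_iff.1 (hz ▸ hρ0)
  have hne' : ∀ z : ℂ, ‖z‖ = ρ⁻¹ → (normLPoly D).eval z ≠ 0 := fun z hz => by
    have h1 : ‖z⁻¹‖ = ρ := by rw [norm_inv, hz, inv_inv]
    have := eval_inv_ne_zero hq hD (hz0 _ h1) (hne _ h1)
    rwa [inv_inv] at this
  have hcont : ∀ z : ℂ, ρ ≤ ‖z‖ → ‖z‖ ≤ ρ⁻¹ → ContinuousAt f z := fun z h1 h2 =>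
    (hd.differentiableAt (hU.mem_nhds (hsub z h1 h2))).continuousAt
  have hP := normLPoly_ne_zero hD
  have hroots : ∀ r : ℝ, 0 < r → ρ ≤ r → r ≤ ρ⁻¹ →
      (∀ z : ℂ, ‖z‖ = r → (normLPoly D).eval z ≠ 0) →
      circleAverage (fun y => f y * logDer D y) 0 r =
        ((normLPoly D).roots.map fun v => circleAverage (fun y => f y * (y / (y - v))) 0 r).sum := by
    intro r hr ha hb hnr
    rw [Finset.sum_multiset_map_count]
    simp_rw [← Nat.cast_smul_eq_nsmul ℂ, ← Real.circleAverage_fun_smul]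
    rw [← Real.circleAverage_fun_sum]
    · refine Real.circleAverage_congr_sphere fun z hz => ?_
      have hz' : ‖z‖ = r := by simpa [abs_of_pos hr] using hz
      rw [logDer_eq_sum (hnr z hz'), Finset.sum_multiset_map_count, Finset.mul_sum]
      refine Finset.sum_congr rfl fun v _ => ?_
      rw [nsmul_eq_mul, smul_eq_mul]
      ring
    · intro v hv
      refine circleIntegrable_of_continuousOn hr.le fun z hz => ContinuousAt.fun_const_smul
        ((hcont z (hz ▸ ha) (hz ▸ hb)).mul ?_) _
      refine continuousAt_id.div (continuousAt_id.sub continuousAt_const) fun h => ?_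
      have : v ∈ (normLPoly D).roots := by simpa using hv
      rw [mem_roots hP] at this
      refine hnr z hz ?_
      have hzv : z = v := sub_eq_zero.1 h
      rw [hzv]; exact this
  have h1 : ((normLPoly D).roots.map fun v => if ρ < ‖v‖ ∧ ‖v‖ < ρ⁻¹ then f v else 0).sum =
      circleAverage (fun y => f y * logDer D y) 0 ρ⁻¹ -
        circleAverage (fun y => f y * logDer D y) 0 ρ := by
    rw [hroots ρ⁻¹ (by positivity) hle le_rfl hne', hroots ρ hρ0 le_rfl hle hne,
      ← Multiset.sum_map_sub]
    congr 1
    refine Multiset.map_congr rfl fun v hv => ?_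
    rw [mem_roots hP] at hv
    exact (circleAverage_mul_div_sub hU hd hρ0 hρ1 hsub (fun h => hne v h hv)
      fun h => hne' v h hv).symm
  have hLcont : ∀ z : ℂ, ‖z‖ = ρ → ContinuousAt (logDer D) z := fun z hz =>
    continuousAt_id.mul ((normLPoly D).derivative.continuous.continuousAt.div
      (normLPoly D).continuous.continuousAt (hne z hz))
  have hfc : ∀ z : ℂ, ‖z‖ = ρ → ContinuousAt f z := fun z hz => hcont z hz.ge (hz.le.trans hle)
  -- Inversion carries the outer circle to the inner one. There the invariance of f and the
  -- functional equation turn the outer term into f(y)(2g - y P'(y)/P(y)).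
  rw [h1, circleAverage_inv, ← Real.circleAverage_fun_sub]
  · refine Real.circleAverage_congr_sphere fun z hz => ?_
    have hz' : ‖z‖ = ρ := by simpa [abs_of_pos hρ0] using hz
    rw [hf, logDer_add_logDer_inv hq hD (hz0 z hz') (hne z hz')]
    ring
  · refine (circleIntegrable_congr (f₁ := fun z => f z * (2 * g - logDer D z)) ?_).1 ?_
    · intro z hz
      have hz' : ‖z‖ = ρ := by simpa [abs_of_pos hρ0] using hz
      show f z * (2 * g - logDer D z) = f z⁻¹ * logDer D z⁻¹
      rw [hf, logDer_add_logDer_inv hq hD (hz0 z hz') (hne z hz')]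
    · exact circleIntegrable_of_continuousOn hρ0.le fun z hz =>
        (hfc z hz).mul (continuousAt_const.sub (hLcont z hz))
  · exact circleIntegrable_of_continuousOn hρ0.le fun z hz => (hfc z hz).mul (hLcont z hz)

end Contour

end HyperellipticEnsemble

namespace HyperellipticEnsemble

/-! ### Zeros near the unit circle and outliers. -/

section Outliers

open Real (circleAverage)

variable {F : Type*} [Field F] [Fintype F]

/-- The zeros that are not near the critical line. -/
def IsOutlier (F : Type*) [Fintype F] (v : ℂ) : Prop :=
  ‖v‖ ≤ innerRadius F ∨ (innerRadius F)⁻¹ ≤ ‖v‖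

open Classical in
/-- The roots of the normalized `L`-polynomial near the unit circle. -/
noncomputable def midRoots (D : F[X]) : Multiset ℂ :=
  (normLPoly D).roots.filter fun v => ¬ IsOutlier F v

open Classical in
/-- The roots of the normalized `L`-polynomial that are not near the unit circle. -/
noncomputable def outliers (D : F[X]) : Multiset ℂ :=
  (normLPoly D).roots.filter (IsOutlier F)

open Classical in
theorem outliers_add_midRoots (D : F[X]) : outliers D + midRoots D = (normLPoly D).roots :=
  Multiset.filter_add_not _ _

theorem card_roots_normLPoly (hq : Odd (Fintype.card F)) {g : ℕ} {D : F[X]}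
    (hD : D ∈ ensemble F g) : (normLPoly D).roots.card = 2 * g := by
  rw [← natDegree_normLPoly hq hD]
  exact (IsAlgClosed.splits _).natDegree_eq_card_roots.symm

theorem card_outliers_add_card_midRoots (hq : Odd (Fintype.card F)) {g : ℕ} {D : F[X]}
    (hD : D ∈ ensemble F g) : (outliers D).card + (midRoots D).card = 2 * g := by
  rw [← Multiset.card_add, outliers_add_midRoots, card_roots_normLPoly hq hD]

theorem card_ensemble_le (g : ℕ) : (ensemble F g).card ≤ Fintype.card F ^ (2 * g + 1) := by
  rw [← card_monicOfDegree]
  refine Finset.card_le_card fun D hD => ?_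
  exact mem_monicOfDegree.2 (mem_ensemble.1 hD).1

theorem ne_zero_of_mem_roots {g : ℕ} {D : F[X]} (hD : D ∈ ensemble F g) {v : ℂ}
    (hv : v ∈ (normLPoly D).roots) : v ≠ 0 := by
  rw [mem_roots (normLPoly_ne_zero hD)] at hv
  rintro rfl
  have h := eval_zero_normLPoly D (by rw [(mem_ensemble.1 hD).1.2]; omega)
  rw [hv] at h
  exact zero_ne_one h

theorem mem_midRoots {D : F[X]} {v : ℂ} :
    v ∈ midRoots D ↔ v ∈ (normLPoly D).roots ∧ innerRadius F < ‖v‖ ∧ ‖v‖ < (innerRadius F)⁻¹ := by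
  simp [midRoots, IsOutlier]

/-- The zero-free annulus inside the unit circle is reflected to the outside by the functional
equation. -/
theorem RatiosConjecture.norm_midRoots (hq : Odd (Fintype.card F)) (hratios : RatiosConjecture F)
    {c₀ : ℝ} (hc₀ : 0 < c₀) : ∀ᶠ g : ℕ in atTop, ∀ D ∈ ensemble F g, ∀ v ∈ midRoots D,
      Real.exp (-(c₀ / (2 * g + 1))) < ‖v‖ ∧ ‖v‖ < Real.exp (c₀ / (2 * g + 1)) := by
  filter_upwards [hratios.eval_ne_zero hq hc₀] with g hg D hD v hv
  obtain ⟨hvr, h1, h2⟩ := mem_midRoots.1 hv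
  have hv0 := ne_zero_of_mem_roots hD hvr
  rw [mem_roots (normLPoly_ne_zero hD)] at hvr
  refine ⟨not_le.1 fun h => hg D hD v h1 h hvr, not_le.1 fun h => ?_⟩
  have h3 : (normLPoly D).eval v⁻¹ ≠ 0 := by
    refine hg D hD v⁻¹ ?_ ?_
    · rw [norm_inv]
      exact lt_inv_of_lt_inv₀ (norm_pos_iff.2 hv0) h2
    · rw [norm_inv, Real.exp_neg]
      exact inv_anti₀ (Real.exp_pos _) h
  have := eval_inv_ne_zero hq hD (inv_ne_zero hv0) h3
  rw [inv_inv] at this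
  exact this hvr

theorem tendsto_exp_div (c : ℝ) :
    Tendsto (fun g : ℕ => Real.exp (c / (2 * g + 1))) atTop (𝓝 1) := by
  have h : Tendsto (fun g : ℕ => (2 * (g : ℝ) + 1)) atTop atTop :=
    tendsto_atTop_add_const_right _ _ (tendsto_natCast_atTop_atTop.const_mul_atTop two_pos)
  simpa [Function.comp_def] using (Real.continuous_exp.tendsto 0).comp (h.const_div_atTop c)

theorem eventually_lt_exp_neg {ρ : ℝ} (hρ : ρ < 1) (c : ℝ) :
    ∀ᶠ g : ℕ in atTop, ρ < Real.exp (-(c / (2 * g + 1))) := by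
  have := (tendsto_exp_div (-c)).eventually (lt_mem_nhds hρ)
  simpa only [neg_div] using this

theorem RatiosConjecture.norm_sum_logDer_le (hq : Odd (Fintype.card F))
    (hratios : RatiosConjecture F) {c₀ κ : ℝ} (hc₀ : 0 < c₀) (hκ : 0 < κ) :
    ∀ᶠ g : ℕ in atTop, ∀ (c : ℂ) (δ : ℝ), 0 < δ → Metric.closedBall c δ ⊆ openAnnulus F →
      ‖c‖ ≤ Real.exp (-(c₀ / (2 * g + 1))) →
      ‖∑ D ∈ ensemble F g, logDer D c + (ensemble F g).card * logDerivMain F g c‖ ≤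
          κ * (Fintype.card F : ℝ) ^ (2 * g + 1) / δ := by
  filter_upwards [hratios.norm_sum_logDeriv_le hq hc₀ hκ] with g hg c δ hδ hsub hc
  have hcm : c ∈ openAnnulus F := hsub (Metric.mem_closedBall_self hδ.le)
  have hc0 := ne_zero_of_mem_openAnnulus hcm
  have h : ∑ D ∈ ensemble F g, logDer D c + (ensemble F g).card * logDerivMain F g c =
      c * (∑ D ∈ ensemble F g, (normLPoly D).derivative.eval c / (normLPoly D).eval c
        + (ensemble F g).card * (logDerivMain F g c / c)) := by
    simp only [logDer, ← Finset.mul_sum]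
    field_simp
  rw [h, norm_mul]
  exact (mul_le_of_le_one_left (norm_nonneg _) hcm.2.le).trans (hg c δ hδ hsub hc)

theorem RatiosConjecture.norm_sum_logDer_le_of_norm_eq (hq : Odd (Fintype.card F))
    (hratios : RatiosConjecture F) {ρ κ : ℝ} (hρ : innerRadius F < ρ) (hρ1 : ρ < 1) (hκ : 0 < κ) :
    ∀ᶠ g : ℕ in atTop, ∀ c : ℂ, ‖c‖ = ρ →
      ‖∑ D ∈ ensemble F g, logDer D c + (ensemble F g).card * logDerivMain F g c‖ ≤
          κ * (Fintype.card F : ℝ) ^ (2 * g + 1) := by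
  have hδ : 0 < min (ρ - innerRadius F) (1 - ρ) / 2 := by
    have := sub_pos.2 hρ
    have := sub_pos.2 hρ1
    positivity
  have h1 := min_le_left (ρ - innerRadius F) (1 - ρ)
  have h2 := min_le_right (ρ - innerRadius F) (1 - ρ)
  set δ := min (ρ - innerRadius F) (1 - ρ) / 2 with hδdef
  filter_upwards [hratios.norm_sum_logDer_le hq one_pos (mul_pos hκ hδ),
    eventually_lt_exp_neg hρ1 1] with g hg hg2 c hc
  refine (hg c δ hδ (fun z hz => ?_) (hc ▸ hg2.le)).trans_eq ?_
  · rw [Metric.mem_closedBall, dist_eq_norm] at hz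
    have h3 := norm_sub_norm_le z c
    have h4 := norm_sub_norm_le c z
    rw [norm_sub_rev] at h4
    constructor <;> linarith
  · field_simp

theorem sum_map_ite_eq_sum_filter {M : Type*} [AddCommMonoid M] (s : Multiset ℂ) (p : ℂ → Prop)
    [DecidablePred p] (f : ℂ → M) :
    (s.map fun v => if p v then f v else 0).sum = ((s.filter p).map f).sum := by
  induction s using Multiset.induction_on with
  | empty => simp
  | cons a s ih => by_cases h : p a <;> simp [h, ih]

/-- The sum over the zeros near the critical line of an invariant function. -/
theorem RatiosConjecture.norm_sum_midRoots_sub_le (hq : Odd (Fintype.card F))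
    (hratios : RatiosConjecture F) {f : ℂ → ℂ} {U : Set ℂ} (hU : IsOpen U)
    (hd : DifferentiableOn ℂ f U) (hf : ∀ z, f z⁻¹ = f z) {ρ : ℝ} (hρ : innerRadius F < ρ)
    (hρ1 : ρ < 1) (hsub : ∀ z : ℂ, ρ ≤ ‖z‖ → ‖z‖ ≤ ρ⁻¹ → z ∈ U) {κ : ℝ} (hκ : 0 < κ) :
    ∀ᶠ g : ℕ in atTop, ‖∑ D ∈ ensemble F g, ((midRoots D).map f).sum - (ensemble F g).card *
      circleAverage (fun y => f y * (2 * g + 2 * logDerivMain F g y)) 0 ρ‖ ≤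
        κ * (Fintype.card F : ℝ) ^ (2 * g + 1) := by
  classical
  have hρ0 : 0 < ρ := innerRadius_pos.trans hρ
  have hle : ρ ≤ ρ⁻¹ := (hρ1.trans ((one_lt_inv₀ hρ0).2 hρ1)).le
  have hfc : ∀ z : ℂ, ‖z‖ = ρ → ContinuousAt f z := fun z hz =>
    (hd.differentiableAt (hU.mem_nhds (hsub z hz.ge (hz.le.trans hle)))).continuousAt
  obtain ⟨B, hB⟩ := (isCompact_sphere (0 : ℂ) ρ).exists_bound_of_continuousOn
    (f := f) fun z hz => (hfc z (by simpa using hz)).continuousWithinAt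
  have hB' : ∀ z : ℂ, ‖z‖ = ρ → ‖f z‖ ≤ |B| + 1 := fun z hz =>
    (hB z (by simpa using hz)).trans ((le_abs_self B).trans (by linarith))
  have hBpos : 0 < |B| + 1 := by positivity
  have hmem : ∀ z : ℂ, ‖z‖ = ρ → z ∈ openAnnulus F := fun z hz => ⟨hz ▸ hρ, hz ▸ hρ1⟩
  filter_upwards [hratios.norm_sum_logDer_le_of_norm_eq hq hρ hρ1 (κ := κ / (2 * (|B| + 1)))
    (by positivity), eventually_lt_exp_neg hρ1 1, hratios.norm_midRoots hq one_pos,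
    hratios.eval_ne_zero hq one_pos] with g hg hg1 hg2 hg3
  have hne : ∀ D ∈ ensemble F g, ∀ z : ℂ, ‖z‖ = ρ → (normLPoly D).eval z ≠ 0 := fun D hD z hz =>
    hg3 D hD z (hz ▸ hρ) (hz ▸ hg1.le)
  have hsum : ∀ D ∈ ensemble F g, ((midRoots D).map f).sum =
      circleAverage (fun y => f y * (2 * g - 2 * logDer D y)) 0 ρ := by
    intro D hD
    rw [← sum_roots_eq_circleAverage hq hD hU hd hf hρ0 hρ1 hsub (hne D hD),
      sum_map_ite_eq_sum_filter, midRoots]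
    congr 2
    -- For large g the zeros that are not outliers lie within a factor exp(1/(2g+1)) of the unit
    -- circle, hence between ρ and 1/ρ, so the two ways of selecting zeros agree.
    refine Multiset.filter_congr fun v hv => ?_
    constructor
    · intro h
      obtain ⟨h1, h2⟩ := hg2 D hD v (by rw [midRoots, Multiset.mem_filter]; exact ⟨hv, h⟩)
      refine ⟨hg1.trans h1, h2.trans ?_⟩
      rw [lt_inv_comm₀ (Real.exp_pos _) hρ0, ← Real.exp_neg]
      exact hg1
    · rintro ⟨h1, h2⟩ (h | h)
      · linarith
      · have := inv_anti₀ innerRadius_pos hρ.le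
        linarith
  have hLc : ∀ D ∈ ensemble F g, ∀ z : ℂ, ‖z‖ = ρ → ContinuousAt (logDer D) z :=
    fun D hD z hz => continuousAt_id.mul ((normLPoly D).derivative.continuous.continuousAt.div
      (normLPoly D).continuous.continuousAt (hne D hD z hz))
  rw [Finset.sum_congr rfl hsum, ← Real.circleAverage_fun_sum,
    ← smul_eq_mul ((ensemble F g).card : ℂ), ← Real.circleAverage_fun_smul, ← Real.circleAverage_fun_sub]
  · refine norm_circleAverage_le hρ0.le fun z hz => ?_
    have e : (∑ D ∈ ensemble F g, f z * (2 * g - 2 * logDer D z)) -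
        ((ensemble F g).card : ℂ) • (f z * (2 * g + 2 * logDerivMain F g z)) =
        -2 * f z * (∑ D ∈ ensemble F g, logDer D z +
          (ensemble F g).card * logDerivMain F g z) := by
      rw [← Finset.mul_sum, Finset.sum_sub_distrib, Finset.sum_const, nsmul_eq_mul,
        ← Finset.mul_sum, smul_eq_mul]
      ring
    rw [e, norm_mul, norm_mul, norm_neg, Complex.norm_ofNat]
    calc 2 * ‖f z‖ * _ ≤ 2 * (|B| + 1) *
          (κ / (2 * (|B| + 1)) * (Fintype.card F : ℝ) ^ (2 * g + 1)) := by
            gcongr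
            · exact hB' z hz
            · exact hg z hz
      _ = _ := by field_simp
  · refine circleIntegrable_of_continuousOn hρ0.le fun z hz => ?_
    refine tendsto_finsetSum _ fun D hD => ?_
    exact ((hfc z hz).mul (continuousAt_const.sub (continuousAt_const.mul (hLc D hD z hz))))
  · refine circleIntegrable_of_continuousOn hρ0.le fun z hz => ContinuousAt.fun_const_smul ?_ _
    exact (hfc z hz).mul (continuousAt_const.add
      (continuousAt_const.mul (continuousAt_logDerivMain g (hmem z hz))))
  · intro D hD
    refine circleIntegrable_of_continuousOn hρ0.le fun z hz => ?_
    exact ((hfc z hz).mul (continuousAt_const.sub (continuousAt_const.mul (hLc D hD z hz))))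

/-- The part without y^(2g) is holomorphic in the unit disc and vanishes at 0, so its average is 0
by the mean value property. The rest carries the factor ρ^(2g). -/
theorem exists_norm_circleAverage_logDerivMain_le {ρ : ℝ} (hρ : innerRadius F < ρ) (hρ1 : ρ < 1) :
    ∃ C : ℝ, ∀ g : ℕ, ‖circleAverage (logDerivMain F g) 0 ρ‖ ≤ C * ρ ^ (2 * g) := by
  have hρ0 : 0 < ρ := innerRadius_pos.trans hρ
  have hmem : ∀ z : ℂ, ‖z‖ = ρ → z ∈ openAnnulus F := fun z hz => ⟨hz ▸ hρ, hz ▸ hρ1⟩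
  set a : ℂ → ℂ := fun y => arithSum F (y ^ 2) - y ^ 2 / (1 - y ^ 2) with ha
  have had : DifferentiableOn ℂ a (Metric.ball 0 1) := by
    refine DifferentiableOn.sub ?_ (DifferentiableOn.div (by fun_prop) (by fun_prop) fun z hz =>
      sq_ne_one_of_norm_lt (by simpa using hz))
    exact differentiableOn_arithSum.comp (by fun_prop) fun z hz =>
      norm_sq_lt_card (by simpa using hz)
  set b : ℂ → ℂ := fun y => y ^ 2 / (1 - y ^ 2) * eulerProd F (y⁻¹ ^ 2) 1 with hb
  have hm : ∀ g y, logDerivMain F g y = a y + y ^ (2 * g) * b y := fun g y => by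
    rw [logDerivMain, ha, hb]; ring
  have hac : ∀ z : ℂ, ‖z‖ = ρ → ContinuousAt a z := fun z hz =>
    (had.differentiableAt (Metric.isOpen_ball.mem_nhds (by simpa [hz] using hρ1))).continuousAt
  -- For g = 0 the decomposition exhibits b as a difference of functions already known to be
  -- continuous.
  have hbc : ∀ z : ℂ, ‖z‖ = ρ → ContinuousAt b z := fun z hz => by
    have h0 := (continuousAt_logDerivMain 0 (hmem z hz)).sub (hac z hz)
    refine h0.congr (Eventually.of_forall fun y => ?_)
    simp [hm]
  obtain ⟨B, hB⟩ := (isCompact_sphere (0 : ℂ) ρ).exists_bound_of_continuousOn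
    (f := b) fun z hz => (hbc z (by simpa using hz)).continuousWithinAt
  refine ⟨B, fun g => ?_⟩
  have e : logDerivMain F g = fun y => a y + y ^ (2 * g) * b y := funext (hm g)
  have ea : circleAverage a 0 ρ = 0 := by
    rw [circleAverage_of_differentiableOn_closedBall hρ0.le
      (had.mono (Metric.closedBall_subset_ball hρ1))]
    simp [ha, arithSum_zero]
  rw [e, Real.circleAverage_fun_add (circleIntegrable_of_continuousOn hρ0.le hac), ea, zero_add]
  · refine norm_circleAverage_le hρ0.le fun z hz => ?_
    rw [norm_mul, norm_pow, hz, mul_comm]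
    gcongr
    exact hB z (by simpa using hz)
  · exact circleIntegrable_of_continuousOn hρ0.le fun z hz =>
      (continuousAt_id.pow _).mul (hbc z hz)

/-- Apply the contour formula to the constant function 1: the average number of zeros near the unit
circle is 2g + o(1). The total number is exactly 2g for each D, so the outliers account for the
difference. -/
theorem RatiosConjecture.sum_card_outliers_le (hq : Odd (Fintype.card F))
    (hratios : RatiosConjecture F) {κ : ℝ} (hκ : 0 < κ) :
    ∀ᶠ g : ℕ in atTop, (∑ D ∈ ensemble F g, (outliers D).card : ℝ) ≤
        κ * (Fintype.card F : ℝ) ^ (2 * g + 1) := by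
  obtain ⟨ρ, hρ, hρ1⟩ := exists_between (innerRadius_lt_one (F := F))
  have hρ0 : 0 < ρ := innerRadius_pos.trans hρ
  obtain ⟨C, hC⟩ := exists_norm_circleAverage_logDerivMain_le hρ hρ1
  have ht : Tendsto (fun g : ℕ => 2 * (C * ρ ^ (2 * g))) atTop (𝓝 0) := by
    have := (tendsto_pow_atTop_nhds_zero_of_lt_one (sq_nonneg ρ)
      (pow_lt_one₀ hρ0.le hρ1 two_ne_zero)).const_mul (2 * C)
    simpa [pow_mul, mul_assoc] using this
  filter_upwards [hratios.norm_sum_midRoots_sub_le hq (f := fun _ => 1) isOpen_univ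
    (differentiableOn_const 1) (fun _ => rfl) hρ hρ1 (fun _ _ _ => Set.mem_univ _) (half_pos hκ),
    ht.eventually (gt_mem_nhds (half_pos hκ))] with g hg hg2
  have hav : circleAverage (fun y : ℂ => (1 : ℂ) * (2 * g + 2 * logDerivMain F g y)) 0 ρ =
      2 * g + 2 * circleAverage (logDerivMain F g) 0 ρ := by
    have hi : CircleIntegrable (logDerivMain F g) 0 ρ :=
      circleIntegrable_of_continuousOn hρ0.le fun z hz =>
        continuousAt_logDerivMain g ⟨hz ▸ hρ, hz ▸ hρ1⟩
    simp only [one_mul]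
    have hi' : CircleIntegrable (fun y => 2 * logDerivMain F g y) 0 ρ :=
      hi.const_fun_smul (a := (2 : ℂ))
    rw [Real.circleAverage_fun_add (circleIntegrable_const _ _ _) hi', Real.circleAverage_const]
    congr 1
    exact Real.circleAverage_fun_smul (a := (2 : ℂ)) (f := logDerivMain F g)
  rw [hav] at hg
  have hs : ∑ D ∈ ensemble F g, ((midRoots D).map fun _ => (1 : ℂ)).sum =
      (ensemble F g).card * (2 * g) - ((∑ D ∈ ensemble F g, (outliers D).card : ℝ) : ℂ) := by
    rw [eq_sub_iff_add_eq]
    push_cast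
    rw [← Finset.sum_add_distrib, ← nsmul_eq_mul, ← Finset.sum_const]
    refine Finset.sum_congr rfl fun D hD => ?_
    have := card_outliers_add_card_midRoots hq hD
    rw [Multiset.map_const', Multiset.sum_replicate, nsmul_one]
    exact_mod_cast (add_comm _ _).trans this
  rw [hs] at hg
  have hcard : ((ensemble F g).card : ℝ) ≤ (Fintype.card F : ℝ) ^ (2 * g + 1) := by
    exact_mod_cast card_ensemble_le g
  set S : ℝ := ∑ D ∈ ensemble F g, ((outliers D).card : ℝ)
  set A := circleAverage (logDerivMain F g) 0 ρ
  have hS : ‖(S : ℂ)‖ ≤ κ / 2 * (Fintype.card F : ℝ) ^ (2 * g + 1) +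
      (ensemble F g).card * (2 * ‖A‖) := by
    have e : (S : ℂ) = -(((ensemble F g).card * (2 * g) - (S : ℂ)) -
      (ensemble F g).card * (2 * g + 2 * A)) - (ensemble F g).card * (2 * A) := by ring
    rw [e]
    refine (norm_sub_le _ _).trans (add_le_add ((norm_neg _).trans_le hg) ?_)
    simp
  have hq0 : 0 ≤ (Fintype.card F : ℝ) ^ (2 * g + 1) := by positivity
  have h2A : 2 * ‖A‖ ≤ κ / 2 := by linarith [hC g]
  calc S ≤ ‖(S : ℂ)‖ := by rw [Complex.norm_real]; exact Real.le_norm_self S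
    _ ≤ _ := hS
    _ ≤ κ / 2 * (Fintype.card F : ℝ) ^ (2 * g + 1) +
        (Fintype.card F : ℝ) ^ (2 * g + 1) * (κ / 2) := by gcongr
    _ = _ := by ring

end Outliers

end HyperellipticEnsemble

namespace HyperellipticEnsemble

/-! ### The predicted density on the unit circle. -/

section Density

open Real (circleAverage)

variable {F : Type*} [Field F] [Fintype F]

theorem hasDerivAt_exp_mul (a z : ℂ) :
    HasDerivAt (fun s => Complex.exp (a * s)) (a * Complex.exp (a * z)) z := by
  have h := ((hasDerivAt_id z).const_mul a).cexp
  rw [mul_one, mul_comm] at h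
  exact h

theorem logDeriv_XFactor (s : ℂ) : logDeriv (XFactor F) s = logCard F := by
  have e : XFactor F = fun s => Complex.exp (-(logCard F / 2)) * Complex.exp (logCard F * s) := by
    ext s
    rw [XFactor, card_cpow, ← Complex.exp_add]
    congr 1; ring
  have h := (hasDerivAt_exp_mul (logCard F) s).const_mul (Complex.exp (-(logCard F / 2)))
  rw [logDeriv_apply, e, h.deriv]
  have h1 := Complex.exp_ne_zero (-((logCard F : ℂ) / 2))
  have h2 := Complex.exp_ne_zero (logCard F * s)
  field_simp

theorem logDeriv_zetaA_one_add {z : ℂ} (hz : 1 - Complex.exp (-(logCard F * z)) ≠ 0) :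
    logDeriv (zetaA F) (1 + z) = -(logCard F *
      (Complex.exp (-(logCard F * z)) / (1 - Complex.exp (-(logCard F * z))))) := by
  have e : zetaA F = fun s => (1 - Complex.exp (logCard F) * Complex.exp (-logCard F * s))⁻¹ := by
    ext s
    rw [show s = 1 + (s - 1) by ring, zetaA_one_add, ← Complex.exp_add, one_div]
    congr 3; ring
  have e2 : Complex.exp (logCard F) * Complex.exp (-logCard F * (1 + z)) =
      Complex.exp (-(logCard F * z)) := by
    rw [← Complex.exp_add]; congr 1; ring
  have h := (((hasDerivAt_exp_mul (-logCard F) (1 + z)).const_mul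
    (Complex.exp (logCard F))).const_sub 1).inv (by rw [e2]; exact hz)
  have e3 : Complex.exp (logCard F) * (-(logCard F : ℂ) * Complex.exp (-logCard F * (1 + z))) =
      -logCard F * Complex.exp (-(logCard F * z)) := by
    rw [← e2]; ring
  rw [e2, e3] at h
  rw [logDeriv_apply]
  have hd : HasDerivAt (zetaA F) (- -(-logCard F * Complex.exp (-(logCard F * z))) /
      (1 - Complex.exp (-(logCard F * z))) ^ 2) (1 + z) := by rw [e]; exact h
  rw [hd.deriv, zetaA_one_add]
  field_simp

theorem eulerA'_eq {r : ℂ} (hr : ‖Complex.exp (-(logCard F * r)) ^ 2‖ < Fintype.card F) :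
    eulerA' F r = logCard F * arithSum F (Complex.exp (-(logCard F * r)) ^ 2) := by
  set c := Complex.exp (-(logCard F * r)) with hc
  have hc0 : c ≠ 0 := Complex.exp_ne_zero _
  have hexp : HasDerivAt (fun α => Complex.exp (-(logCard F * α))) (-logCard F * c) r := by
    have := hasDerivAt_exp_mul (-logCard F) r
    simpa only [neg_mul, hc] using this
  have h := HasDerivAt.comp (h₂ := fun a => eulerProd F (a ^ 2) (a * c)) r
    (hasDerivAt_eulerProd hc0 hr) hexp
  have hev : (fun α => eulerA F α r) =ᶠ[𝓝 r]
      (fun a => eulerProd F (a ^ 2) (a * c)) ∘ fun α => Complex.exp (-(logCard F * α)) := by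
    have hcont : Continuous fun α => ‖Complex.exp (-(logCard F * α)) * c‖ := by fun_prop
    filter_upwards [(isOpen_lt hcont continuous_const).mem_nhds
      (show ‖Complex.exp (-(logCard F * r)) * c‖ < Fintype.card F by rwa [← hc, ← sq])] with α hα
    exact eulerA_eq hα
  rw [eulerA', (h.congr_of_eventuallyEq hev).deriv]
  field_simp

/-- Here log|D| - X'/X = (2g+1) log q - log q, and the remaining terms form the main term of L'/L at
a point of the unit circle. The points with y² = 1, where the displayed formula has cancelling
poles, are set aside. -/
theorem densityIntegrand_eq {g : ℕ} {D : F[X]} (hD : D ∈ ensemble F g) {t : ℝ} {y : ℂ}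
    (hy : y = Complex.exp (-(logCard F * (Complex.I * t)))) (hy2 : 1 - y ^ 2 ≠ 0) :
    densityIntegrand D t = logCard F * (2 * g + 2 * logDerivMain F g y) := by
  obtain ⟨⟨hm, hdeg⟩, -⟩ := mem_ensemble.1 hD
  have hy0 : y ≠ 0 := hy ▸ Complex.exp_ne_zero _
  have hn : ‖y‖ = 1 := by rw [hy, Complex.norm_exp]; simp
  have hinv : y⁻¹ = Complex.exp (logCard F * (Complex.I * t)) := by
    rw [hy, ← Complex.exp_neg, neg_neg]
  have hsq : Complex.exp (-(logCard F * (2 * (Complex.I * t)))) = y ^ 2 := by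
    rw [hy, exp_neg_sq]; congr 1; ring
  have hsq' : Complex.exp (-(logCard F * (-2 * (Complex.I * t)))) = y⁻¹ ^ 2 := by
    rw [hinv, ← Complex.exp_nat_mul]; congr 1; push_cast; ring
  have h1 : (Real.log (polyNorm D) : ℂ) = (2 * g + 1) * logCard F := by
    rw [polyNorm_eq hm.ne_zero, hdeg, Real.log_pow, logCard]; push_cast; ring
  have h2 : eulerA' F (Complex.I * t) = logCard F * arithSum F (y ^ 2) := by
    rw [eulerA'_eq, hy]
    rw [← hy, norm_pow, hn, one_pow]
    exact one_lt_cardReal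
  have h3 : eulerA F (-(Complex.I * t)) (Complex.I * t) = eulerProd F (y⁻¹ ^ 2) 1 := by
    have e1 : Complex.exp (-(logCard F * -(Complex.I * t))) = y⁻¹ := by
      rw [hinv]; congr 1; ring
    rw [eulerA_eq, e1, ← hy, inv_mul_cancel₀ hy0]
    rw [e1, ← hy, inv_mul_cancel₀ hy0, norm_one]
    exact one_lt_cardReal
  have h4 : XFactor F (1 / 2 + Complex.I * t) = y⁻¹ := by
    rw [XFactor, card_cpow, hinv]; congr 1; ring
  have h5 : (polyNorm D : ℂ) ^ (-(Complex.I * t)) = y ^ (2 * g + 1) := by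
    rw [polyNorm_cpow hm.ne_zero, hdeg, hy, mul_neg]
  have h6 : zetaA F (1 - 2 * (Complex.I * t)) = 1 / (1 - y⁻¹ ^ 2) := by
    rw [show (1 : ℂ) - 2 * (Complex.I * t) = 1 + -2 * (Complex.I * t) by ring, zetaA_one_add, hsq']
  have h7 : logDeriv (zetaA F) (1 + 2 * (Complex.I * t)) =
      -(logCard F * (y ^ 2 / (1 - y ^ 2))) := by
    rw [logDeriv_zetaA_one_add, hsq]
    rwa [hsq]
  have h8 := inv_sq_ne_one hy0 hy2
  have h9 : y ^ (2 * g + 1) * y⁻¹ * (1 / (1 - y⁻¹ ^ 2)) = -(y ^ 2 / (1 - y ^ 2) * y ^ (2 * g)) := by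
    have : y⁻¹ ^ 2 = (y ^ 2)⁻¹ := inv_pow y 2
    have h10 : (1 : ℂ) / (1 - y⁻¹ ^ 2) = -(y ^ 2 / (1 - y ^ 2)) := by
      rw [eq_neg_iff_add_eq_zero, div_add_div _ _ h8 hy2, div_eq_zero_iff]
      left
      field_simp
      ring
    rw [h10, pow_succ]
    field_simp
  rw [densityIntegrand, h1, h2, h3, h4, h5, h6, h7, logDeriv_XFactor,
    show (Real.log (Fintype.card F) : ℂ) = logCard F from rfl, logDerivMain]
  linear_combination (-2 * logCard F * eulerProd F (y⁻¹ ^ 2) 1) * h9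

theorem isOpen_inv_lt : IsOpen {x : ℂ | x ≠ 0 ∧ ‖x⁻¹‖ < Fintype.card F} := by
  have h : ContinuousOn (fun x : ℂ => ‖x⁻¹‖) {x | x ≠ 0} :=
    (continuousOn_inv₀ (G₀ := ℂ)).norm
  exact h.isOpen_inter_preimage isOpen_ne isOpen_Iio

theorem differentiableOn_pow_mul_eulerProd (g : ℕ) : DifferentiableOn ℂ
    (fun x => x ^ g * eulerProd F x⁻¹ 1) {x | x ≠ 0 ∧ ‖x⁻¹‖ < Fintype.card F} := by
  refine DifferentiableOn.mul (by fun_prop) (differentiableOn_eulerProd isOpen_inv_lt (φ := fun x => x⁻¹)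
    (ψ := fun _ => 1) (differentiableOn_inv.mono fun x hx => hx.1) (by fun_prop) (fun x hx => hx.2)
    fun x hx => ?_)
  rw [norm_one]
  exact one_lt_cardReal

/-- The continuation of `logDerivMain` across the points with `y ^ 2 = 1`. -/
noncomputable def logDerivExt (F : Type*) [Field F] [Fintype F] (g : ℕ) (y : ℂ) : ℂ :=
  arithSum F (y ^ 2) - y ^ 2 * dslope (fun x => x ^ g * eulerProd F x⁻¹ 1) 1 (y ^ 2)

/-- The function x^g · `eulerProd F x⁻¹ 1` has the value 1 at x = 1. The apparently singular term is
therefore minus y² times a difference quotient based at 1, and `dslope` removes the singularity. -/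
theorem logDerivExt_eq (g : ℕ) {y : ℂ} (hy : 1 - y ^ 2 ≠ 0) :
    logDerivExt F g y = logDerivMain F g y := by
  have h : y ^ 2 ≠ 1 := fun h => hy (by rw [h, sub_self])
  rw [logDerivExt, logDerivMain, dslope_of_ne _ h, slope_def_field, inv_one, eulerProd_self,
    one_pow, mul_one, ← pow_mul, inv_pow]
  have h' : y ^ 2 - 1 ≠ 0 := sub_ne_zero.2 h
  field_simp
  ring

/-- A neighbourhood of the unit circle. -/
def extDomain (F : Type*) [Fintype F] : Set ℂ :=
  {y | y ≠ 0 ∧ ‖(y ^ 2)⁻¹‖ < Fintype.card F ∧ ‖y ^ 2‖ < Fintype.card F}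

theorem isOpen_extDomain : IsOpen (extDomain F) := by
  have h : extDomain F = (fun y : ℂ => y ^ 2) ⁻¹' {x : ℂ | x ≠ 0 ∧ ‖x⁻¹‖ < Fintype.card F} ∩
      (fun y : ℂ => y ^ 2) ⁻¹' {x : ℂ | ‖x‖ < Fintype.card F} := by
    ext y
    simp [extDomain, and_assoc]
  rw [h]
  exact (isOpen_inv_lt.preimage (continuous_pow 2)).inter
    ((isOpen_lt continuous_norm continuous_const).preimage (continuous_pow 2))

theorem mem_extDomain {y : ℂ} (h1 : innerRadius F < ‖y‖) (h2 : ‖y‖ ≤ 1) : y ∈ extDomain F := by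
  refine ⟨norm_pos_iff.1 (innerRadius_pos.trans h1), ?_, ?_⟩
  · rw [← inv_pow]; exact inv_sq_lt h1
  · rw [norm_pow]
    exact (pow_le_one₀ (norm_nonneg _) h2).trans_lt one_lt_cardReal

theorem differentiableOn_logDerivExt (g : ℕ) :
    DifferentiableOn ℂ (logDerivExt F g) (extDomain F) := by
  refine DifferentiableOn.sub (differentiableOn_arithSum.comp (by fun_prop) fun y hy => hy.2.2)
    (DifferentiableOn.mul (by fun_prop) ?_)
  refine DifferentiableOn.comp (t := {x : ℂ | x ≠ 0 ∧ ‖x⁻¹‖ < Fintype.card F})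
    ((Complex.differentiableOn_dslope (isOpen_inv_lt.mem_nhds ⟨one_ne_zero, ?_⟩)).2
      (differentiableOn_pow_mul_eulerProd g)) (by fun_prop) fun y hy =>
        ⟨pow_ne_zero 2 hy.1, hy.2.1⟩
  rw [inv_one, norm_one]
  exact one_lt_cardReal

/-- Substitution of log q · t for the angle, after an inversion of the circle because the variable
is q^(-it). -/
theorem circleAverage_one_eq_integral {G : ℂ → ℂ} :
    circleAverage G 0 1 = 1 / (2 * (Real.pi : ℂ)) *
      ∫ t in (-(Real.pi / logCard F))..(Real.pi / logCard F),
        logCard F * G (Complex.exp (-(logCard F * (Complex.I * t)))) := by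
  have hl := logCard_pos (F := F)
  rw [← Real.circleAverage_zero_one_congr_inv, Real.circleAverage_eq_integral_add (-Real.pi)]
  rw [intervalIntegral.integral_comp_add_right (fun θ => G (circleMap 0 1 θ)⁻¹),
    intervalIntegral.integral_const_mul]
  have h := intervalIntegral.smul_integral_comp_mul_left (a := -(Real.pi / logCard F))
    (b := Real.pi / logCard F) (fun θ : ℝ => G (circleMap 0 1 θ)⁻¹) (logCard F)
  have e1 : logCard F * -(Real.pi / logCard F) = 0 + -Real.pi := by field_simp; ring
  have e2 : logCard F * (Real.pi / logCard F) = 2 * Real.pi + -Real.pi := by field_simp; ring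
  rw [e1, e2] at h
  rw [← h, Complex.real_smul, Complex.real_smul]
  have e3 : ∀ t : ℝ, (circleMap 0 1 (logCard F * t))⁻¹ =
      Complex.exp (-(logCard F * (Complex.I * t))) := by
    intro t
    rw [circleMap_zero, Complex.ofReal_one, one_mul, ← Complex.exp_neg]
    congr 1
    push_cast
    ring
  simp only [e3]
  push_cast
  rw [one_div]

end Density

end HyperellipticEnsemble

namespace HyperellipticEnsemble

/-! ### The integral formula for holomorphic test functions. -/

section PeriodicFunction

open Real (circleAverage)

variable {F : Type*} [Field F] [Fintype F]

theorem periodic_int {f : ℂ → ℂ} {δ T : ℝ}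
    (hper : ∀ z : ℂ, |z.im| < δ → f (z + (T : ℂ)) = f z) (n : ℤ) {z : ℂ} (hz : |z.im| < δ) :
    f (z + n * T) = f z := by
  induction n using Int.induction_on with
  | zero => simp
  | succ k ih =>
    rw [← ih, ← hper (z + ((k : ℤ) : ℂ) * T) (by simpa using hz)]
    congr 1; push_cast; ring
  | pred k ih =>
    rw [← ih, ← hper (z + ((-k - 1 : ℤ) : ℂ) * T) (by simpa using hz)]
    congr 1; push_cast; ring

open Classical in
/-- A periodic function on a strip as a function on an annulus. -/
noncomputable def annulusFun (F : Type*) [Fintype F] (δ : ℝ) (f : ℂ → ℂ) (v : ℂ) : ℂ :=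
  if |Real.log ‖v‖| < logCard F * δ then f (-(Complex.I * (Complex.log v / logCard F))) else 0

theorem im_neg_I_mul_div (w : ℂ) : (-(Complex.I * (w / logCard F))).im = -(w.re / logCard F) := by
  simp

theorem abs_im_lt {δ : ℝ} {w : ℂ} (hw : |w.re| < logCard F * δ) :
    |(-(Complex.I * (w / logCard F))).im| < δ := by
  rw [im_neg_I_mul_div, abs_neg, abs_div, abs_of_pos logCard_pos, div_lt_iff₀ logCard_pos]
  linarith

/-- Two logarithms of the same number differ by a multiple of 2πi, which is a multiple of the period
of f; any logarithm may be used. -/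
theorem annulusFun_exp {δ : ℝ} {f : ℂ → ℂ}
    (hper : ∀ z : ℂ, |z.im| < δ → f (z + ((2 * Real.pi / logCard F : ℝ) : ℂ)) = f z)
    {w : ℂ} (hw : |w.re| < logCard F * δ) :
    annulusFun F δ f (Complex.exp w) = f (-(Complex.I * (w / logCard F))) := by
  have hl := logCard_ne_zero (F := F)
  rw [annulusFun, if_pos (by rwa [Complex.norm_exp, Real.log_exp])]
  obtain ⟨n, hn⟩ := Complex.exp_eq_exp_iff_exists_int.1 (Complex.exp_log (Complex.exp_ne_zero w))
  rw [hn, ← periodic_int hper n (abs_im_lt hw)]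
  congr 1
  push_cast
  field_simp
  ring_nf
  rw [Complex.I_sq]
  ring

theorem annulusFun_inv {δ : ℝ} {f : ℂ → ℂ}
    (hper : ∀ z : ℂ, |z.im| < δ → f (z + ((2 * Real.pi / logCard F : ℝ) : ℂ)) = f z)
    (heven : ∀ z : ℂ, |z.im| < δ → f (-z) = f z) (v : ℂ) :
    annulusFun F δ f v⁻¹ = annulusFun F δ f v := by
  rcases eq_or_ne v 0 with rfl | hv
  · rw [inv_zero]
  by_cases h : |Real.log ‖v‖| < logCard F * δ
  · have h1 : |(Complex.log v).re| < logCard F * δ := by rwa [Complex.log_re]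
    have h2 : v⁻¹ = Complex.exp (-Complex.log v) := by rw [Complex.exp_neg, Complex.exp_log hv]
    rw [h2, annulusFun_exp hper (by rwa [Complex.neg_re, abs_neg]), ← heven _ (abs_im_lt (by
      rwa [Complex.neg_re, abs_neg])), annulusFun, if_pos h]
    congr 1; ring
  · rw [annulusFun, annulusFun, if_neg h, if_neg (by rwa [norm_inv, Real.log_inv, abs_neg])]

theorem isOpen_annulus_log (a : ℝ) : IsOpen {v : ℂ | v ≠ 0 ∧ |Real.log ‖v‖| < a} := by
  have h : ContinuousOn (fun v : ℂ => |Real.log ‖v‖|) {v | v ≠ 0} :=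
    (continuous_norm.continuousOn.log fun v hv => norm_ne_zero_iff.2 hv).abs
  exact h.isOpen_inter_preimage isOpen_ne isOpen_Iio

theorem differentiableOn_annulusFun {δ : ℝ} {f : ℂ → ℂ}
    (hd : DifferentiableOn ℂ f {z : ℂ | |z.im| < δ})
    (hper : ∀ z : ℂ, |z.im| < δ → f (z + ((2 * Real.pi / logCard F : ℝ) : ℂ)) = f z) :
    DifferentiableOn ℂ (annulusFun F δ f) {v | v ≠ 0 ∧ |Real.log ‖v‖| < logCard F * δ} := by
  intro v₀ hv₀
  have hstrip : IsOpen {z : ℂ | |z.im| < δ} :=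
    isOpen_lt Complex.continuous_im.abs continuous_const
  -- A branch of the logarithm that is holomorphic near v₀ even when v₀ lies on the cut of the
  -- principal branch.
  set w : ℂ → ℂ := fun v => Complex.log (v / v₀) + Complex.log v₀ with hw
  have hre : ∀ v, v ≠ 0 → Complex.exp (w v) = v := fun v hv => by
    rw [hw, Complex.exp_add, Complex.exp_log (div_ne_zero hv hv₀.1), Complex.exp_log hv₀.1,
      div_mul_cancel₀ _ hv₀.1]
  have hre' : ∀ v, v ≠ 0 → (w v).re = Real.log ‖v‖ := fun v hv => by
    rw [← Real.log_exp (w v).re, ← Complex.norm_exp, hre v hv]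
  have hwd : DifferentiableAt ℂ w v₀ := by
    refine DifferentiableAt.add_const _ (DifferentiableAt.clog (by fun_prop) ?_)
    rw [div_self hv₀.1]
    exact Complex.one_mem_slitPlane
  have hfd : DifferentiableAt ℂ f (-(Complex.I * (w v₀ / logCard F))) :=
    hd.differentiableAt (hstrip.mem_nhds (abs_im_lt (by rw [hre' v₀ hv₀.1]; exact hv₀.2)))
  have hcomp : DifferentiableAt ℂ (fun v => f (-(Complex.I * (w v / logCard F)))) v₀ :=
    DifferentiableAt.comp (g := f) v₀ hfd ((hwd.div_const _).const_mul _).neg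
  refine (hcomp.congr_of_eventuallyEq ?_).differentiableWithinAt
  filter_upwards [(isOpen_annulus_log (logCard F * δ)).mem_nhds hv₀] with v hv
  nth_rw 1 [← hre v hv.1]
  exact annulusFun_exp hper (by rw [hre' v hv.1]; exact hv.2)

theorem annulusFun_eq {δ : ℝ} {f : ℂ → ℂ} {v : ℂ} (hv : |Real.log ‖v‖| < logCard F * δ) :
    annulusFun F δ f v = f ((v.arg / logCard F : ℝ) - Real.log ‖v‖ / logCard F * Complex.I) := by
  rw [annulusFun, if_pos hv, Complex.log]
  congr 1
  push_cast
  ring_nf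
  rw [Complex.I_sq]
  ring

theorem annulusFun_exp_I {δ : ℝ} (hδ : 0 < δ) {f : ℂ → ℂ}
    (hper : ∀ z : ℂ, |z.im| < δ → f (z + ((2 * Real.pi / logCard F : ℝ) : ℂ)) = f z)
    (heven : ∀ z : ℂ, |z.im| < δ → f (-z) = f z) (t : ℝ) :
    annulusFun F δ f (Complex.exp (-(logCard F * (Complex.I * t)))) = f t := by
  have hl := logCard_pos (F := F)
  have hl' := logCard_ne_zero (F := F)
  rw [annulusFun_exp hper, ← heven t (by simpa using hδ)]
  · congr 1
    field_simp
    rw [Complex.I_sq]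
    ring
  · simp
    positivity

theorem exists_lipschitz_strip {δ : ℝ} (hδ : 0 < δ) {f : ℂ → ℂ}
    (hd : DifferentiableOn ℂ f {z : ℂ | |z.im| < δ}) (R : ℝ) :
    ∃ K > (0 : ℝ), (∀ x : ℝ, |x| ≤ R → ‖f x‖ ≤ K) ∧ ∀ x s : ℝ, |x| ≤ R → |s| ≤ δ / 2 →
      ‖f x - f (x - s * Complex.I)‖ ≤ K * |s| := by
  have hstrip : IsOpen {z : ℂ | |z.im| < δ} :=
    isOpen_lt Complex.continuous_im.abs continuous_const
  set S : Set ℂ := Set.Icc (-R) R ×ℂ Set.Icc (-(δ / 2)) (δ / 2) with hS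
  have hSc : IsCompact S := isCompact_Icc.reProdIm isCompact_Icc
  have hSsub : S ⊆ {z : ℂ | |z.im| < δ} := fun z hz => by
    have := abs_le.2 hz.2
    show |z.im| < δ
    linarith
  have hconv : Convex ℝ S := ((convex_Icc (-R) R).affine_preimage Complex.reLm.toAffineMap).inter
      ((convex_Icc (-(δ / 2)) (δ / 2)).affine_preimage Complex.imLm.toAffineMap)
  obtain ⟨A, hA⟩ := hSc.exists_bound_of_continuousOn (hd.continuousOn.mono hSsub)
  obtain ⟨B, hB⟩ := hSc.exists_bound_of_continuousOn ((hd.deriv hstrip).continuousOn.mono hSsub)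
  refine ⟨|A| + |B| + 1, by positivity, fun x hx => ?_, fun x s hx hs => ?_⟩
  · refine (hA x ⟨by simpa using abs_le.1 hx, ?_⟩).trans ?_
    · simp only [Set.mem_preimage, Complex.ofReal_im, Set.mem_Icc]
      constructor <;> linarith
    · linarith [le_abs_self A, abs_nonneg B]
  · have h1 : (x : ℂ) ∈ S := ⟨by simpa using abs_le.1 hx, by
      simp only [Set.mem_preimage, Complex.ofReal_im, Set.mem_Icc]; constructor <;> linarith⟩
    have h2 : (x - s * Complex.I : ℂ) ∈ S := by
      have := abs_le.1 hs
      refine ⟨by simpa using abs_le.1 hx, ?_⟩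
      simp only [Set.mem_preimage, Set.mem_Icc]
      simp
      constructor <;> linarith
    have := hconv.norm_image_sub_le_of_norm_deriv_le (𝕜 := ℂ) (f := f) (C := |A| + |B| + 1)
      (fun z hz => hd.differentiableAt (hstrip.mem_nhds (hSsub hz)))
      (fun z hz => (hB z hz).trans (by linarith [le_abs_self B, abs_nonneg A])) h2 h1
    simpa using this

theorem norm_sum_map_le {s : Multiset ℂ} {f : ℂ → ℂ} {C : ℝ} (h : ∀ v ∈ s, ‖f v‖ ≤ C) :
    ‖(s.map f).sum‖ ≤ s.card * C := by
  induction s using Multiset.induction_on with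
  | empty => simp
  | cons a s ih =>
    rw [Multiset.map_cons, Multiset.sum_cons, Multiset.card_cons]
    refine (norm_add_le _ _).trans ?_
    have h1 := h a (Multiset.mem_cons_self a s)
    have h2 := ih fun v hv => h v (Multiset.mem_cons_of_mem hv)
    push_cast
    linarith

theorem sum_map_add_sub {s t : Multiset ℂ} (f f' : ℂ → ℂ) :
    ((s + t).map f).sum - (t.map f').sum = (s.map f).sum + (t.map fun v => f v - f' v).sum := by
  rw [Multiset.map_add, Multiset.sum_add, Multiset.sum_map_sub]
  ring

/-- The one-level density sees only ordinates, whereas residues evaluate f at complex points. Each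
of the at most 2g near zeros is displaced by at most c₀/((2g+1) log q), which costs a small constant
for each D by the Lipschitz bound. The outliers contribute boundedly each, and there are few of
them. -/
theorem RatiosConjecture.norm_oneLevelDensity_sub_le (hq : Odd (Fintype.card F))
    (hratios : RatiosConjecture F) {δ : ℝ} (hδ : 0 < δ) {f : ℂ → ℂ}
    (hd : DifferentiableOn ℂ f {z : ℂ | |z.im| < δ})
    (heven : ∀ z : ℂ, |z.im| < δ → f (-z) = f z) {κ : ℝ} (hκ : 0 < κ) :
    ∀ᶠ g : ℕ in atTop, ‖oneLevelDensity F g (fun t : ℝ => f t) -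
      ∑ D ∈ ensemble F g, ((midRoots D).map (annulusFun F δ f)).sum‖ ≤
        κ * (Fintype.card F : ℝ) ^ (2 * g + 1) := by
  have hl := logCard_pos (F := F)
  obtain ⟨K, hK, hK1, hK2⟩ := exists_lipschitz_strip hδ hd (Real.pi / logCard F)
  -- The first bound makes the total displacement error at most κ/2 for each D. The second keeps the
  -- displaced points in the half strip where the Lipschitz constant is valid.
  set c₀ : ℝ := min (κ * logCard F / (2 * K)) (logCard F * (δ / 2)) with hc₀
  have hc₀pos : 0 < c₀ := by rw [hc₀]; positivity
  filter_upwards [hratios.sum_card_outliers_le hq (κ := κ / (2 * K)) (by positivity),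
    hratios.norm_midRoots hq hc₀pos] with g hg1 hg2
  have hq0 : (0 : ℝ) < (Fintype.card F : ℝ) ^ (2 * g + 1) :=
    pow_pos (by linarith [one_lt_cardReal (F := F)]) _
  have hevenR : ∀ x : ℝ, f ((-x : ℝ) : ℂ) = f x := fun x => by
    rw [Complex.ofReal_neg]; exact heven x (by simpa using hδ)
  have harg : ∀ v : ℂ, |v.arg / logCard F| ≤ Real.pi / logCard F := fun v => by
    rw [abs_div, abs_of_pos hl]
    have := Complex.abs_arg_le_pi v
    gcongr
  have hD : ∀ D ∈ ensemble F g, ‖zeroSum D (fun t : ℝ => f t) -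
      ((midRoots D).map (annulusFun F δ f)).sum‖ ≤
        (outliers D).card * K + κ / 2 := by
    intro D hD
    rw [zeroSum_eq hq hD (φ := fun t : ℝ => f t) hevenR, ← outliers_add_midRoots, sum_map_add_sub]
    refine (norm_add_le _ _).trans (add_le_add (norm_sum_map_le fun v _ => hK1 _ (harg v)) ?_)
    have hgpos : (0 : ℝ) < 2 * g + 1 := by positivity
    refine (norm_sum_map_le (C := K * (c₀ / (2 * g + 1) / logCard F)) fun v hv => ?_).trans ?_
    · obtain ⟨h1, h2⟩ := hg2 D hD v hv
      have hv0 : 0 < ‖v‖ := (Real.exp_pos _).trans h1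
      have hlog : |Real.log ‖v‖| ≤ c₀ / (2 * g + 1) := by
        rw [abs_le]
        constructor
        · rw [Real.le_log_iff_exp_le hv0]; exact h1.le
        · rw [Real.log_le_iff_le_exp hv0]; exact h2.le
      have hle : c₀ / (2 * g + 1) ≤ logCard F * (δ / 2) :=
        (div_le_self hc₀pos.le (by linarith [(Nat.cast_nonneg g : (0 : ℝ) ≤ g)])).trans
          (min_le_right _ _)
      have hlt : |Real.log ‖v‖| < logCard F * δ := by nlinarith
      rw [annulusFun_eq hlt, ← Complex.ofReal_div]
      have hs : |Real.log ‖v‖ / logCard F| ≤ c₀ / (2 * g + 1) / logCard F := by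
        rw [abs_div, abs_of_pos hl]; gcongr
      refine (hK2 _ _ (harg v) (hs.trans ?_)).trans (by gcongr)
      rw [div_le_iff₀ hl]
      linarith
    · have hcard : ((midRoots D).card : ℝ) ≤ 2 * g + 1 := by
        have := card_outliers_add_card_midRoots hq hD
        exact_mod_cast (by omega : (midRoots D).card ≤ 2 * g + 1)
      calc ((midRoots D).card : ℝ) * (K * (c₀ / (2 * g + 1) / logCard F))
          ≤ (2 * g + 1) * (K * (c₀ / (2 * g + 1) / logCard F)) := by gcongr
        _ = K * c₀ / logCard F := by field_simp
        _ ≤ K * (κ * logCard F / (2 * K)) / logCard F := by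
          gcongr; exact min_le_left _ _
        _ = κ / 2 := by field_simp
  have hcard : ((ensemble F g).card : ℝ) ≤ (Fintype.card F : ℝ) ^ (2 * g + 1) := by
    exact_mod_cast card_ensemble_le g
  rw [oneLevelDensity, ← Finset.sum_sub_distrib]
  calc _ ≤ ∑ D ∈ ensemble F g, (((outliers D).card : ℝ) * K + κ / 2) :=
        (norm_sum_le _ _).trans (Finset.sum_le_sum hD)
    _ = (∑ D ∈ ensemble F g, ((outliers D).card : ℝ)) * K + (ensemble F g).card * (κ / 2) := by
        rw [Finset.sum_add_distrib, ← Finset.sum_mul, Finset.sum_const, nsmul_eq_mul]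
    _ ≤ κ / (2 * K) * (Fintype.card F : ℝ) ^ (2 * g + 1) * K +
        (Fintype.card F : ℝ) ^ (2 * g + 1) * (κ / 2) := by gcongr
    _ = _ := by field_simp; ring

theorem ae_one_sub_exp_sq_ne_zero :
    ∀ᵐ t : ℝ, 1 - Complex.exp (-(logCard F * (Complex.I * t))) ^ 2 ≠ 0 := by
  have hl := logCard_ne_zero (F := F)
  have hc : (Set.range fun n : ℤ => (-(n * Real.pi / logCard F) : ℝ)).Countable :=
    Set.countable_range _
  filter_upwards [hc.ae_notMem MeasureTheory.volume] with t ht h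
  apply ht
  rw [exp_neg_sq, sub_eq_zero, eq_comm, Complex.exp_eq_one_iff] at h
  obtain ⟨n, hn⟩ := h
  refine ⟨n, ?_⟩
  have h2 : (logCard F : ℂ) * t = -(n * Real.pi) := by
    have hI := Complex.I_ne_zero
    have : (2 * Complex.I) * (logCard F * t) = (2 * Complex.I) * -(n * Real.pi) := by
      linear_combination -hn
    exact mul_left_cancel₀ (mul_ne_zero two_ne_zero hI) this
  have h3 : logCard F * t = -(n * Real.pi) := by exact_mod_cast h2
  have hl' := logCard_pos (F := F)
  show -(n * Real.pi / logCard F) = t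
  rw [← neg_div, ← h3]
  field_simp

theorem ae_integrand_eq {δ : ℝ} (hδ : 0 < δ) {f : ℂ → ℂ}
    (hper : ∀ z : ℂ, |z.im| < δ → f (z + ((2 * Real.pi / logCard F : ℝ) : ℂ)) = f z)
    (heven : ∀ z : ℂ, |z.im| < δ → f (-z) = f z) (g : ℕ) :
    ∀ᵐ t : ℝ, f t * ∑ D ∈ ensemble F g, densityIntegrand D t = (ensemble F g).card *
      (logCard F * (fun y => annulusFun F δ f y * (2 * g + 2 * logDerivExt F g y))
        (Complex.exp (-(logCard F * (Complex.I * t))))) := by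
  filter_upwards [ae_one_sub_exp_sq_ne_zero (F := F)] with t ht
  rw [Finset.sum_congr rfl fun D hD => densityIntegrand_eq hD rfl ht, Finset.sum_const,
    nsmul_eq_mul]
  rw [annulusFun_exp_I hδ hper heven, logDerivExt_eq g ht]
  ring

theorem differentiableOn_annulusFun_mul {δ : ℝ} {f : ℂ → ℂ}
    (hd : DifferentiableOn ℂ f {z : ℂ | |z.im| < δ})
    (hper : ∀ z : ℂ, |z.im| < δ → f (z + ((2 * Real.pi / logCard F : ℝ) : ℂ)) = f z) (g : ℕ) :
    DifferentiableOn ℂ (fun y => annulusFun F δ f y * (2 * g + 2 * logDerivExt F g y))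
      ({v | v ≠ 0 ∧ |Real.log ‖v‖| < logCard F * δ} ∩ extDomain F) :=
  ((differentiableOn_annulusFun hd hper).mono Set.inter_subset_left).mul
    ((((differentiableOn_logDerivExt g).mono Set.inter_subset_right).const_mul 2).const_add _)

/-- Outside the countable set where y² = 1 the integrand agrees with a continuous function. -/
theorem intervalIntegrable_density {δ : ℝ} (hδ : 0 < δ) {f : ℂ → ℂ}
    (hd : DifferentiableOn ℂ f {z : ℂ | |z.im| < δ})
    (hper : ∀ z : ℂ, |z.im| < δ → f (z + ((2 * Real.pi / logCard F : ℝ) : ℂ)) = f z)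
    (heven : ∀ z : ℂ, |z.im| < δ → f (-z) = f z) (g : ℕ) (a b : ℝ) :
    IntervalIntegrable (fun t : ℝ => f t * ∑ D ∈ ensemble F g, densityIntegrand D t)
      MeasureTheory.volume a b := by
  have hl := logCard_pos (F := F)
  have hc : Continuous fun t : ℝ => ((ensemble F g).card : ℂ) *
      (logCard F * (fun y => annulusFun F δ f y * (2 * g + 2 * logDerivExt F g y))
        (Complex.exp (-(logCard F * (Complex.I * t))))) := by
    refine continuous_const.mul (continuous_const.mul ?_)
    refine (differentiableOn_annulusFun_mul hd hper g).continuousOn.comp_continuous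
      (by fun_prop) fun t => ?_
    have hn : ‖Complex.exp (-(logCard F * (Complex.I * t)))‖ = 1 := by
      rw [Complex.norm_exp]; simp
    refine ⟨⟨Complex.exp_ne_zero _, ?_⟩, mem_extDomain ?_ hn.le⟩
    · rw [hn, Real.log_one, abs_zero]; positivity
    · rw [hn]; exact innerRadius_lt_one
  refine (hc.intervalIntegrable a b).congr_ae ?_
  refine MeasureTheory.ae_restrict_of_ae ?_
  filter_upwards [ae_integrand_eq hδ hper heven g] with t ht using ht.symm

/-- With the continued main term the integrand is holomorphic between radius ρ and the unit circle,
so the contour can be moved from one to the other without crossing a pole. -/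
theorem integral_density_eq {δ : ℝ} (hδ : 0 < δ) {f : ℂ → ℂ}
    (hd : DifferentiableOn ℂ f {z : ℂ | |z.im| < δ})
    (hper : ∀ z : ℂ, |z.im| < δ → f (z + ((2 * Real.pi / logCard F : ℝ) : ℂ)) = f z)
    (heven : ∀ z : ℂ, |z.im| < δ → f (-z) = f z) (g : ℕ) {ρ : ℝ} (hρ : innerRadius F < ρ)
    (hρ1 : ρ < 1) (hρδ : |Real.log ρ| < logCard F * δ) :
    1 / (2 * (Real.pi : ℂ)) * ∫ t in (-(Real.pi / logCard F))..(Real.pi / logCard F),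
      f t * ∑ D ∈ ensemble F g, densityIntegrand D t =
    (ensemble F g).card *
      circleAverage (fun y => annulusFun F δ f y * (2 * g + 2 * logDerivMain F g y)) 0 ρ := by
  have hρ0 : 0 < ρ := innerRadius_pos.trans hρ
  have h1 : circleAverage (fun y => annulusFun F δ f y * (2 * g + 2 * logDerivMain F g y)) 0 ρ =
      circleAverage (fun y => annulusFun F δ f y * (2 * g + 2 * logDerivExt F g y)) 0 ρ := by
    refine Real.circleAverage_congr_sphere fun z hz => ?_
    have hz' : ‖z‖ = ρ := by simpa [abs_of_pos hρ0] using hz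
    rw [logDerivExt_eq g (sq_ne_one_of_norm_lt (hz' ▸ hρ1))]
  have h2 := circleAverage_eq_of_annulus
    ((isOpen_annulus_log (logCard F * δ)).inter isOpen_extDomain)
    (differentiableOn_annulusFun_mul hd hper g) hρ0 hρ1.le fun z hz1 hz2 => by
      have hz0 : 0 < ‖z‖ := hρ0.trans_le hz1
      refine ⟨⟨norm_pos_iff.1 hz0, ?_⟩, mem_extDomain (hρ.trans_le hz1) hz2⟩
      refine lt_of_le_of_lt ?_ hρδ
      rw [abs_of_nonpos (Real.log_nonpos hz0.le hz2), abs_of_nonpos (Real.log_nonpos hρ0.le hρ1.le)]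
      exact neg_le_neg (Real.log_le_log hρ0 hz1)
  rw [h1, ← h2, circleAverage_one_eq_integral (F := F), mul_left_comm,
    ← intervalIntegral.integral_const_mul ((ensemble F g).card : ℂ)]
  congr 1
  refine intervalIntegral.integral_congr_ae ?_
  filter_upwards [ae_integrand_eq hδ hper heven g] with t ht _ using ht

theorem RatiosConjecture.isLittleO_oneLevelDensity_sub (hq : Odd (Fintype.card F))
    (hratios : RatiosConjecture F) {δ : ℝ} (hδ : 0 < δ) {f : ℂ → ℂ}
    (hd : DifferentiableOn ℂ f {z : ℂ | |z.im| < δ})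
    (hper : ∀ z : ℂ, |z.im| < δ → f (z + ((2 * Real.pi / logCard F : ℝ) : ℂ)) = f z)
    (heven : ∀ z : ℂ, |z.im| < δ → f (-z) = f z) :
    (fun g : ℕ => oneLevelDensity F g (fun t : ℝ => f t) - 1 / (2 * (Real.pi : ℂ)) *
      ∫ t in (-(Real.pi / logCard F))..(Real.pi / logCard F),
        f t * ∑ D ∈ ensemble F g, densityIntegrand D t)
      =o[atTop] (fun g : ℕ => (Fintype.card F : ℝ) ^ (2 * g + 1)) := by
  have hl := logCard_pos (F := F)
  -- The circle must lie in the range of the ratios conjecture, |y| > q^(-1/4), and in the image of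
  -- the strip, |y| > q^(-δ).
  obtain ⟨ρ, hρ, hρ1⟩ := exists_between (max_lt (innerRadius_lt_one (F := F))
    (Real.exp_lt_one_iff.2 (neg_lt_zero.2 (mul_pos hl hδ))))
  obtain ⟨hρi, hρe⟩ := max_lt_iff.1 hρ
  have hρ0 : 0 < ρ := innerRadius_pos.trans hρi
  have hlog : ∀ z : ℝ, ρ ≤ z → z ≤ ρ⁻¹ → |Real.log z| < logCard F * δ := fun z h1 h2 => by
    have hz := hρ0.trans_le h1
    have h3 := Real.log_le_log hρ0 h1
    have h4 := Real.log_le_log hz h2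
    rw [Real.log_inv] at h4
    have h5 := (Real.lt_log_iff_exp_lt hρ0).2 hρe
    rw [abs_lt]
    constructor <;> linarith
  have hle : ρ ≤ ρ⁻¹ := (hρ1.trans ((one_lt_inv₀ hρ0).2 hρ1)).le
  rw [isLittleO_iff]
  intro κ hκ
  filter_upwards [hratios.norm_oneLevelDensity_sub_le hq hδ hd heven (half_pos hκ),
    hratios.norm_sum_midRoots_sub_le hq (isOpen_annulus_log (logCard F * δ))
      (differentiableOn_annulusFun hd hper) (annulusFun_inv hper heven) hρi hρ1
      (fun z h1 h2 => ⟨norm_pos_iff.1 (hρ0.trans_le h1), hlog _ h1 h2⟩) (half_pos hκ)] with g h1 h2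
  rw [integral_density_eq hδ hd hper heven g hρi hρ1 (hlog ρ le_rfl hle),
    Real.norm_of_nonneg (by positivity)]
  refine (norm_sub_le_norm_sub_add_norm_sub _ _ _).trans ((add_le_add h1 h2).trans_eq ?_)
  ring

end PeriodicFunction

end HyperellipticEnsemble

namespace HyperellipticEnsemble

/-! ### Poisson kernels at the scale of the mean spacing. -/

section PoissonKernel

theorem poissonKernel_zero_eq (y v : ℂ) :
    poissonKernel 0 y v = (‖v‖ ^ 2 - ‖y‖ ^ 2) / ‖v - y‖ ^ 2 := by
  simp [poissonKernel_def]

theorem poissonKernel_zero_eq_re (y v : ℂ) :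
    poissonKernel 0 y v = ((v + y) / (v - y)).re := by
  simp [poissonKernel_eq_re_herglotzRieszKernel, herglotzRieszKernel_def]

/-- This links the kernel to the terms y/(y - v) of the logarithmic derivative. It holds for v off
the unit circle too, so the zeros need not be located first. -/
theorem poissonKernel_eq_one_add {y v : ℂ} (h : v ≠ y) :
    poissonKernel 0 y v = 1 + 2 * (y / (v - y)).re := by
  have h' : v - y ≠ 0 := sub_ne_zero.2 h
  have e : (v + y) / (v - y) = 1 + 2 * (y / (v - y)) := by field_simp; ring
  rw [poissonKernel_zero_eq_re, e]
  simp

theorem abs_poissonKernel_le {y v : ℂ} {d : ℝ} (hd : 0 < d) (h : d ≤ ‖v - y‖) (hy : ‖y‖ ≤ 1) :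
    |poissonKernel 0 y v| ≤ 1 + 2 / d := by
  have hne : v ≠ y := fun h0 => by
    rw [h0, sub_self, norm_zero] at h; exact absurd h hd.not_ge
  rw [poissonKernel_eq_one_add hne]
  refine (abs_add_le _ _).trans ?_
  rw [abs_one, abs_mul, abs_two]
  have h1 : |(y / (v - y)).re| ≤ 1 / d := by
    refine (Complex.abs_re_le_norm _).trans ?_
    rw [norm_div]
    gcongr
  calc _ ≤ 1 + 2 * (1 / d) := by gcongr
    _ = _ := by ring

/-- A displacement small against 1 - |y| changes the kernel by a small relative amount, because |w -
y| ≥ 1 - |y|. A relative error is what survives summation over all zeros, since the sum of the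
kernels is controlled. -/
theorem abs_poissonKernel_sub_le {y v w : ℂ} {θ : ℝ} (hθ : θ ≤ 1 / 2) (hy : ‖y‖ < 1)
    (hw : ‖w‖ = 1) (hvw : ‖v - w‖ ≤ θ * (1 - ‖y‖)) :
    |poissonKernel 0 y v - poissonKernel 0 y w| ≤ 4 * θ * poissonKernel 0 y w := by
  have hy1 : 0 < 1 - ‖y‖ := sub_pos.2 hy
  have hθ0 : 0 ≤ θ := nonneg_of_mul_nonneg_left ((norm_nonneg _).trans hvw) hy1
  have hwy : 1 - ‖y‖ ≤ ‖w - y‖ := hw ▸ norm_sub_norm_le w y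
  have hwy0 : 0 < ‖w - y‖ := hy1.trans_le hwy
  have hvy : ‖w - y‖ / 2 ≤ ‖v - y‖ := by
    have h1 := norm_sub_norm_le (w - y) (w - v)
    rw [sub_sub_sub_cancel_left, norm_sub_rev w v] at h1
    nlinarith
  have hvy0 : 0 < ‖v - y‖ := (half_pos hwy0).trans_le hvy
  have hv : v ≠ y := sub_ne_zero.1 (norm_pos_iff.1 hvy0)
  have hw' : w ≠ y := sub_ne_zero.1 (norm_pos_iff.1 hwy0)
  have e : y / (v - y) - y / (w - y) = y * (w - v) / ((v - y) * (w - y)) := by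
    rw [div_sub_div _ _ (sub_ne_zero.2 hv) (sub_ne_zero.2 hw')]
    congr 1; ring
  rw [poissonKernel_eq_one_add hv, poissonKernel_eq_one_add hw', add_sub_add_left_eq_sub,
    ← mul_sub, ← Complex.sub_re, e, abs_mul, abs_two, ← poissonKernel_eq_one_add hw',
    poissonKernel_zero_eq, hw, one_pow]
  have h2 : ‖y * (w - v) / ((v - y) * (w - y))‖ ≤ 2 * θ * ((1 - ‖y‖) / ‖w - y‖ ^ 2) := by
    rw [norm_div, norm_mul, norm_mul, norm_sub_rev w v]
    calc ‖y‖ * ‖v - w‖ / (‖v - y‖ * ‖w - y‖)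
        ≤ 1 * (θ * (1 - ‖y‖)) / (‖w - y‖ / 2 * ‖w - y‖) := by gcongr
      _ = _ := by field_simp
  have h3 : (1 - ‖y‖) / ‖w - y‖ ^ 2 ≤ (1 - ‖y‖ ^ 2) / ‖w - y‖ ^ 2 := by
    gcongr
    nlinarith [norm_nonneg y]
  calc _ ≤ 2 * (2 * θ * ((1 - ‖y‖) / ‖w - y‖ ^ 2)) := by
        gcongr; exact (Complex.abs_re_le_norm _).trans h2
    _ = 4 * θ * ((1 - ‖y‖) / ‖w - y‖ ^ 2) := by ring
    _ ≤ _ := by gcongr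

/-- The point at which the logarithmic derivative is evaluated. -/
noncomputable def circlePoint (g : ℕ) (ε τ : ℝ) : ℂ :=
  Complex.exp (-(2 * Real.pi * (ε - τ * Complex.I) / (2 * g)))

theorem norm_circlePoint (g : ℕ) (ε τ : ℝ) :
    ‖circlePoint g ε τ‖ = Real.exp (-(Real.pi * ε / g)) := by
  rw [circlePoint, Complex.norm_exp]
  congr 1
  have e : (-(2 * Real.pi * (ε - τ * Complex.I) / (2 * g)) : ℂ) =
      ((-(Real.pi * ε / g) : ℝ) : ℂ) + ((Real.pi * τ / g : ℝ) : ℂ) * Complex.I := by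
    push_cast; ring
  rw [e, Complex.add_re, Complex.ofReal_re, Complex.re_ofReal_mul, Complex.I_re, mul_zero, add_zero]

theorem circlePoint_eq (g : ℕ) (ε τ : ℝ) : circlePoint g ε τ =
    circleMap 0 (Real.exp (-(Real.pi * ε / g))) (Real.pi / g * τ) := by
  rw [circleMap_zero, circlePoint, Complex.ofReal_exp, ← Complex.exp_add]
  congr 1
  push_cast
  ring

theorem norm_circleMap_sub_circleMap_sq (r a b : ℝ) :
    ‖circleMap 0 1 a - circleMap 0 r b‖ ^ 2 = (1 - r) ^ 2 + 2 * r * (1 - Real.cos (a - b)) := by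
  rw [circleMap_zero, circleMap_zero, ← Complex.normSq_eq_norm_sq, Complex.normSq_apply,
    Complex.exp_mul_I, Complex.exp_mul_I, Real.cos_sub]
  simp [Complex.cos_ofReal_re, Complex.sin_ofReal_re]
  linear_combination Real.sin_sq_add_cos_sq a + r ^ 2 * Real.sin_sq_add_cos_sq b

/-- The Poisson kernel on the circle of length `2g`. -/
noncomputable def circleKernel (g : ℕ) (ε τ x : ℝ) : ℝ :=
  1 / (2 * g) * poissonKernel 0 (circlePoint g ε τ) (circleMap 0 1 (Real.pi / g * x))

theorem circleKernel_eq (g : ℕ) (ε τ x : ℝ) : circleKernel g ε τ x =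
    1 / (2 * g) * ((1 - Real.exp (-(Real.pi * ε / g)) ^ 2) /
      ((1 - Real.exp (-(Real.pi * ε / g))) ^ 2 + 2 * Real.exp (-(Real.pi * ε / g)) *
        (1 - Real.cos (Real.pi / g * (x - τ))))) := by
  rw [circleKernel, poissonKernel_zero_eq, norm_circlePoint, circlePoint_eq,
    norm_circleMap_sub_circleMap_sq, norm_circleMap_zero, abs_one, one_pow,
    mul_sub (Real.pi / g)]

theorem circleKernel_nonneg (g : ℕ) {ε : ℝ} (hε : 0 ≤ ε) (τ x : ℝ) :
    0 ≤ circleKernel g ε τ x := by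
  have h1 : Real.exp (-(Real.pi * ε / g)) ≤ 1 :=
    Real.exp_le_one_iff.2 (neg_nonpos.2 (by positivity))
  have h2 := Real.exp_pos (-(Real.pi * ε / g))
  have h3 := Real.cos_le_one (Real.pi / g * (x - τ))
  have h4 : 0 ≤ 1 - Real.exp (-(Real.pi * ε / g)) ^ 2 := by nlinarith
  have h5 : 0 ≤ 1 - Real.cos (Real.pi / g * (x - τ)) := by linarith
  rw [circleKernel_eq]
  positivity

theorem continuous_circleKernel {g : ℕ} (hg : 0 < g) {ε : ℝ} (hε : 0 < ε) (x : ℝ) :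
    Continuous fun τ => circleKernel g ε τ x := by
  simp only [circleKernel_eq]
  have hg' : (0 : ℝ) < g := by exact_mod_cast hg
  have h1 : Real.exp (-(Real.pi * ε / g)) < 1 :=
    Real.exp_lt_one_iff.2 (neg_lt_zero.2 (by positivity))
  refine continuous_const.mul (continuous_const.div (by fun_prop) fun τ => ?_)
  have h3 := Real.cos_le_one (Real.pi / g * (x - τ))
  have h5 : 0 ≤ 1 - Real.cos (Real.pi / g * (x - τ)) := by linarith
  have h6 := sub_pos.2 h1
  positivity

theorem half_le_one_sub_exp_neg {u : ℝ} (h0 : 0 ≤ u) (h1 : u ≤ 1) :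
    u / 2 ≤ 1 - Real.exp (-u) := by
  have h2 := Real.add_one_le_exp u
  have h3 : Real.exp (-u) * Real.exp u = 1 := by rw [← Real.exp_add]; simp
  have h4 := Real.exp_pos (-u)
  nlinarith

/-- Comparison with the Cauchy kernel of width ε on the line, which later converts an average of
kernels into a bound on how the zeros can cluster. -/
theorem circleKernel_ge {g : ℕ} (hg : 0 < g) {ε : ℝ} (hε : 0 < ε) (hεg : Real.pi * ε ≤ g)
    (τ x : ℝ) : 1 / (4 * Real.pi) * (ε / (ε ^ 2 + (x - τ) ^ 2)) ≤ circleKernel g ε τ x := by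
  have hg' : (0 : ℝ) < g := by exact_mod_cast hg
  have hπ := Real.pi_pos
  set u := Real.pi * ε / g with hu
  have hu0 : 0 < u := by positivity
  have hu1 : u ≤ 1 := (div_le_one hg').2 hεg
  have h1 := half_le_one_sub_exp_neg hu0.le hu1
  have h2 := Real.add_one_le_exp (-u)
  have h3 := Real.exp_pos (-u)
  have h4 := Real.one_sub_sq_div_two_le_cos (x := Real.pi / g * (x - τ))
  have h5 := Real.cos_le_one (Real.pi / g * (x - τ))
  rw [circleKernel_eq, ← hu]
  have hden : (1 - Real.exp (-u)) ^ 2 + 2 * Real.exp (-u) * (1 - Real.cos (Real.pi / g * (x - τ)))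
      ≤ (Real.pi / g) ^ 2 * (ε ^ 2 + (x - τ) ^ 2) := by
    have a1 : (1 - Real.exp (-u)) ^ 2 ≤ u ^ 2 := by
      apply pow_le_pow_left₀ <;> linarith
    have a2 : 2 * Real.exp (-u) * (1 - Real.cos (Real.pi / g * (x - τ))) ≤
        (Real.pi / g * (x - τ)) ^ 2 := by
      have : Real.exp (-u) ≤ 1 := by linarith
      nlinarith
    have a3 : u ^ 2 = (Real.pi / g) ^ 2 * ε ^ 2 := by rw [hu]; ring
    nlinarith
  have hden0 : 0 < (1 - Real.exp (-u)) ^ 2 +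
      2 * Real.exp (-u) * (1 - Real.cos (Real.pi / g * (x - τ))) := by
    have : 0 < 1 - Real.exp (-u) := by linarith
    have : 0 ≤ 1 - Real.cos (Real.pi / g * (x - τ)) := by linarith
    positivity
  have hnum : u / 2 ≤ 1 - Real.exp (-u) ^ 2 := by nlinarith
  have hnum0 : 0 ≤ 1 - Real.exp (-u) ^ 2 := by linarith
  calc 1 / (4 * Real.pi) * (ε / (ε ^ 2 + (x - τ) ^ 2))
      = 1 / (2 * g) * (u / 2 / ((Real.pi / g) ^ 2 * (ε ^ 2 + (x - τ) ^ 2))) := by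
        rw [hu]; field_simp; ring
    _ ≤ _ := by gcongr

/-- From 1 - cos φ = 2 sin²(φ/2) and sin(|φ|/2) ≥ |φ|/10. The range beyond π spares a reduction
modulo the period: below, one of x and τ may reach a full half period g and the other g/2, so that
|x - τ| ≤ 3g/2. -/
theorem sq_div_le_one_sub_cos {φ : ℝ} (h : |φ| ≤ 3 * Real.pi / 2) :
    φ ^ 2 / 50 ≤ 1 - Real.cos φ := by
  have hπ := Real.pi_pos
  have hπ4 := Real.pi_le_four
  have key : |φ| / 10 ≤ Real.sin (|φ| / 2) := by
    have h0 := abs_nonneg φ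
    have hp : |φ| / 10 ≤ 2 / Real.pi * (|φ| / 2) := by
      rw [div_mul_div_comm, div_le_div_iff₀ (by norm_num) (by positivity)]
      nlinarith
    rcases le_total (|φ| / 2) (Real.pi / 2) with h1 | h1
    · exact hp.trans (Real.mul_le_sin (by positivity) h1)
    · rw [← Real.sin_pi_sub]
      have h2 := Real.mul_le_sin (x := Real.pi - |φ| / 2) (by linarith) (by linarith)
      refine le_trans ?_ h2
      have h3 : (1 : ℝ) / 2 = 2 / Real.pi * (Real.pi / 4) := by field_simp; norm_num
      have h4 : 2 / Real.pi * (Real.pi / 4) ≤ 2 / Real.pi * (Real.pi - |φ| / 2) := by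
        gcongr; linarith
      have h5 : |φ| / 10 ≤ 3 * Real.pi / 20 := by linarith
      have hπ' := Real.pi_lt_d2
      linarith
  have h2 : Real.cos φ = 1 - 2 * Real.sin (|φ| / 2) ^ 2 := by
    have h := Real.cos_two_mul (|φ| / 2)
    rw [Real.cos_sq', mul_div_cancel₀ _ (two_ne_zero' ℝ), Real.cos_abs] at h
    rw [h]
    ring
  have h3 : (|φ| / 10) ^ 2 ≤ Real.sin (|φ| / 2) ^ 2 := by
    apply pow_le_pow_left₀ (by positivity) key
  rw [div_pow, sq_abs] at h3
  rw [h2]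
  linarith

theorem circleKernel_le {g : ℕ} (hg : 0 < g) {ε : ℝ} (hε : 0 < ε) (hεg : 2 * Real.pi * ε ≤ g)
    {τ x : ℝ} (hx : |x - τ| ≤ 3 * g / 2) (hne : x ≠ τ) :
    circleKernel g ε τ x ≤ 16 * ε / (x - τ) ^ 2 := by
  have hg' : (0 : ℝ) < g := by exact_mod_cast hg
  have hπ := Real.pi_pos
  set u := Real.pi * ε / g with hu
  have hu0 : 0 < u := by positivity
  have hu1 : u ≤ 1 / 2 := by rw [hu, div_le_iff₀ hg']; linarith
  have h2 := Real.add_one_le_exp (-u)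
  have h2' := Real.add_one_le_exp (-(2 * u))
  have h3 : Real.exp (-u) ^ 2 = Real.exp (-(2 * u)) := by
    rw [← Real.exp_nat_mul]; congr 1; push_cast; ring
  have h4 := sq_div_le_one_sub_cos (φ := Real.pi / g * (x - τ)) (by
    rw [abs_mul, abs_of_pos (by positivity)]
    calc Real.pi / g * |x - τ| ≤ Real.pi / g * (3 * g / 2) := by gcongr
      _ = _ := by field_simp)
  have hsub : x - τ ≠ 0 := sub_ne_zero.2 hne
  have hsq : 0 < (x - τ) ^ 2 := by positivity
  rw [circleKernel_eq, ← hu]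
  have hden : (Real.pi / g * (x - τ)) ^ 2 / 50 ≤
      (1 - Real.exp (-u)) ^ 2 + 2 * Real.exp (-u) * (1 - Real.cos (Real.pi / g * (x - τ))) := by
    have := sq_nonneg (1 - Real.exp (-u))
    have : 1 ≤ 2 * Real.exp (-u) := by linarith
    have : 0 ≤ (Real.pi / g * (x - τ)) ^ 2 / 50 := by positivity
    nlinarith
  have hnum : 1 - Real.exp (-u) ^ 2 ≤ 2 * u := by rw [h3]; linarith
  calc _ ≤ 1 / (2 * g) * (2 * u / ((Real.pi / g * (x - τ)) ^ 2 / 50)) := by gcongr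
    _ = 50 / Real.pi * ε / (x - τ) ^ 2 := by rw [hu]; field_simp
    _ ≤ 16 * ε / (x - τ) ^ 2 := by
      gcongr
      rw [div_le_iff₀ hπ]
      linarith [Real.pi_gt_d2]

/-- The kernel is the real part of (v + y)/(v - y), holomorphic in y for |y| < 1 with value 1 at the
centre. The integral over τ runs once around a circle in y, so the mean value property applies. -/
theorem integral_circleKernel {g : ℕ} (hg : 0 < g) {ε : ℝ} (hε : 0 < ε) (x : ℝ) :
    ∫ τ in (-(g : ℝ))..g, circleKernel g ε τ x = 1 := by
  have hg' : (0 : ℝ) < g := by exact_mod_cast hg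
  have hπ := Real.pi_pos
  set r := Real.exp (-(Real.pi * ε / g)) with hr
  have hr0 : 0 < r := Real.exp_pos _
  have hr1 : r < 1 := Real.exp_lt_one_iff.2 (neg_lt_zero.2 (by positivity))
  set v := circleMap 0 1 (Real.pi / g * x) with hv
  have hvn : ‖v‖ = 1 := by rw [hv, norm_circleMap_zero, abs_one]
  have hvy : ∀ y : ℂ, ‖y‖ ≤ r → v - y ≠ 0 := fun y hy h0 => by
    rw [sub_eq_zero] at h0
    rw [← h0, hvn] at hy
    linarith
  have h1 : Real.circleAverage (fun y => (v + y) / (v - y)) 0 r = 1 := by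
    rw [circleAverage_of_differentiableOn_closedBall hr0.le]
    · rw [add_zero, sub_zero, div_self (by simpa using hvy 0 (by simpa using hr0.le))]
    · exact DifferentiableOn.div (by fun_prop) (by fun_prop) fun y hy => hvy y (by simpa using hy)
  have h2 : Real.circleAverage (fun y => poissonKernel 0 y v) 0 r = 1 := by
    have h3 := Complex.reCLM.circleAverage_comp_comm (c := 0) (R := r)
      (f := fun y => (v + y) / (v - y)) (circleIntegrable_of_continuousOn hr0.le fun z hz =>
        ContinuousAt.div (by fun_prop) (by fun_prop) (hvy z hz.le))
    rw [h1] at h3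
    simp only [poissonKernel_zero_eq_re]
    simpa [Function.comp_def] using h3
  rw [Real.circleAverage_eq_integral_add (-Real.pi),
    intervalIntegral.integral_comp_add_right (fun θ => poissonKernel 0 (circleMap 0 r θ) v)] at h2
  have h := intervalIntegral.smul_integral_comp_mul_left (a := -(g : ℝ)) (b := g)
    (fun θ : ℝ => poissonKernel 0 (circleMap 0 r θ) v) (Real.pi / g)
  have e1 : Real.pi / g * -(g : ℝ) = 0 + -Real.pi := by field_simp; ring
  have e2 : Real.pi / g * g = 2 * Real.pi + -Real.pi := by field_simp; ring
  rw [e1, e2] at h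
  rw [← h, smul_eq_mul, smul_eq_mul] at h2
  simp only [circleKernel, circlePoint_eq]
  rw [intervalIntegral.integral_const_mul]
  refine Eq.trans ?_ h2
  rw [← mul_assoc]
  congr 1
  field_simp

end PoissonKernel

end HyperellipticEnsemble

namespace HyperellipticEnsemble

/-! ### Smoothed averages over the zeros. -/

section ZeroAverage

variable {F : Type*} [Field F] [Fintype F]

/-- The average over the ensemble of the sum of `φ` over the zeros, on the scale of their mean
spacing. -/
noncomputable def zeroAvg (F : Type*) [Field F] [Fintype F] (g : ℕ) {E : Type*}
    [NormedAddCommGroup E] [NormedSpace ℝ E] (φ : ℝ → E) : E :=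
  ((ensemble F g).card : ℝ)⁻¹ •
    ∑ D ∈ ensemble F g, ((normLPoly D).roots.map fun v => φ (g / Real.pi * v.arg)).sum

theorem norm_multiset_sum_map_le {E : Type*} [NormedAddCommGroup E] {s : Multiset ℂ}
    {f : ℂ → E} {w : ℂ → ℝ} (h : ∀ v ∈ s, ‖f v‖ ≤ w v) : ‖(s.map f).sum‖ ≤ (s.map w).sum := by
  induction s using Multiset.induction_on with
  | empty => simp
  | cons a s ih =>
    rw [Multiset.map_cons, Multiset.sum_cons, Multiset.map_cons, Multiset.sum_cons]
    exact (norm_add_le _ _).trans (add_le_add (h a (Multiset.mem_cons_self a s))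
      (ih fun v hv => h v (Multiset.mem_cons_of_mem hv)))

theorem norm_zeroAvg_le (g : ℕ) {E : Type*} [NormedAddCommGroup E] [NormedSpace ℝ E]
    {φ : ℝ → E} {w : ℝ → ℝ} (h : ∀ x : ℝ, |x| ≤ g → ‖φ x‖ ≤ w x) :
    ‖zeroAvg F g φ‖ ≤ zeroAvg F g w := by
  rw [zeroAvg, zeroAvg, norm_smul, norm_inv, Real.norm_natCast, smul_eq_mul]
  refine mul_le_mul_of_nonneg_left ?_ (by positivity)
  refine (norm_sum_le _ _).trans (Finset.sum_le_sum fun D _ => ?_)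
  refine norm_multiset_sum_map_le fun v _ => h _ ?_
  have hπ := Real.pi_pos
  rw [abs_mul, abs_of_nonneg (by positivity)]
  calc (g : ℝ) / Real.pi * |v.arg| ≤ g / Real.pi * Real.pi := by
        gcongr; exact Complex.abs_arg_le_pi v
    _ = g := by field_simp

theorem zeroAvg_const_mul (g : ℕ) (c : ℝ) (φ : ℝ → ℝ) :
    zeroAvg F g (fun x => c * φ x) = c * zeroAvg F g φ := by
  simp only [zeroAvg, Multiset.sum_map_mul_left, ← Finset.mul_sum, smul_eq_mul]
  ring

theorem zeroAvg_sub (g : ℕ) {E : Type*} [NormedAddCommGroup E] [NormedSpace ℝ E] (φ ψ : ℝ → E) :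
    zeroAvg F g (fun x => φ x - ψ x) = zeroAvg F g φ - zeroAvg F g ψ := by
  simp only [zeroAvg, Multiset.sum_map_sub, Finset.sum_sub_distrib, smul_sub]

theorem circleMap_arg {v : ℂ} (hv : v ≠ 0) : circleMap 0 1 v.arg = v / ‖v‖ := by
  have h : (‖v‖ : ℂ) ≠ 0 := by exact_mod_cast norm_ne_zero_iff.2 hv
  rw [circleMap_zero, Complex.ofReal_one, one_mul, eq_div_iff h, mul_comm]
  exact Complex.norm_mul_exp_arg_mul_I v

/-- The normalized sum of the Poisson kernel over the zeros. -/
noncomputable def poissonAvg (F : Type*) [Field F] [Fintype F] (g : ℕ) (y : ℂ) : ℝ :=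
  ((ensemble F g).card : ℝ)⁻¹ *
    ∑ D ∈ ensemble F g, 1 / (2 * g) * ((normLPoly D).roots.map (poissonKernel 0 y)).sum

theorem card_ensemble_pos (hq : Odd (Fintype.card F)) (g : ℕ) : 0 < ((ensemble F g).card : ℝ) := by
  have h := card_pow_le_two_mul_card_ensemble hq g
  have h2 : 0 < Fintype.card F ^ (2 * g + 1) := pow_pos Fintype.card_pos _
  exact_mod_cast (by omega : 0 < (ensemble F g).card)

theorem pow_card_le (hq : Odd (Fintype.card F)) (g : ℕ) :
    (Fintype.card F : ℝ) ^ (2 * g + 1) ≤ 2 * (ensemble F g).card := by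
  exact_mod_cast card_pow_le_two_mul_card_ensemble hq g

theorem multiset_sum_map_re (s : Multiset ℂ) (f : ℂ → ℂ) :
    (s.map fun v => (f v).re).sum = (s.map f).sum.re := by
  induction s using Multiset.induction_on with
  | empty => simp
  | cons a s ih => simp [ih]

/-- Exact wherever the zeros lie; there are 2g of them, each contributing 1 - 2 Re(y/(y - v)). -/
theorem sum_poissonKernel_eq (hq : Odd (Fintype.card F)) {g : ℕ} {D : F[X]}
    (hD : D ∈ ensemble F g) {y : ℂ} (hy : (normLPoly D).eval y ≠ 0) :
    ((normLPoly D).roots.map (poissonKernel 0 y)).sum = 2 * g - 2 * (logDer D y).re := by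
  have h : (normLPoly D).roots.map (poissonKernel 0 y) =
      (normLPoly D).roots.map fun v => 1 - 2 * (y / (y - v)).re := by
    refine Multiset.map_congr rfl fun v hv => ?_
    rw [mem_roots (normLPoly_ne_zero hD)] at hv
    have hvy : v ≠ y := by rintro rfl; exact hy hv
    rw [poissonKernel_eq_one_add hvy, ← neg_sub y v, div_neg, Complex.neg_re]
    ring
  rw [h, Multiset.sum_map_sub, Multiset.sum_map_mul_left, multiset_sum_map_re, ← logDer_eq_sum hy,
    Multiset.map_const', Multiset.sum_replicate, card_roots_normLPoly hq hD]
  simp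

theorem tendsto_exp_neg_div (c : ℝ) :
    Tendsto (fun g : ℕ => Real.exp (-(c / g))) atTop (𝓝 1) := by
  have h := (Real.continuous_exp.tendsto (-0)).comp
    (tendsto_const_div_atTop_nhds_zero_nat c).neg
  simpa [Function.comp_def] using h

/-- At distance about ε/g from the unit circle Cauchy's estimate loses a factor g/ε, and the
normalization by 2g absorbs it. -/
theorem RatiosConjecture.abs_poissonAvg_sub_le (hq : Odd (Fintype.card F))
    (hratios : RatiosConjecture F) {ε η : ℝ} (hε : 0 < ε) (hη : 0 < η) :
    ∀ᶠ g : ℕ in atTop, ∀ y : ℂ, ‖y‖ = Real.exp (-(Real.pi * ε / g)) →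
      |poissonAvg F g y - (1 + (logDerivMain F g y).re / g)| ≤ η := by
  have hπ := Real.pi_pos
  have hc₀ : 0 < Real.pi * ε := by positivity
  have hin := innerRadius_lt_one (F := F)
  -- The factor 8 is 2 from the size of the ensemble times 4 from the radius (1 - |y|)/2 ≥ πε/(4g).
  filter_upwards [hratios.norm_sum_logDer_le hq hc₀ (κ := η * Real.pi * ε / 8) (by positivity),
    hratios.eval_ne_zero hq hc₀, eventually_ge_atTop 1,
    (tendsto_natCast_atTop_atTop (R := ℝ)).eventually_ge_atTop (Real.pi * ε),
    (tendsto_exp_neg_div (Real.pi * ε)).eventually (lt_mem_nhds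
      (show (2 * innerRadius F + 1) / 3 < 1 by linarith))] with g h1 h2 hg1 hg2 hg3 y hy
  have hg0 : (0 : ℝ) < g := by exact_mod_cast hg1
  have hu1 : Real.pi * ε / g ≤ 1 := (div_le_one hg0).2 hg2
  have hu0 : 0 < Real.pi * ε / g := by positivity
  have hhalf := half_le_one_sub_exp_neg hu0.le hu1
  rw [← hy] at hhalf hg3
  have hy1 : 0 < 1 - ‖y‖ := by linarith
  have hyle : ‖y‖ ≤ Real.exp (-(Real.pi * ε / (2 * g + 1))) := by
    rw [hy, Real.exp_le_exp, neg_le_neg_iff]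
    gcongr
    linarith
  have hsub : Metric.closedBall y ((1 - ‖y‖) / 2) ⊆ openAnnulus F := fun z hz => by
    rw [Metric.mem_closedBall, dist_eq_norm] at hz
    have h3 := norm_sub_norm_le z y
    have h4 := norm_sub_norm_le y z
    rw [norm_sub_rev] at h4
    constructor <;> linarith
  have hne : ∀ D ∈ ensemble F g, (normLPoly D).eval y ≠ 0 := fun D hD =>
    h2 D hD y (by linarith) hyle
  have h3 := h1 y _ (half_pos hy1) hsub hyle
  have hH := card_ensemble_pos hq g
  have hHq := pow_card_le hq g
  set H : ℝ := ((ensemble F g).card : ℝ) with hHdef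
  set S := ∑ D ∈ ensemble F g, logDer D y
  have e1 : poissonAvg F g y = 1 - S.re / (g * H) := by
    rw [poissonAvg, ← Finset.mul_sum,
      Finset.sum_congr rfl fun D hD => sum_poissonKernel_eq hq hD (hne D hD),
      Finset.sum_sub_distrib, ← Finset.mul_sum (f := fun D => (logDer D y).re), ← Complex.re_sum,
      Finset.sum_const, nsmul_eq_mul, ← hHdef]
    field_simp
    rfl
  have e2 : poissonAvg F g y - (1 + (logDerivMain F g y).re / g) =
      -((S + (ensemble F g).card * logDerivMain F g y).re / (g * H)) := by
    rw [e1, Complex.add_re, ← Complex.ofReal_natCast, Complex.re_ofReal_mul, ← hHdef]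
    field_simp
    ring
  rw [e2, abs_neg, abs_div, abs_of_pos (by positivity : 0 < g * H)]
  calc _ ≤ η * Real.pi * ε / 8 * (Fintype.card F : ℝ) ^ (2 * g + 1) / ((1 - ‖y‖) / 2) / (g * H) := by
        gcongr
        exact (Complex.abs_re_le_norm _).trans h3
    _ ≤ η * Real.pi * ε / 8 * (2 * H) / (Real.pi * ε / g / 2 / 2) / (g * H) := by gcongr
    _ = η := by field_simp; norm_num

/-- The only unbounded factor is y²/(1 - y²), of size at most a multiple of g/ε. The bound is
uniform on the circle, as dominated convergence in τ will require. -/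
theorem exists_norm_logDerivMain_le {ε : ℝ} (hε : 0 < ε) :
    ∃ C > (0 : ℝ), ∀ᶠ g : ℕ in atTop, ∀ y : ℂ, ‖y‖ = Real.exp (-(Real.pi * ε / g)) →
      ‖logDerivMain F g y‖ ≤ C * g := by
  have hπ := Real.pi_pos
  obtain ⟨ρ, hρ, hρ1⟩ := exists_between (innerRadius_lt_one (F := F))
  have hρ0 : 0 < ρ := innerRadius_pos.trans hρ
  obtain ⟨A, hA⟩ := (isCompact_closedBall (0 : ℂ) 1).exists_bound_of_continuousOn
    (f := arithSum F) (differentiableOn_arithSum.continuousOn.mono fun x hx =>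
      lt_of_le_of_lt (by simpa using hx) one_lt_cardReal)
  obtain ⟨B, hB⟩ := ((isCompact_closedBall (0 : ℂ) 1).diff
    (Metric.isOpen_ball (x := (0 : ℂ)) (ε := ρ))).exists_bound_of_continuousOn
    (f := fun y => eulerProd F (y⁻¹ ^ 2) 1) (by
      have h := (differentiableOn_pow_mul_eulerProd (F := F) 0).continuousOn
      simp only [pow_zero, one_mul] at h
      have h2 := h.comp (continuous_pow 2).continuousOn (s := Metric.closedBall (0 : ℂ) 1 \
        Metric.ball 0 ρ) fun y hy => by
          have hy2 : ρ ≤ ‖y‖ := by simpa using hy.2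
          refine ⟨pow_ne_zero 2 (norm_pos_iff.1 (hρ0.trans_le hy2)), ?_⟩
          rw [← inv_pow]
          exact inv_sq_lt (hρ.trans_le hy2)
      simpa only [Function.comp_def, inv_pow] using h2)
  refine ⟨|A| + (|B| + 1) * (2 / (Real.pi * ε)), by positivity, ?_⟩
  filter_upwards [eventually_ge_atTop 1,
    (tendsto_natCast_atTop_atTop (R := ℝ)).eventually_ge_atTop (Real.pi * ε),
    (tendsto_exp_neg_div (Real.pi * ε)).eventually (lt_mem_nhds hρ1)] with g hg1 hg2 hg3 y hy
  have hg0 : (0 : ℝ) < g := by exact_mod_cast hg1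
  have hg1' : (1 : ℝ) ≤ g := by exact_mod_cast hg1
  have hu1 : Real.pi * ε / g ≤ 1 := (div_le_one hg0).2 hg2
  have hu0 : 0 < Real.pi * ε / g := by positivity
  have hhalf := half_le_one_sub_exp_neg hu0.le hu1
  rw [← hy] at hhalf hg3
  have hy1 : ‖y‖ ≤ 1 := by linarith
  have a1 : ‖arithSum F (y ^ 2)‖ ≤ |A| := (hA _ (by
    rw [mem_closedBall_zero_iff, norm_pow]; exact pow_le_one₀ (norm_nonneg y) hy1)).trans (le_abs_self A)
  have a2 : ‖eulerProd F (y⁻¹ ^ 2) 1‖ ≤ |B| := (hB y ⟨by simpa using hy1, by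
    simpa using hg3.le⟩).trans (le_abs_self B)
  have a3 : ‖y ^ 2 / (1 - y ^ 2)‖ ≤ 2 / (Real.pi * ε) * g := by
    rw [norm_div]
    have : Real.pi * ε / g / 2 ≤ ‖1 - y ^ 2‖ := by
      have h := norm_sub_norm_le 1 (y ^ 2)
      rw [norm_one, norm_pow] at h
      nlinarith [norm_nonneg y]
    calc ‖y ^ 2‖ / ‖1 - y ^ 2‖ ≤ 1 / (Real.pi * ε / g / 2) := by
          gcongr
          rw [norm_pow]
          exact pow_le_one₀ (norm_nonneg y) hy1
      _ = _ := by field_simp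
  have a4 : ‖y ^ (2 * g) * eulerProd F (y⁻¹ ^ 2) 1 - 1‖ ≤ |B| + 1 := by
    refine (norm_sub_le _ _).trans ?_
    rw [norm_one, norm_mul, norm_pow]
    gcongr
    exact (mul_le_of_le_one_left (norm_nonneg _) (pow_le_one₀ (norm_nonneg y) hy1)).trans a2
  rw [logDerivMain]
  refine (norm_add_le _ _).trans ?_
  rw [norm_mul]
  calc _ ≤ |A| * g + 2 / (Real.pi * ε) * g * (|B| + 1) := by
        gcongr
        exact a1.trans (le_mul_of_one_le_right (abs_nonneg A) hg1')
    _ = _ := by ring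

theorem zeroAvg_circleKernel_eq {g : ℕ} (hg : 0 < g) (ε τ : ℝ) :
    zeroAvg F g (circleKernel g ε τ) = ((ensemble F g).card : ℝ)⁻¹ *
      ∑ D ∈ ensemble F g, 1 / (2 * g) *
        ((normLPoly D).roots.map fun v => poissonKernel 0 (circlePoint g ε τ) (v / ‖v‖)).sum := by
  have hg0 : (g : ℝ) ≠ 0 := by exact_mod_cast hg.ne'
  have hπ := Real.pi_pos.ne'
  rw [zeroAvg, smul_eq_mul]
  congr 1
  refine Finset.sum_congr rfl fun D hD => ?_
  rw [← Multiset.sum_map_mul_left]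
  congr 1
  refine Multiset.map_congr rfl fun v hv => ?_
  rw [circleKernel, ← circleMap_arg (ne_zero_of_mem_roots hD hv)]
  congr 3
  field_simp

theorem norm_div_norm {v : ℂ} (hv : v ≠ 0) : ‖v / ‖v‖‖ = 1 := by
  rw [norm_div, Complex.norm_real, norm_norm, div_self (norm_ne_zero_iff.2 hv)]

theorem norm_sub_div_norm {v : ℂ} (hv : v ≠ 0) : ‖v - v / ‖v‖‖ = |‖v‖ - 1| := by
  have h : (‖v‖ : ℂ) ≠ 0 := by exact_mod_cast norm_ne_zero_iff.2 hv
  have e : v - v / ‖v‖ = (v / ‖v‖) * ((‖v‖ - 1 : ℝ) : ℂ) := by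
    push_cast; field_simp
  rw [e, norm_mul, norm_div_norm hv, one_mul, Complex.norm_real, Real.norm_eq_abs]

theorem sum_map_nonneg {s : Multiset ℂ} {w : ℂ → ℝ} (h : ∀ v ∈ s, 0 ≤ w v) :
    0 ≤ (s.map w).sum :=
  Multiset.sum_nonneg fun x hx => by
    obtain ⟨v, hv, rfl⟩ := Multiset.mem_map.1 hx
    exact h v hv

/-- One average takes the zeros where they are, the other their radial projections to the unit
circle. Near zeros move by at most θ(1 - |y|), a relative error 4θ. An outlier costs O(g/ε), which
the normalization by 2g and the scarcity of outliers make small. -/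
theorem RatiosConjecture.abs_poissonAvg_sub_zeroAvg_le (hq : Odd (Fintype.card F))
    (hratios : RatiosConjecture F) {ε θ κ : ℝ} (hε : 0 < ε) (hθ : 0 < θ) (hθ1 : θ ≤ 1 / 2)
    (hκ : 0 < κ) : ∀ᶠ g : ℕ in atTop, ∀ τ : ℝ,
      |poissonAvg F g (circlePoint g ε τ) - zeroAvg F g (circleKernel g ε τ)| ≤
        κ + 4 * θ * zeroAvg F g (circleKernel g ε τ) := by
  have hπ := Real.pi_pos
  have hin := innerRadius_lt_one (F := F)
  filter_upwards [hratios.sum_card_outliers_le hq (κ := κ * Real.pi * ε / 12) (by positivity),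
    -- A near zero moves by at most 2c₀/(2g+1) ≤ θ · πε/(2g) ≤ θ(1 - |y|). The cap c₀ ≤ 1 is for exp
    -- t - 1 ≤ 2t.
    hratios.norm_midRoots hq (c₀ := min 1 (θ * Real.pi * ε / 2)) (by positivity),
    eventually_ge_atTop 1,
    (tendsto_natCast_atTop_atTop (R := ℝ)).eventually_ge_atTop (Real.pi * ε),
    (tendsto_exp_neg_div (Real.pi * ε)).eventually (lt_mem_nhds
      (show (innerRadius F + 1) / 2 < 1 by linarith))] with g h1 h2 hg1 hg2 hg3 τ
  have hg0 : (0 : ℝ) < g := by exact_mod_cast hg1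
  have hu1 : Real.pi * ε / g ≤ 1 := (div_le_one hg0).2 hg2
  have hu0 : 0 < Real.pi * ε / g := by positivity
  have hhalf := half_le_one_sub_exp_neg hu0.le hu1
  have hy := norm_circlePoint g ε τ
  rw [zeroAvg_circleKernel_eq hg1]
  set y := circlePoint g ε τ
  rw [← hy] at hhalf hg3
  have hy1 : 0 < 1 - ‖y‖ := by linarith
  have hy1' : ‖y‖ < 1 := by linarith
  set c₀ := min 1 (θ * Real.pi * ε / 2) with hc₀
  have hc₀0 : 0 < c₀ := by rw [hc₀]; positivity
  have hk : ∀ D ∈ ensemble F g, ∀ v ∈ (normLPoly D).roots, 0 ≤ poissonKernel 0 y (v / ‖v‖) := by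
    intro D hD v hv
    rw [poissonKernel_zero_eq, norm_div_norm (ne_zero_of_mem_roots hD hv)]
    have : 0 ≤ 1 ^ 2 - ‖y‖ ^ 2 := by nlinarith [norm_nonneg y]
    positivity
  have hD : ∀ D ∈ ensemble F g, |((normLPoly D).roots.map (poissonKernel 0 y)).sum -
      ((normLPoly D).roots.map fun v => poissonKernel 0 y (v / ‖v‖)).sum| ≤
      (outliers D).card * (6 / (1 - ‖y‖)) +
        4 * θ * ((normLPoly D).roots.map fun v => poissonKernel 0 y (v / ‖v‖)).sum := by
    intro D hD
    have hmid : ∀ v ∈ midRoots D, v ∈ (normLPoly D).roots := fun v hv => (mem_midRoots.1 hv).1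
    have hout : ∀ v ∈ outliers D, v ∈ (normLPoly D).roots := fun v hv => by
      rw [← outliers_add_midRoots]; exact Multiset.mem_add.2 (Or.inl hv)
    rw [← Multiset.sum_map_sub, ← outliers_add_midRoots, Multiset.map_add, Multiset.sum_add,
      Multiset.map_add, Multiset.sum_add]
    refine (abs_add_le _ _).trans ?_
    -- Both v and its projection are at distance at least 1 - |y| from y, so each kernel is at most
    -- 1 + 2/(1 - |y|) ≤ 3/(1 - |y|).
    have b1 : |((outliers D).map fun v =>
        poissonKernel 0 y v - poissonKernel 0 y (v / ‖v‖)).sum| ≤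
        (outliers D).card * (6 / (1 - ‖y‖)) := by
      rw [← Real.norm_eq_abs]
      refine (norm_multiset_sum_map_le (f := fun v => poissonKernel 0 y v -
        poissonKernel 0 y (v / ‖v‖)) (w := fun _ => 6 / (1 - ‖y‖)) fun v hv => ?_).trans_eq ?_
      · have hv0 := ne_zero_of_mem_roots hD (hout v hv)
        have d1 : 1 - ‖y‖ ≤ ‖v - y‖ := by
          classical
          rw [outliers, Multiset.mem_filter] at hv
          rcases hv.2 with h | h
          · have := norm_sub_norm_le y v
            rw [norm_sub_rev] at this
            linarith
          · have h3 := norm_sub_norm_le v y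
            have h4 := (one_lt_inv₀ (innerRadius_pos (F := F))).2 hin
            linarith
        have d2 : 1 - ‖y‖ ≤ ‖v / ‖v‖ - y‖ := by
          have := norm_sub_norm_le (v / ‖v‖) y
          rwa [norm_div_norm hv0] at this
        have k1 := abs_poissonKernel_le hy1 d1 hy1'.le
        have k2 := abs_poissonKernel_le hy1 d2 hy1'.le
        have k3 : 1 ≤ 1 / (1 - ‖y‖) := by
          rw [le_div_iff₀ hy1]; linarith [norm_nonneg y]
        rw [Real.norm_eq_abs]
        refine (abs_sub _ _).trans ((add_le_add k1 k2).trans ?_)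
        have e : (6 : ℝ) / (1 - ‖y‖) = 6 * (1 / (1 - ‖y‖)) := by ring
        have e' : (2 : ℝ) / (1 - ‖y‖) = 2 * (1 / (1 - ‖y‖)) := by ring
        rw [e, e']
        linarith
      · simp
    have b2 : |((midRoots D).map fun v =>
        poissonKernel 0 y v - poissonKernel 0 y (v / ‖v‖)).sum| ≤
        4 * θ * ((midRoots D).map fun v => poissonKernel 0 y (v / ‖v‖)).sum := by
      rw [← Multiset.sum_map_mul_left, ← Real.norm_eq_abs]
      refine norm_multiset_sum_map_le (f := fun v => poissonKernel 0 y v -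
        poissonKernel 0 y (v / ‖v‖)) fun v hv => ?_
      have hv0 := ne_zero_of_mem_roots hD (hmid v hv)
      refine abs_poissonKernel_sub_le hθ1 hy1' (norm_div_norm hv0) ?_
      obtain ⟨m1, m2⟩ := h2 D hD v hv
      rw [norm_sub_div_norm hv0]
      have hgp : (0 : ℝ) < 2 * g + 1 := by positivity
      set t := c₀ / (2 * g + 1) with ht
      have ht0 : 0 < t := by positivity
      have ht1 : t ≤ 1 := by
        rw [ht, div_le_one hgp]
        linarith [min_le_left 1 (θ * Real.pi * ε / 2)]
      have q1 := Real.add_one_le_exp (-t)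
      have q2 : Real.exp t - 1 ≤ 2 * t := by
        have := Real.abs_exp_sub_one_le (x := t) (by rwa [abs_of_pos ht0])
        rw [abs_of_pos ht0] at this
        exact (le_abs_self _).trans this
      have q3 : 2 * t ≤ θ * (1 - ‖y‖) := by
        calc 2 * t ≤ 2 * ((θ * Real.pi * ε / 2) / (2 * g)) := by
              rw [ht]
              gcongr
              · exact min_le_right _ _
              · linarith
          _ = θ * (Real.pi * ε / g / 2) := by field_simp
          _ ≤ θ * (1 - ‖y‖) := by gcongr
      rw [abs_le]
      constructor <;> linarith
    have b3 : 0 ≤ ((outliers D).map fun v => poissonKernel 0 y (v / ‖v‖)).sum :=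
      sum_map_nonneg fun v hv => hk D hD v (hout v hv)
    have b4 : 0 ≤ 4 * θ * ((outliers D).map fun v => poissonKernel 0 y (v / ‖v‖)).sum := by
      positivity
    rw [mul_add]
    linarith
  have hH := card_ensemble_pos hq g
  have hHq := pow_card_le hq g
  rw [poissonAvg, ← mul_sub, ← Finset.sum_sub_distrib, abs_mul,
    abs_of_pos (inv_pos.2 hH)]
  set H : ℝ := ((ensemble F g).card : ℝ) with hHdef
  have hsum : |∑ D ∈ ensemble F g, (1 / (2 * (g : ℝ)) *
      ((normLPoly D).roots.map (poissonKernel 0 y)).sum - 1 / (2 * g) *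
      ((normLPoly D).roots.map fun v => poissonKernel 0 y (v / ‖v‖)).sum)| ≤
      ∑ D ∈ ensemble F g, (1 / (2 * (g : ℝ)) * ((outliers D).card * (6 / (1 - ‖y‖)) +
        4 * θ * ((normLPoly D).roots.map fun v => poissonKernel 0 y (v / ‖v‖)).sum)) := by
    refine (Finset.abs_sum_le_sum_abs _ _).trans (Finset.sum_le_sum fun D hDm => ?_)
    rw [← mul_sub, abs_mul, abs_of_pos (by positivity : 0 < 1 / (2 * (g : ℝ)))]
    exact mul_le_mul_of_nonneg_left (hD D hDm) (by positivity)
  refine (mul_le_mul_of_nonneg_left hsum (by positivity)).trans ?_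
  simp only [mul_add, Finset.sum_add_distrib]
  refine add_le_add ?_ (le_of_eq ?_)
  · have e : ∑ D ∈ ensemble F g, 1 / (2 * (g : ℝ)) * ((outliers D).card * (6 / (1 - ‖y‖))) =
        1 / (2 * g) * ((∑ D ∈ ensemble F g, ((outliers D).card : ℝ)) * (6 / (1 - ‖y‖))) := by
      rw [← Finset.mul_sum, Finset.sum_mul]
    rw [e]
    calc _ ≤ H⁻¹ * (1 / (2 * g) * (κ * Real.pi * ε / 12 * (2 * H) *
          (6 / (Real.pi * ε / g / 2)))) := by
          gcongr
          exact h1.trans (by gcongr)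
      _ = κ := by field_simp; norm_num
  · rw [Finset.mul_sum, Finset.mul_sum, Finset.mul_sum]
    refine Finset.sum_congr rfl fun D _ => by ring

/-- A bootstrap: with 4θ ≤ 1/2 the relative error first shows that the average is bounded by M, and
then θ small against η/M makes the same error at most η/4. -/
theorem RatiosConjecture.abs_zeroAvg_circleKernel_sub_le (hq : Odd (Fintype.card F))
    (hratios : RatiosConjecture F) {ε η : ℝ} (hε : 0 < ε) (hη : 0 < η) :
    ∀ᶠ g : ℕ in atTop, ∀ τ : ℝ, |zeroAvg F g (circleKernel g ε τ) -
      (1 + (logDerivMain F g (circlePoint g ε τ)).re / g)| ≤ η := by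
  obtain ⟨C, hC, hCg⟩ := exists_norm_logDerivMain_le (F := F) hε
  set M := 2 * (1 + C + η) with hM
  have hMpos : 0 < M := by positivity
  set θ := min (1 / 8) (η / (16 * M)) with hθ
  have hθ0 : 0 < θ := by rw [hθ]; positivity
  have hθ8 : θ ≤ 1 / 8 := min_le_left _ _
  filter_upwards [hCg, hratios.abs_poissonAvg_sub_le hq hε (half_pos hη),
    hratios.abs_poissonAvg_sub_zeroAvg_le hq hε (κ := η / 4) hθ0 (by linarith) (by positivity),
    eventually_ge_atTop 1] with g h1 h2 h3 hg1 τ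
  have hg0 : (0 : ℝ) < g := by exact_mod_cast hg1
  have hn := norm_circlePoint g ε τ
  have k1 := h1 _ hn
  have k2 := h2 _ hn
  have k3 := h3 τ
  set y := circlePoint g ε τ
  set T := zeroAvg F g (circleKernel g ε τ)
  have hm : |(logDerivMain F g y).re / g| ≤ C := by
    rw [abs_div, abs_of_pos hg0, div_le_iff₀ hg0]
    exact (Complex.abs_re_le_norm _).trans k1
  have hT0 : 0 ≤ T := by
    have := norm_zeroAvg_le (F := F) g (φ := fun _ => (0 : ℝ)) (w := circleKernel g ε τ)
      fun x _ => by rw [norm_zero]; exact circleKernel_nonneg g hε.le τ x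
    exact (norm_nonneg _).trans this
  have hTM : T ≤ M := by
    have := abs_le.1 k3
    have := abs_le.1 k2
    have := abs_le.1 hm
    nlinarith
  have hθT : 4 * θ * T ≤ η / 4 := by
    calc 4 * θ * T ≤ 4 * (η / (16 * M)) * M := by gcongr; exact min_le_right _ _
      _ = η / 4 := by field_simp; norm_num
  have a1 := abs_le.1 k3
  have a2 := abs_le.1 k2
  rw [abs_le]
  constructor <;> linarith

end ZeroAverage

end HyperellipticEnsemble

namespace HyperellipticEnsemble

/-! ### Limits as g → ∞ and then as the width ε → 0. -/

section Limits

variable {F : Type*} [Field F] [Fintype F]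

theorem tendsto_nat_mul_one_sub_exp (w : ℂ) :
    Tendsto (fun g : ℕ => (g : ℂ) * (1 - Complex.exp (-(w / g)))) atTop (𝓝 w) := by
  have hd : HasDerivAt (fun t : ℝ => -Complex.exp (-w * t)) w 0 := by
    refine ((hasDerivAt_exp_mul (-w) ((0 : ℝ) : ℂ)).comp_ofReal).neg.congr_deriv ?_
    simp
  have h := hd.tendsto_slope_zero_right.comp
    (tendsto_inv_atTop_nhdsGT_zero.comp (tendsto_natCast_atTop_atTop (R := ℝ)))
  refine h.congr fun g => ?_
  simp only [Function.comp_apply, inv_inv, zero_add, Complex.real_smul, Complex.ofReal_inv,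
    Complex.ofReal_natCast, Complex.ofReal_zero, mul_zero, Complex.exp_zero]
  rw [neg_mul, ← div_eq_mul_inv]
  ring

theorem tendsto_exp_neg_div_nat (w : ℂ) :
    Tendsto (fun g : ℕ => Complex.exp (-(w / g))) atTop (𝓝 1) := by
  have h := (Complex.continuous_exp.tendsto (-0)).comp
    (tendsto_const_div_atTop_nhds_zero_nat w).neg
  simpa [Function.comp_def] using h

/-- The limit of the smoothed one-level density. -/
noncomputable def limitDensity (ε τ : ℝ) : ℝ :=
  1 + ((Complex.exp (-(2 * Real.pi * (ε - τ * Complex.I))) - 1) /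
    (2 * Real.pi * (ε - τ * Complex.I))).re

theorem re_two_pi_mul (ε τ : ℝ) : (2 * Real.pi * (ε - τ * Complex.I) : ℂ).re =
    2 * Real.pi * ε := by
  simp

theorem two_pi_mul_ne_zero {ε : ℝ} (hε : 0 < ε) (τ : ℝ) :
    (2 * Real.pi * (ε - τ * Complex.I) : ℂ) ≠ 0 := fun h => by
  have h1 := re_two_pi_mul ε τ
  rw [h, Complex.zero_re] at h1
  have := Real.pi_pos
  have : 0 < 2 * Real.pi * ε := by positivity
  linarith

theorem norm_exp_neg_sub_one_div_le {w : ℂ} (hw : 0 ≤ w.re) :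
    ‖(Complex.exp (-w) - 1) / w‖ ≤ 2 := by
  rcases eq_or_ne w 0 with rfl | h0
  · simp
  rw [norm_div, div_le_iff₀ (norm_pos_iff.2 h0)]
  rcases le_total ‖w‖ 1 with h | h
  · have := Complex.norm_exp_sub_one_le (x := -w) (by rwa [norm_neg])
    rwa [norm_neg] at this
  · refine (norm_sub_le _ _).trans ?_
    rw [Complex.norm_exp, norm_one, Complex.neg_re]
    have : Real.exp (-w.re) ≤ 1 := Real.exp_le_one_iff.2 (by linarith)
    linarith

theorem abs_limitDensity_le {ε : ℝ} (hε : 0 ≤ ε) (τ : ℝ) : |limitDensity ε τ| ≤ 3 := by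
  have hπ := Real.pi_pos
  have h := (Complex.abs_re_le_norm _).trans (norm_exp_neg_sub_one_div_le
    (w := 2 * Real.pi * (ε - τ * Complex.I)) (by rw [re_two_pi_mul]; positivity))
  rw [limitDensity]
  refine (abs_add_le _ _).trans ?_
  rw [abs_one]
  linarith

theorem continuous_limitDensity {ε : ℝ} (hε : 0 < ε) : Continuous (limitDensity ε) := by
  unfold limitDensity
  refine continuous_const.add (Complex.continuous_re.comp (Continuous.div (by fun_prop)
    (by fun_prop) fun τ => two_pi_mul_ne_zero hε τ))

theorem limitDensity_zero {τ : ℝ} (hτ : τ ≠ 0) :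
    limitDensity 0 τ = 1 - Real.sin (2 * Real.pi * τ) / (2 * Real.pi * τ) := by
  have hπ := Real.pi_ne_zero
  have hθ : (2 * Real.pi * τ : ℝ) ≠ 0 := by positivity
  have e : ((Complex.exp (-(2 * Real.pi * ((0 : ℝ) - τ * Complex.I))) - 1) /
      (2 * Real.pi * ((0 : ℝ) - τ * Complex.I))) =
      ((-(Real.sin (2 * Real.pi * τ) / (2 * Real.pi * τ)) : ℝ) : ℂ) +
        (((Real.cos (2 * Real.pi * τ) - 1) / (2 * Real.pi * τ) : ℝ) : ℂ) * Complex.I := by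
    rw [show -(2 * Real.pi * ((0 : ℝ) - τ * Complex.I) : ℂ) =
      ((2 * Real.pi * τ : ℝ) : ℂ) * Complex.I by push_cast; ring,
      show (2 * Real.pi * ((0 : ℝ) - τ * Complex.I) : ℂ) =
      -(((2 * Real.pi * τ : ℝ) : ℂ) * Complex.I) by push_cast; ring, Complex.exp_mul_I]
    generalize 2 * Real.pi * τ = θ at hθ
    have hθ' : (θ : ℂ) ≠ 0 := by exact_mod_cast hθ
    have hI := Complex.I_ne_zero
    push_cast
    field_simp
    ring_nf
    rw [Complex.I_sq]
    ring
  rw [limitDensity, e, Complex.add_re, Complex.ofReal_re, Complex.re_ofReal_mul, Complex.I_re]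
  ring

theorem tendsto_limitDensity {τ : ℝ} (hτ : τ ≠ 0) :
    Tendsto (fun ε => limitDensity ε τ) (𝓝[>] 0)
      (𝓝 (1 - Real.sin (2 * Real.pi * τ) / (2 * Real.pi * τ))) := by
  rw [← limitDensity_zero hτ]
  have hπ := Real.pi_ne_zero
  have h : ContinuousAt (fun ε => limitDensity ε τ) 0 := by
    unfold limitDensity
    refine continuousAt_const.add (Complex.continuous_re.continuousAt.comp
      (ContinuousAt.div (by fun_prop) (by fun_prop) ?_))
    simp [hτ, hπ, Complex.I_ne_zero]
  exact h.tendsto.mono_left nhdsWithin_le_nhds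

/-- At these points y² = exp(-w/g) and y^(2g) = exp(-w). The Euler product tends to 1, the
arithmetic sum disappears after division by g, and g(1 - y²) tends to w. -/
theorem tendsto_logDerivMain_circlePoint {ε : ℝ} (hε : 0 < ε) (τ : ℝ) :
    Tendsto (fun g : ℕ => 1 + (logDerivMain F g (circlePoint g ε τ)).re / g) atTop
      (𝓝 (limitDensity ε τ)) := by
  set w : ℂ := 2 * Real.pi * (ε - τ * Complex.I) with hw
  have hw0 : w ≠ 0 := two_pi_mul_ne_zero hε τ
  have hx := tendsto_exp_neg_div_nat w
  have hq1 := one_lt_cardReal (F := F)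
  have ha : Tendsto (fun g : ℕ => arithSum F (Complex.exp (-(w / g)))) atTop (𝓝 (arithSum F 1)) :=
    ((differentiableOn_arithSum.differentiableAt ((isOpen_lt continuous_norm
      continuous_const).mem_nhds (by simpa using hq1))).continuousAt.tendsto).comp hx
  have hE : Tendsto (fun g : ℕ => eulerProd F (Complex.exp (-(w / g)))⁻¹ 1) atTop (𝓝 1) := by
    have h := ((differentiableOn_pow_mul_eulerProd (F := F) 0).differentiableAt
      (isOpen_inv_lt.mem_nhds (x := (1 : ℂ)) ⟨one_ne_zero, by
        simpa using hq1⟩)).continuousAt.tendsto.comp hx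
    simpa [Function.comp_def, eulerProd_self] using h
  have hinv : Tendsto (fun g : ℕ => (g : ℂ)⁻¹) atTop (𝓝 0) :=
    tendsto_inv_atTop_nhds_zero_nat (𝕜 := ℂ)
  have h1 : Tendsto (fun g : ℕ => arithSum F (Complex.exp (-(w / g))) * (g : ℂ)⁻¹ +
      Complex.exp (-(w / g)) / ((g : ℂ) * (1 - Complex.exp (-(w / g)))) *
        (Complex.exp (-w) * eulerProd F (Complex.exp (-(w / g)))⁻¹ 1 - 1)) atTop
      (𝓝 (arithSum F 1 * 0 + 1 / w * (Complex.exp (-w) * 1 - 1))) :=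
    (ha.mul hinv).add ((hx.div (tendsto_nat_mul_one_sub_exp w) hw0).mul
      ((hE.const_mul _).sub_const 1))
  have h2 : Tendsto (fun g : ℕ => logDerivMain F g (circlePoint g ε τ) / g) atTop
      (𝓝 ((Complex.exp (-w) - 1) / w)) := by
    have e : arithSum F 1 * 0 + 1 / w * (Complex.exp (-w) * 1 - 1) =
        (Complex.exp (-w) - 1) / w := by
      ring
    rw [← e]
    refine h1.congr' ?_
    filter_upwards [eventually_ge_atTop 1] with g hg
    have hg0 : (g : ℂ) ≠ 0 := by exact_mod_cast (by omega : g ≠ 0)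
    have e1 : circlePoint g ε τ ^ 2 = Complex.exp (-(w / g)) := by
      rw [circlePoint, ← hw, exp_neg_sq]
      congr 2
      field_simp
    have e2 : circlePoint g ε τ ^ (2 * g) = Complex.exp (-w) := by
      rw [pow_mul, e1, ← Complex.exp_nat_mul]
      congr 1
      field_simp
    rw [logDerivMain, e2, inv_pow, e1]
    simp only [div_eq_mul_inv, mul_inv]
    ring
  have h3 := ((Complex.continuous_re.tendsto _).comp h2).const_add 1
  rw [limitDensity]
  refine h3.congr fun g => ?_
  simp only [Function.comp_apply]
  rw [← Complex.ofReal_natCast, Complex.div_ofReal_re]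

theorem RatiosConjecture.tendsto_zeroAvg_circleKernel (hq : Odd (Fintype.card F))
    (hratios : RatiosConjecture F) {ε : ℝ} (hε : 0 < ε) (τ : ℝ) :
    Tendsto (fun g : ℕ => zeroAvg F g (circleKernel g ε τ)) atTop (𝓝 (limitDensity ε τ)) := by
  have h : Tendsto (fun g : ℕ => zeroAvg F g (circleKernel g ε τ) -
      (1 + (logDerivMain F g (circlePoint g ε τ)).re / g)) atTop (𝓝 0) := by
    rw [Metric.tendsto_nhds]
    intro η hη
    filter_upwards [hratios.abs_zeroAvg_circleKernel_sub_le hq hε (half_pos hη)] with g hg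
    rw [dist_zero_right, Real.norm_eq_abs]
    exact (hg τ).trans_lt (half_lt_self hη)
  simpa using h.add (tendsto_logDerivMain_circlePoint (F := F) hε τ)

theorem RatiosConjecture.exists_abs_zeroAvg_circleKernel_le (hq : Odd (Fintype.card F))
    (hratios : RatiosConjecture F) {ε : ℝ} (hε : 0 < ε) :
    ∃ C : ℝ, ∀ᶠ g : ℕ in atTop, ∀ τ : ℝ, |zeroAvg F g (circleKernel g ε τ)| ≤ C := by
  obtain ⟨C, hC, hCg⟩ := exists_norm_logDerivMain_le (F := F) hε
  refine ⟨2 + C, ?_⟩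
  filter_upwards [hCg, hratios.abs_zeroAvg_circleKernel_sub_le hq hε one_pos,
    eventually_ge_atTop 1] with g h1 h2 hg1 τ
  have hg0 : (0 : ℝ) < g := by exact_mod_cast hg1
  have hm : |(logDerivMain F g (circlePoint g ε τ)).re / g| ≤ C := by
    rw [abs_div, abs_of_pos hg0, div_le_iff₀ hg0]
    exact (Complex.abs_re_le_norm _).trans (h1 _ (norm_circlePoint g ε τ))
  have a1 := abs_le.1 (h2 τ)
  have a2 := abs_le.1 hm
  rw [abs_le]
  constructor <;> linarith

/-- The circle kernel of width R dominates 1/(4π) times this weight, and its average tends to at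
most 3, hence is eventually below 4; finally 4 · 4π ≤ 64. The bound does not depend on R: R = 1
serves for the smoothing error and large R for the tails. -/
theorem RatiosConjecture.zeroAvg_cauchy_le (hq : Odd (Fintype.card F))
    (hratios : RatiosConjecture F) {R : ℝ} (hR : 0 < R) :
    ∀ᶠ g : ℕ in atTop, zeroAvg F g (fun x => R / (R ^ 2 + x ^ 2)) ≤ 64 := by
  have hπ := Real.pi_pos
  filter_upwards [(hratios.tendsto_zeroAvg_circleKernel hq hR 0).eventually (gt_mem_nhds
    (((le_abs_self _).trans (abs_limitDensity_le hR.le 0)).trans_lt (by norm_num :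
      (3 : ℝ) < 4))), eventually_ge_atTop 1,
    (tendsto_natCast_atTop_atTop (R := ℝ)).eventually_ge_atTop (Real.pi * R)] with g h1 hg1 hg2
  have h2 : zeroAvg F g (fun x => 1 / (4 * Real.pi) * (R / (R ^ 2 + x ^ 2))) ≤
      zeroAvg F g (circleKernel g R 0) := by
    refine (Real.le_norm_self _).trans (norm_zeroAvg_le g fun x _ => ?_)
    rw [Real.norm_of_nonneg (by positivity)]
    simpa using circleKernel_ge hg1 hR hg2 0 x
  rw [zeroAvg_const_mul, one_div, inv_mul_le_iff₀ (by positivity)] at h2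
  have := Real.pi_le_four
  nlinarith

theorem continuous_zeroAvg_circleKernel {g : ℕ} (hg : 0 < g) {ε : ℝ} (hε : 0 < ε) :
    Continuous fun τ => zeroAvg F g (circleKernel g ε τ) := by
  simp only [zeroAvg, smul_eq_mul]
  refine continuous_const.mul (continuous_finsetSum _ fun D _ => ?_)
  exact continuous_multiset_sum (f := fun (v : ℂ) τ => circleKernel g ε τ (g / Real.pi * v.arg)) _
    fun v _ => continuous_circleKernel hg hε _

theorem RatiosConjecture.tendsto_integral_zeroAvg (hq : Odd (Fintype.card F))
    (hratios : RatiosConjecture F) {ε : ℝ} (hε : 0 < ε) {h : ℝ → ℂ}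
    (hh : MeasureTheory.Integrable h) :
    Tendsto (fun g : ℕ => ∫ τ, h τ * ((zeroAvg F g (circleKernel g ε τ) : ℝ) : ℂ)) atTop
      (𝓝 (∫ τ, h τ * (limitDensity ε τ : ℂ))) := by
  obtain ⟨C, hC⟩ := hratios.exists_abs_zeroAvg_circleKernel_le hq hε
  refine MeasureTheory.tendsto_integral_filter_of_dominated_convergence (fun τ => ‖h τ‖ * C) ?_ ?_
    (hh.norm.mul_const C) (Eventually.of_forall fun τ => ?_)
  · filter_upwards [eventually_ge_atTop 1] with g hg
    exact hh.aestronglyMeasurable.mul (Complex.continuous_ofReal.comp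
      (continuous_zeroAvg_circleKernel hg hε)).aestronglyMeasurable
  · filter_upwards [hC] with g hg
    refine Eventually.of_forall fun τ => ?_
    rw [norm_mul, Complex.norm_real, Real.norm_eq_abs]
    exact mul_le_mul_of_nonneg_left (hg τ) (norm_nonneg _)
  · exact ((Complex.continuous_ofReal.tendsto _).comp
      (hratios.tendsto_zeroAvg_circleKernel hq hε τ)).const_mul _

theorem ae_ne_zero : ∀ᵐ τ : ℝ, τ ≠ 0 := by
  simpa using (Set.countable_singleton (0 : ℝ)).ae_notMem MeasureTheory.volume

theorem tendsto_integral_limitDensity {h : ℝ → ℂ} (hh : MeasureTheory.Integrable h) :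
    Tendsto (fun ε : ℝ => ∫ τ, h τ * (limitDensity ε τ : ℂ)) (𝓝[>] 0)
      (𝓝 (∫ τ, h τ * ((1 - Real.sin (2 * Real.pi * τ) / (2 * Real.pi * τ) : ℝ) : ℂ))) := by
  refine MeasureTheory.tendsto_integral_filter_of_dominated_convergence (fun τ => ‖h τ‖ * 3) ?_ ?_
    (hh.norm.mul_const 3) ?_
  · filter_upwards [self_mem_nhdsWithin] with ε hε
    exact hh.aestronglyMeasurable.mul (Complex.continuous_ofReal.comp
      (continuous_limitDensity hε)).aestronglyMeasurable
  · filter_upwards [self_mem_nhdsWithin] with ε hε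
    refine Eventually.of_forall fun τ => ?_
    rw [norm_mul, Complex.norm_real, Real.norm_eq_abs]
    exact mul_le_mul_of_nonneg_left (abs_limitDensity_le (le_of_lt hε) τ) (norm_nonneg _)
  · filter_upwards [ae_ne_zero] with τ hτ
    exact ((Complex.continuous_ofReal.tendsto _).comp (tendsto_limitDensity hτ)).const_mul _

end Limits

end HyperellipticEnsemble

namespace HyperellipticEnsemble

/-! ### Removing the smoothing and the truncation. -/

section Smoothing

open MeasureTheory

variable {F : Type*} [Field F] [Fintype F]

theorem integral_inv_one_add_sub_sq_le {a b : ℝ} (hab : a ≤ b) (x : ℝ) :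
    ∫ τ in a..b, (1 + (x - τ) ^ 2)⁻¹ ≤ 4 := by
  have hi : Integrable fun τ : ℝ => (1 + (x - τ) ^ 2)⁻¹ :=
    integrable_inv_one_add_sq.comp_sub_left x
  rw [intervalIntegral.integral_of_le hab]
  refine (setIntegral_le_integral hi (Eventually.of_forall fun τ => by positivity)).trans ?_
  rw [integral_sub_left_eq_self (fun u : ℝ => (1 + u ^ 2)⁻¹) volume x,
    integral_univ_inv_one_add_sq]
  exact Real.pi_le_four

/-- An approximate identity: uniform continuity handles |x - τ| < d, and elsewhere the kernel is
O(ε/(x - τ)²). The support of h lies in one period, so the integral over the line is one over [-g,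
g], where the kernel has mass 1. -/
theorem norm_sub_integral_circleKernel_le_of_abs_le {h : ℝ → ℂ} (hc : Continuous h) {T M η d ε : ℝ}
    (hT : 1 ≤ T) (hsupp : ∀ x, T < |x| → h x = 0) (hM : ∀ x, ‖h x‖ ≤ M) (hη : 0 ≤ η)
    (hd0 : 0 < d) (hd1 : d ≤ 1) (hd : ∀ x τ, |x - τ| < d → ‖h x - h τ‖ ≤ η) (hε : 0 < ε)
    {g : ℕ} (hgT : 4 * T ≤ g) (hgε : 2 * Real.pi * ε ≤ g) {x : ℝ} (hx : |x| ≤ 2 * T) :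
    ‖h x - ∫ τ, h τ * (circleKernel g ε τ x : ℂ)‖ ≤ η + 256 * M * ε / d ^ 2 := by
  have hg0' : (0 : ℝ) < g := by linarith
  have hg0 : 0 < g := by exact_mod_cast hg0'
  have hM0 : 0 ≤ M := (norm_nonneg _).trans (hM 0)
  have hKc := continuous_circleKernel hg0 hε x
  have hKc' : Continuous fun τ => (circleKernel g ε τ x : ℂ) := Complex.continuous_ofReal.comp hKc
  have hsub : Function.support (fun τ => h τ * (circleKernel g ε τ x : ℂ)) ⊆
      Set.Ioc (-(g : ℝ)) g := fun τ hτ => by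
    have h1 : h τ ≠ 0 := left_ne_zero_of_mul hτ
    have h2 : |τ| ≤ T := not_lt.1 fun h3 => h1 (hsupp τ h3)
    have h3 := abs_le.1 h2
    constructor <;> linarith
  have hmass : ∫ τ in (-(g : ℝ))..g, h x * (circleKernel g ε τ x : ℂ) = h x := by
    rw [intervalIntegral.integral_const_mul, intervalIntegral.integral_ofReal,
      integral_circleKernel hg0 hε, Complex.ofReal_one, mul_one]
  have e : h x - ∫ τ, h τ * (circleKernel g ε τ x : ℂ) =
      ∫ τ in (-(g : ℝ))..g, (h x - h τ) * (circleKernel g ε τ x : ℂ) := by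
    rw [← intervalIntegral.integral_eq_integral_of_support_subset hsub]
    conv_lhs => rw [← hmass]
    rw [← intervalIntegral.integral_sub]
    · simp only [sub_mul]
    · exact (continuous_const.mul hKc').intervalIntegrable _ _
    · exact (hc.mul hKc').intervalIntegrable _ _
  have hcauchy : Continuous fun τ : ℝ => (1 + (x - τ) ^ 2)⁻¹ :=
    Continuous.inv₀ (by fun_prop) fun τ => by positivity
  have hgg : -(g : ℝ) ≤ g := by linarith
  rw [e]
  calc ‖∫ τ in (-(g : ℝ))..g, (h x - h τ) * (circleKernel g ε τ x : ℂ)‖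
      ≤ ∫ τ in (-(g : ℝ))..g, (η * circleKernel g ε τ x +
          64 * M * ε / d ^ 2 * (1 + (x - τ) ^ 2)⁻¹) := by
        refine intervalIntegral.norm_integral_le_of_norm_le hgg
          (Eventually.of_forall fun τ hτ => ?_)
          (((hKc.const_mul η).add (hcauchy.const_mul _)).intervalIntegrable _ _)
        have hK0 := circleKernel_nonneg g hε.le τ x
        rw [norm_mul, Complex.norm_real, Real.norm_of_nonneg hK0]
        rcases lt_or_ge |x - τ| d with h1 | h1
        · have := mul_le_mul_of_nonneg_right (hd x τ h1) hK0
          have h2 : 0 ≤ 64 * M * ε / d ^ 2 * (1 + (x - τ) ^ 2)⁻¹ := by positivity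
          linarith
        · have hne : x ≠ τ := fun h2 => by
            rw [h2, sub_self, abs_zero] at h1; linarith
          have hsq : d ^ 2 ≤ (x - τ) ^ 2 := by
            rw [← sq_abs (x - τ)]; exact pow_le_pow_left₀ hd0.le h1 2
          have hK := circleKernel_le hg0 hε hgε (x := x) (τ := τ) (by
            have := abs_sub x τ
            have : |τ| ≤ g := abs_le.2 ⟨hτ.1.le, hτ.2⟩
            linarith) hne
          have h2 : ‖h x - h τ‖ ≤ 2 * M := (norm_sub_le _ _).trans (by
            linarith [hM x, hM τ])
          -- Since d ≤ 1 and d ≤ |x - τ|, one has d²(1 + (x - τ)²) ≤ 2(x - τ)².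
          have h3 : 16 * ε / (x - τ) ^ 2 ≤ 32 * ε / d ^ 2 * (1 + (x - τ) ^ 2)⁻¹ := by
            rw [← div_eq_mul_inv, div_div, div_le_div_iff₀ (by positivity) (by positivity)]
            have : d ^ 2 * (x - τ) ^ 2 ≤ 1 * (x - τ) ^ 2 := by
              gcongr
              exact pow_le_one₀ hd0.le hd1
            nlinarith
          have h4 : 0 ≤ η * circleKernel g ε τ x := by positivity
          calc _ ≤ 2 * M * (32 * ε / d ^ 2 * (1 + (x - τ) ^ 2)⁻¹) := by
                gcongr; exact hK.trans h3
            _ = 64 * M * ε / d ^ 2 * (1 + (x - τ) ^ 2)⁻¹ := by ring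
            _ ≤ _ := by linarith
    _ = η + 64 * M * ε / d ^ 2 * ∫ τ in (-(g : ℝ))..g, (1 + (x - τ) ^ 2)⁻¹ := by
        rw [intervalIntegral.integral_add ((hKc.const_mul η).intervalIntegrable _ _)
          ((hcauchy.const_mul _).intervalIntegrable _ _), intervalIntegral.integral_const_mul,
          intervalIntegral.integral_const_mul, integral_circleKernel hg0 hε, mul_one]
    _ ≤ η + 64 * M * ε / d ^ 2 * 4 := by
        gcongr
        exact integral_inv_one_add_sub_sq_le hgg x
    _ = _ := by ring

theorem norm_sub_integral_circleKernel_le_of_lt_abs {h : ℝ → ℂ} (hi : Integrable h) {T ε : ℝ}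
    (hT : 1 ≤ T) (hsupp : ∀ x, T < |x| → h x = 0) (hε : 0 < ε) {g : ℕ} (hgT : 4 * T ≤ g)
    (hgε : 2 * Real.pi * ε ≤ g) {x : ℝ} (hx : 2 * T < |x|) (hxg : |x| ≤ g) :
    ‖h x - ∫ τ, h τ * (circleKernel g ε τ x : ℂ)‖ ≤ 64 * ε / x ^ 2 * ∫ τ, ‖h τ‖ := by
  have hg0' : (0 : ℝ) < g := by linarith
  have hg0 : 0 < g := by exact_mod_cast hg0'
  rw [hsupp x (by linarith), zero_sub, norm_neg, ← integral_const_mul]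
  refine norm_integral_le_of_norm_le (hi.norm.const_mul _) (Eventually.of_forall fun τ => ?_)
  rcases lt_or_ge T |τ| with h1 | h1
  · simp [hsupp τ h1]
  · rw [norm_mul, Complex.norm_real, Real.norm_of_nonneg (circleKernel_nonneg g hε.le τ x), mul_comm]
    have h2 : |x| / 2 ≤ |x - τ| := by
      have := abs_sub_abs_le_abs_sub x τ
      linarith
    have hx0 : 0 < |x| := by linarith
    have hne : x ≠ τ := fun h3 => by
      rw [h3, sub_self, abs_zero, ← h3] at h2; linarith
    have h3 := circleKernel_le hg0 hε hgε (x := x) (τ := τ) (by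
      have := abs_sub x τ
      linarith) hne
    have h4 : (|x| / 2) ^ 2 ≤ (x - τ) ^ 2 := by
      rw [← sq_abs (x - τ)]; exact pow_le_pow_left₀ (by positivity) h2 2
    rw [div_pow, sq_abs] at h4
    have hx2 : 0 < x ^ 2 := by rw [← sq_abs]; positivity
    gcongr
    calc circleKernel g ε τ x ≤ 16 * ε / (x - τ) ^ 2 := h3
      _ ≤ 16 * ε / (x ^ 2 / 2 ^ 2) := by gcongr
      _ = 64 * ε / x ^ 2 := by field_simp; norm_num

theorem hasCompactSupport_of_eq_zero {h : ℝ → ℂ} {T : ℝ} (hsupp : ∀ x, T < |x| → h x = 0) :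
    HasCompactSupport h :=
  HasCompactSupport.intro (isCompact_closedBall (0 : ℝ) T) fun x hx => hsupp x (by
    simpa using hx)

/-- The decay in x is the point: a uniform error would be summed over 2g zeros, while the weight
1/(1 + x²) has bounded average by `RatiosConjecture.zeroAvg_cauchy_le`. -/
theorem exists_norm_sub_integral_circleKernel_le {h : ℝ → ℂ} (hc : Continuous h) {T : ℝ}
    (hT : 1 ≤ T) (hsupp : ∀ x, T < |x| → h x = 0) {η : ℝ} (hη : 0 < η) :
    ∃ ε₀ > (0 : ℝ), ∀ ε, 0 < ε → ε ≤ ε₀ → ∀ᶠ g : ℕ in atTop, ∀ x : ℝ, |x| ≤ g →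
      ‖h x - ∫ τ, h τ * (circleKernel g ε τ x : ℂ)‖ ≤ η * (1 / (1 ^ 2 + x ^ 2)) := by
  have hcs := hasCompactSupport_of_eq_zero hsupp
  obtain ⟨M, hM⟩ := hcs.exists_bound_of_continuous hc
  have hM0 : 0 ≤ M := (norm_nonneg _).trans (hM 0)
  have hi := hc.integrable_of_hasCompactSupport (μ := volume) hcs
  have hI : 0 ≤ ∫ τ, ‖h τ‖ := integral_nonneg fun τ => norm_nonneg _
  have hη' : 0 < η / (2 * (1 + 4 * T ^ 2)) := by positivity
  obtain ⟨d, hd0, hd⟩ := Metric.uniformContinuous_iff.1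
    (hcs.uniformContinuous_of_continuous hc) _ hη'
  set d' := min d 1 with hd'
  have hd'0 : 0 < d' := by rw [hd']; positivity
  set B := 256 * M / d' ^ 2 * (1 + 4 * T ^ 2) + 128 * ∫ τ, ‖h τ‖ with hB
  have hB0 : 0 ≤ B := by positivity
  refine ⟨η / (2 * (B + 1)), by positivity, fun ε hε hε₀ => ?_⟩
  have hεB : ε * B ≤ η / 2 := by
    calc ε * B ≤ η / (2 * (B + 1)) * (B + 1) := by gcongr; linarith
      _ = η / 2 := by field_simp
  filter_upwards [(tendsto_natCast_atTop_atTop (R := ℝ)).eventually_ge_atTop (4 * T),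
    (tendsto_natCast_atTop_atTop (R := ℝ)).eventually_ge_atTop (2 * Real.pi * ε)] with g h1 h2 x hx
  rw [mul_one_div, le_div_iff₀ (by positivity), one_pow]
  rcases le_or_gt |x| (2 * T) with h3 | h3
  · have k := norm_sub_integral_circleKernel_le_of_abs_le hc hT hsupp hM hη'.le hd'0
      (min_le_right _ _) (fun x τ hxτ => by
        have := hd (show dist x τ < d from hxτ.trans_le (min_le_left _ _))
        rw [dist_eq_norm] at this
        exact this.le) hε h1 h2 h3
    have hx2 : x ^ 2 ≤ 4 * T ^ 2 := by
      rw [← sq_abs]; nlinarith [abs_nonneg x]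
    calc _ ≤ (η / (2 * (1 + 4 * T ^ 2)) + 256 * M * ε / d' ^ 2) * (1 + 4 * T ^ 2) := by gcongr
      _ = η / 2 + ε * (256 * M / d' ^ 2 * (1 + 4 * T ^ 2)) := by field_simp
      _ ≤ η / 2 + ε * B := by gcongr; rw [hB]; linarith
      _ ≤ η := by linarith
  · have k := norm_sub_integral_circleKernel_le_of_lt_abs hi hT hsupp hε h1 h2 h3 hx
    have hx1 : 1 ≤ x ^ 2 := by
      rw [← sq_abs]; nlinarith [abs_nonneg x]
    have hx0 : 0 < x ^ 2 := by linarith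
    have hxne : x ≠ 0 := by rintro rfl; norm_num at hx1
    calc _ ≤ 64 * ε / x ^ 2 * (∫ τ, ‖h τ‖) * (x ^ 2 + x ^ 2) := by gcongr
      _ = ε * (128 * ∫ τ, ‖h τ‖) := by field_simp; ring
      _ ≤ ε * B := by
        gcongr
        rw [hB]
        have : 0 ≤ 256 * M / d' ^ 2 * (1 + 4 * T ^ 2) := by positivity
        linarith
      _ ≤ η := by linarith

theorem mul_ofReal_multiset_sum (c : ℂ) (s : Multiset ℂ) (f : ℂ → ℝ) :
    c * (((s.map f).sum : ℝ) : ℂ) = (s.map fun v => c * (f v : ℂ)).sum := by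
  induction s using Multiset.induction_on with
  | empty => simp
  | cons a s ih => simp [mul_add, ih]

theorem integrable_multiset_sum_map {s : Multiset ℂ} {f : ℂ → ℝ → ℂ}
    (hf : ∀ v, Integrable (f v)) : Integrable fun τ => (s.map fun v => f v τ).sum := by
  induction s using Multiset.induction_on with
  | empty => simp
  | cons a s ih =>
    simp only [Multiset.map_cons, Multiset.sum_cons]
    exact (hf a).add ih

theorem integral_multiset_sum_map {s : Multiset ℂ} {f : ℂ → ℝ → ℂ}
    (hf : ∀ v, Integrable (f v)) :
    ∫ τ, (s.map fun v => f v τ).sum = (s.map fun v => ∫ τ, f v τ).sum := by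
  induction s using Multiset.induction_on with
  | empty => simp
  | cons a s ih =>
    simp only [Multiset.map_cons, Multiset.sum_cons]
    rw [integral_add (hf a) (integrable_multiset_sum_map hf), ih]

theorem integral_mul_zeroAvg {h : ℝ → ℂ} (hc : Continuous h) (hcs : HasCompactSupport h) {g : ℕ}
    (hg : 0 < g) {ε : ℝ} (hε : 0 < ε) :
    ∫ τ, h τ * ((zeroAvg F g (circleKernel g ε τ) : ℝ) : ℂ) =
      zeroAvg F g fun x => ∫ τ, h τ * (circleKernel g ε τ x : ℂ) := by
  have hint : ∀ x, Integrable fun τ => h τ * (circleKernel g ε τ x : ℂ) := fun x =>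
    (hc.mul (Complex.continuous_ofReal.comp
      (continuous_circleKernel hg hε x))).integrable_of_hasCompactSupport hcs.mul_right
  have e : ∀ τ, h τ * ((zeroAvg F g (circleKernel g ε τ) : ℝ) : ℂ) =
      ((ensemble F g).card : ℝ)⁻¹ • ∑ D ∈ ensemble F g, ((normLPoly D).roots.map fun v =>
        h τ * (circleKernel g ε τ (g / Real.pi * v.arg) : ℂ)).sum := by
    intro τ
    rw [zeroAvg, smul_eq_mul, Complex.ofReal_mul, Complex.ofReal_sum, mul_left_comm,
      Finset.mul_sum, Complex.real_smul]
    simp only [mul_ofReal_multiset_sum]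
  simp only [e]
  rw [integral_smul, integral_finsetSum, zeroAvg]
  · congr 1
    refine Finset.sum_congr rfl fun D _ => ?_
    exact integral_multiset_sum_map (f := fun v τ =>
      h τ * (circleKernel g ε τ (g / Real.pi * v.arg) : ℂ)) fun v => hint _
  · exact fun D _ => integrable_multiset_sum_map (f := fun v τ =>
      h τ * (circleKernel g ε τ (g / Real.pi * v.arg) : ℂ)) fun v => hint _

/-- The width ε is fixed first, so small that smoothing h and replacing the smoothed density by its
limit both cost little. Only then does g tend to infinity. -/
theorem RatiosConjecture.tendsto_zeroAvg_of_eq_zero (hq : Odd (Fintype.card F))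
    (hratios : RatiosConjecture F) {h : ℝ → ℂ} (hc : Continuous h) {T : ℝ} (hT : 1 ≤ T)
    (hsupp : ∀ x, T < |x| → h x = 0) :
    Tendsto (fun g : ℕ => zeroAvg F g h) atTop
      (𝓝 (∫ τ, h τ * ((1 - Real.sin (2 * Real.pi * τ) / (2 * Real.pi * τ) : ℝ) : ℂ))) := by
  have hcs := hasCompactSupport_of_eq_zero hsupp
  have hi := hc.integrable_of_hasCompactSupport (μ := volume) hcs
  rw [Metric.tendsto_nhds]
  intro η hη
  -- The Cauchy weight of width 1 has average at most 64, so η/256 becomes η/4.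
  obtain ⟨ε₀, hε₀, hsm⟩ := exists_norm_sub_integral_circleKernel_le hc hT hsupp
    (η := η / 256) (by positivity)
  obtain ⟨ε, hε1, hε, hε2⟩ := ((((tendsto_integral_limitDensity hi).eventually
    (Metric.ball_mem_nhds _ (show 0 < η / 4 by positivity))).and
      (Ioc_mem_nhdsGT hε₀))).exists
  filter_upwards [hsm ε hε hε2, (hratios.tendsto_integral_zeroAvg hq hε hi).eventually
    (Metric.ball_mem_nhds _ (show 0 < η / 4 by positivity)),
    hratios.zeroAvg_cauchy_le hq one_pos, eventually_ge_atTop 1] with g h1 h2 h3 hg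
  rw [integral_mul_zeroAvg hc hcs hg hε] at h2
  have h4 : dist (zeroAvg F g h) (zeroAvg F g fun x =>
      ∫ τ, h τ * (circleKernel g ε τ x : ℂ)) ≤ η / 4 := by
    rw [dist_eq_norm, ← zeroAvg_sub]
    refine (norm_zeroAvg_le g h1).trans ?_
    rw [zeroAvg_const_mul]
    calc _ ≤ η / 256 * 64 := by gcongr
      _ = η / 4 := by ring
  refine (dist_triangle4 _ _ _ _).trans_lt (add_lt_add (add_lt_add_of_le_of_lt h4 h2) hε1
    |>.trans_le ?_)
  linarith

/-- A continuous cutoff function. -/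
noncomputable def cutoff (T x : ℝ) : ℝ := max 0 (min 1 (T + 1 - |x|))

theorem continuous_cutoff (T : ℝ) : Continuous (cutoff T) := by
  unfold cutoff; fun_prop

theorem cutoff_nonneg (T x : ℝ) : 0 ≤ cutoff T x := le_max_left _ _

theorem cutoff_le_one (T x : ℝ) : cutoff T x ≤ 1 := max_le zero_le_one (min_le_left _ _)

theorem cutoff_eq_one {T x : ℝ} (h : |x| ≤ T) : cutoff T x = 1 := by
  rw [cutoff, min_eq_left (by linarith), max_eq_right zero_le_one]

theorem cutoff_eq_zero {T x : ℝ} (h : T + 1 < |x|) : cutoff T x = 0 :=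
  max_eq_left ((min_le_right _ _).trans (by linarith))

theorem norm_cutoff_mul_le (T x : ℝ) (z : ℂ) : ‖(cutoff T x : ℂ) * z‖ ≤ ‖z‖ := by
  rw [norm_mul, Complex.norm_real, Real.norm_of_nonneg (cutoff_nonneg T x)]
  exact mul_le_of_le_one_left (norm_nonneg _) (cutoff_le_one T x)

/-- Where the difference is nonzero, T² < x², so the decay of h is at most 2C/(T² + x²). In terms of
the Cauchy weight of width T this has the small coefficient 2C/T. -/
theorem norm_sub_cutoff_mul_le {h : ℝ → ℂ} {C : ℝ} (hC : ∀ x, ‖h x‖ ≤ C / (1 + x ^ 2)) {T : ℝ}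
    (hT : 0 < T) (x : ℝ) :
    ‖h x - cutoff T x * h x‖ ≤ 2 * C / T * (T / (T ^ 2 + x ^ 2)) := by
  have hC0 : 0 ≤ C := by simpa using (norm_nonneg _).trans (hC 0)
  rcases le_or_gt |x| T with h1 | h1
  · rw [cutoff_eq_one h1, Complex.ofReal_one, one_mul, sub_self, norm_zero]
    positivity
  · have e : h x - cutoff T x * h x = ((1 - cutoff T x : ℝ) : ℂ) * h x := by push_cast; ring
    have hx2 : T ^ 2 ≤ x ^ 2 := by rw [← sq_abs x]; exact pow_le_pow_left₀ hT.le h1.le 2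
    rw [e, norm_mul, Complex.norm_real,
      Real.norm_of_nonneg (sub_nonneg.2 (cutoff_le_one T x))]
    calc _ ≤ 1 * (C / (1 + x ^ 2)) := by
          gcongr
          · linarith [cutoff_nonneg T x]
          · exact hC x
      _ ≤ 2 * C / (T ^ 2 + x ^ 2) := by
          rw [one_mul, div_le_div_iff₀ (by positivity) (by positivity)]
          nlinarith
      _ = _ := by field_simp

theorem abs_one_sub_sinc_le {τ : ℝ} (hτ : τ ≠ 0) :
    |1 - Real.sin (2 * Real.pi * τ) / (2 * Real.pi * τ)| ≤ 3 :=
  limitDensity_zero hτ ▸ abs_limitDensity_le le_rfl τ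

/-- Truncate h at height n. The discarded tail has average at most 128C/n for all large g, and the
truncated integrals converge by domination. -/
theorem RatiosConjecture.tendsto_zeroAvg (hq : Odd (Fintype.card F))
    (hratios : RatiosConjecture F) {h : ℝ → ℂ} (hc : Continuous h) {C : ℝ}
    (hC : ∀ x, ‖h x‖ ≤ C / (1 + x ^ 2)) :
    Tendsto (fun g : ℕ => zeroAvg F g h) atTop
      (𝓝 (∫ τ, h τ * ((1 - Real.sin (2 * Real.pi * τ) / (2 * Real.pi * τ) : ℝ) : ℂ))) := by
  have hi : Integrable h := (integrable_inv_one_add_sq.const_mul C).mono'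
    hc.aestronglyMeasurable (Eventually.of_forall fun x => by
      rw [← div_eq_mul_inv]; exact hC x)
  have hcut : ∀ T : ℝ, Continuous fun x => (cutoff T x : ℂ) * h x := fun T =>
    (Complex.continuous_ofReal.comp (continuous_cutoff T)).mul hc
  have hmeas : AEStronglyMeasurable (fun τ : ℝ =>
      ((1 - Real.sin (2 * Real.pi * τ) / (2 * Real.pi * τ) : ℝ) : ℂ)) volume := by
    refine Measurable.aestronglyMeasurable ?_
    fun_prop
  have hlim : Tendsto (fun n : ℕ => ∫ τ, (cutoff n τ * h τ) *
      ((1 - Real.sin (2 * Real.pi * τ) / (2 * Real.pi * τ) : ℝ) : ℂ)) atTop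
      (𝓝 (∫ τ, h τ * ((1 - Real.sin (2 * Real.pi * τ) / (2 * Real.pi * τ) : ℝ) : ℂ))) := by
    refine tendsto_integral_of_dominated_convergence (fun τ => ‖h τ‖ * 3)
      (fun n => (hcut n).aestronglyMeasurable.mul hmeas) (hi.norm.mul_const 3) (fun n => ?_)
      (Eventually.of_forall fun τ => ?_)
    · filter_upwards [ae_ne_zero] with τ hτ
      rw [norm_mul, Complex.norm_real, Real.norm_eq_abs]
      exact mul_le_mul (norm_cutoff_mul_le _ _ _) (abs_one_sub_sinc_le hτ) (abs_nonneg _)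
        (norm_nonneg _)
    · refine tendsto_const_nhds.congr' ?_
      filter_upwards [(tendsto_natCast_atTop_atTop (R := ℝ)).eventually_ge_atTop |τ|] with n hn
      rw [cutoff_eq_one hn, Complex.ofReal_one, one_mul]
  rw [Metric.tendsto_nhds]
  intro η hη
  have hT : Tendsto (fun n : ℕ => 2 * C / (n : ℝ) * 64) atTop (𝓝 0) := by
    simpa using (tendsto_const_div_atTop_nhds_zero_nat (2 * C)).mul_const 64
  obtain ⟨n, hn1, hn2, hn3⟩ := ((hlim.eventually (Metric.ball_mem_nhds _
    (show 0 < η / 3 by positivity))).and ((hT.eventually (gt_mem_nhds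
      (show 0 < η / 3 by positivity))).and (eventually_ge_atTop 1))).exists
  have hn0 : (0 : ℝ) < n := by exact_mod_cast hn3
  have hC0 : 0 ≤ C := by simpa using (norm_nonneg _).trans (hC 0)
  filter_upwards [(hratios.tendsto_zeroAvg_of_eq_zero hq (hcut n) (T := n + 1) (by linarith)
    (fun x hx => by rw [cutoff_eq_zero hx, Complex.ofReal_zero, zero_mul])).eventually
      (Metric.ball_mem_nhds _ (show 0 < η / 3 by positivity)),
    hratios.zeroAvg_cauchy_le hq hn0] with g h1 h2
  have h4 : dist (zeroAvg F g h) (zeroAvg F g fun x => (cutoff n x : ℂ) * h x) < η / 3 := by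
    rw [dist_eq_norm, ← zeroAvg_sub]
    refine (norm_zeroAvg_le g fun x _ => norm_sub_cutoff_mul_le hC hn0 x).trans_lt ?_
    rw [zeroAvg_const_mul]
    refine lt_of_le_of_lt ?_ hn2
    gcongr
  refine (dist_triangle4 _ _ _ _).trans_lt ((add_lt_add (add_lt_add h4 h1) hn1).trans_le ?_)
  linarith

/-- An ordinate is, up to the sign that evenness absorbs, arg v / log q, and rescaling by 2g log
q/(2π) turns it into (g/π) arg v. -/
theorem one_div_mul_oneLevelDensity_eq (hq : Odd (Fintype.card F)) (g : ℕ) {h : ℝ → ℂ}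
    (heven : ∀ x : ℝ, h (-x) = h x) :
    1 / ((ensemble F g).card : ℂ) * oneLevelDensity F g
      (fun t : ℝ => h (t * (2 * (g : ℝ) * Real.log (Fintype.card F)) / (2 * Real.pi))) =
        zeroAvg F g h := by
  have hl := (logCard_pos (F := F)).ne'
  have hπ := Real.pi_ne_zero
  rw [oneLevelDensity, zeroAvg, Complex.real_smul]
  push_cast
  rw [one_div]
  congr 1
  refine Finset.sum_congr rfl fun D hD => ?_
  rw [zeroSum_eq hq hD (φ := fun t : ℝ =>
    h (t * (2 * (g : ℝ) * Real.log (Fintype.card F)) / (2 * Real.pi)))]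
  · congr 1
    refine Multiset.map_congr rfl fun v _ => ?_
    congr 1
    rw [show Real.log (Fintype.card F) = logCard F from rfl]
    field_simp
  · intro x
    rw [← heven]
    congr 1
    ring

end Smoothing

end HyperellipticEnsemble

theorem mainTheorem3 (F : Type*) [Field F] [Fintype F] (hq : Odd (Fintype.card F))
    (hratios : RatiosConjecture F) :
    (∀ (δ : ℝ) (f : ℂ → ℂ), 0 < δ →
      DifferentiableOn ℂ f {z : ℂ | |z.im| < δ} →
      (∀ z : ℂ, |z.im| < δ → f (-z) = f z) →
      (∀ z : ℂ, |z.im| < δ →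
        f (z + ((2 * Real.pi / Real.log (Fintype.card F) : ℝ) : ℂ)) = f z) →
      (∀ g : ℕ, IntervalIntegrable
        (fun t : ℝ => f t * ∑ D ∈ ensemble F g, densityIntegrand D t) MeasureTheory.volume
        (-(Real.pi / Real.log (Fintype.card F))) (Real.pi / Real.log (Fintype.card F))) ∧
      (fun g : ℕ => oneLevelDensity F g (fun t : ℝ => f t)
        - 1 / (2 * (Real.pi : ℂ)) *
          ∫ t in (-(Real.pi / Real.log (Fintype.card F)))..(Real.pi / Real.log (Fintype.card F)),
            f t * ∑ D ∈ ensemble F g, densityIntegrand D t)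
        =o[atTop] (fun g : ℕ => (Fintype.card F : ℝ) ^ (2 * g + 1))) ∧
    (∀ h : ℝ → ℂ, Continuous h → (∀ x : ℝ, h (-x) = h x) →
      (∃ C : ℝ, ∀ x : ℝ, ‖h x‖ ≤ C / (1 + x ^ 2)) →
      Tendsto
        (fun g : ℕ => 1 / ((ensemble F g).card : ℂ) *
          oneLevelDensity F g
            (fun t : ℝ => h (t * (2 * (g : ℝ) * Real.log (Fintype.card F)) / (2 * Real.pi))))
        atTop
        (𝓝 (∫ τ : ℝ, h τ *
          ((1 - Real.sin (2 * Real.pi * τ) / (2 * Real.pi * τ) : ℝ) : ℂ)))) := by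
  refine ⟨fun δ f hδ hd heven hper => ⟨fun g => intervalIntegrable_density hδ hd hper heven g _ _,
    hratios.isLittleO_oneLevelDensity_sub hq hδ hd hper heven⟩, fun h hc heven hbound => ?_⟩
  obtain ⟨C, hC⟩ := hbound
  simp only [one_div_mul_oneLevelDensity_eq hq _ heven]
  exact hratios.tendsto_zeroAvg hq hc hC
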